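/- **Conventions.** For a finite set of oscillators with $[\mathsf a_\alpha,\bar{\mathsf a}_\beta]=\delta_{\alpha\beta}$ (all other commutators zero) let $\mathsf F$ be the Fock module with basis $|\vec m\rangle=\prod_\alpha \bar{\mathsf a}_\alpha^{m_\alpha}|0\rangle$, $\mathsf a_\alpha|0\rangle=0$, and put $\operatorname{tr}X=\sum_{\vec m}\langle \vec m|X|\vec m\rangle$ and $\widehat{\operatorname{tr}}_Y(X)=\operatorname{tr}(YX)/\operatorname{tr}(Y)$. For a matrix $L$ with entries in the oscillator algebra, $L^{\otimes N}=L\otimes\cdots\otimes L$ ($N\ge 0$ factors) is the tensor product on the matrix space, with the ordered product of operators on $\mathsf F$. Twists are $\tau_i=e^{h_i}$ with $h_i\in\mathbb C$, and $\tau_i^{X}=e^{h_iX}$ (for $X$ a scalar or a diagonal operator on $\mathsf F$). Let $t,x\in\mathbb C$. A particle-hole substitution (p.h.) on a set of oscillators is $\bar{\mathsf a}\mapsto-\mathsf a$, $\mathsf a\mapsto\bar{\mathsf a}$ for the oscillators of the set. Oscillators are taken with the labels they have before any substitution. For rectangular blocks $\mathbf A,\bar{\mathbf A}$ put $$\mathcal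 L_{u,v}=\begin{pmatrix}u-\bar{\mathbf A}\mathbf A&-\bar{\mathbf A}(u-v-\mathbf A\bar{\mathbf A})\\-\mathbf A&v+\mathbf A\bar{\mathbf A}\end{pmatrix},\quad L^{+}(x)=\begin{pmatrix}x-\bar{\mathbf A}\mathbf A&\bar{\mathbf A}\\-\mathbf A&1\end{pmatrix},\quad L^{-}(x)=\begin{pmatrix}1&\bar{\mathbf A}\\ \mathbf A&x+\mathbf A\bar{\mathbf A}\end{pmatrix}.$$ In each case below the traces defining $T^+$ and $\mathrm{ch}^+$ converge absolutely on the stated domain of twists, and there the stated formulas hold. In types $B,C,D$ the traces defining $Q_{(\pm,\dots,\pm)}$, $Q_1$, $Q_{\mathsf K}$ converge absolutely on the domain stated for them, their entries extend to rational functions of the $\tau_i$, regular wherever the stated products of twists are $\ne1$, and all $Q$-operators are understood as these rational functions. **Type A.** Let $I\subset\{1,\dots,n\}$, $1\le a=|I|<n$, $\bar I$ the complement, $\sigma_I$ the permutation mapping $1,\dots,a$ increasingly onto $I$ and $a+1,\dots,n$ increasingly onto $\bar I$, $B_I$ its permutation matrix ($B_Ie_i=e_{\sigma_I(i)}$). Let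 $\mathbf A=(\mathsf a_{j,i})$, $\bar{\mathbf A}=(\bar{\mathsf a}_{i,j})$, $i\le a<j$. Put $\mathcal L_I(x)=B_I\mathcal L_{x+t,\,x-a}B_I^{-1}$ with p.h. on the pairs with $\sigma_I(j)<\sigma_I(i)$, write $\mathcal L_I(x)=x+\sum e_{ij}\mathcal E^I_{ji}$, and set $$T^+_{I,t}(x)=\operatorname{tr}\prod_{i=1}^n\tau_i^{\mathcal E^I_{ii}}\,\mathcal L_I(x)^{\otimes N},\qquad \mathrm{ch}^+_{I,t}=\operatorname{tr}\prod_{i=1}^n\tau_i^{\mathcal E^I_{ii}} .$$ Let $L_I(x)=B_IL^+(x)B_I^{-1}$ with $\bar{\mathsf a}_{i,j}\mapsto\mathsf a_{j,i}$, $\mathsf a_{j,i}\mapsto-\bar{\mathsf a}_{i,j}$ for the pairs with $\sigma_I(j)<\sigma_I(i)$, and $Q_I(x)=\widehat{\operatorname{tr}}_{D_I}L_I(x)^{\otimes N}$, where $D_I$ is the product over the pairs, with $p=\sigma_I(i)\in I$, $q=\sigma_I(j)\in\bar I$, of $(\tau_q/\tau_p)^{\bar{\mathsf a}\mathsf a}$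 if $p<q$ and of $(\tau_p/\tau_q)^{\mathsf a\bar{\mathsf a}}$ if $p>q$. If for all $p\in I$, $q\in\bar I$ the one of $\tau_p,\tau_q$ with the smaller index has the larger modulus, then all these traces (also those for $Q_{\bar I}$) converge absolutely and $$T^+_{I,t}(x)=\mathrm{ch}^+_{I,t}\,Q_I(x+t)\,Q_{\bar I}(x-a),\qquad \mathrm{ch}^+_{I,t}=\prod_{i\in I}\tau_i^t\prod_{i\in I,\,j\in\bar I}\frac{(-1)^{\delta_{i>j}}\tau_i}{\tau_i-\tau_j}.$$ **Type C ($r\ge1$) and type D, spinorial nodes ($r\ge2$).** Let $e_1,\dots,e_r,e_{r'},\dots,e_{1'}$, $i'=2r+1-i$, be the basis of $\mathbb C^{2r}$, $\varepsilon=-1$ in type $C$ and $\varepsilon=+1$ in type $D$, and $\kappa=r+1$ in type $C$, $\kappa=r-1$ in type $D$. The oscillators are $(\mathsf a_{j'i},\bar{\mathsf a}_{ij'})$ with $i\le j$ (type $C$) resp. $i<j$ (type $D$), $1\le i,j\le r$. The blocks have entries $\mathbf A_{j'i}=\mathsf a_{j'i}$, $\mathbf A_{i'j}=-\varepsilon\,\mathsf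 a_{j'i}$, $\bar{\mathbf A}_{ij'}=\bar{\mathsf a}_{ij'}$, $\bar{\mathbf A}_{ji'}=-\varepsilon\,\bar{\mathsf a}_{ij'}$ for $i<j$, and $\mathbf A_{i'i}=\mathsf a_{i'i}$, $\bar{\mathbf A}_{ii'}=2\bar{\mathsf a}_{ii'}$ in type $C$, both $0$ in type $D$. For $\vec\mu\in\{\pm1\}^r$ let $B_{\vec\mu}=\prod_{\mu_i=-1}B_i$, $B_i=e_{ii'}+\varepsilon e_{i'i}+\sum_{j\ne i}(e_{jj}+e_{j'j'})$, and $\mathcal L_{\vec\mu}(x)=B_{\vec\mu}\mathcal L_{x+t,\,x-t-\kappa}B_{\vec\mu}^{-1}$ with p.h. on the pairs $i\le j$ (resp. $i<j$) with $\mu_i=-1$; write $\mathcal L_{\vec\mu}(x)=x+\sum e_{ij}\mathcal F^{\vec\mu}_{ji}$ and $$T^+_{\vec\mu,t}(x)=\operatorname{tr}\prod_{i=1}^r\tau_i^{\mathcal F^{\vec\mu}_{ii}}\,\mathcal L_{\vec\mu}(x)^{\otimes N},\qquad \mathrm{ch}^+_{\vec\mu,t}=\operatorname{tr}\prod_{i=1}^r\tau_i^{\mathcal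 F^{\vec\mu}_{ii}}.$$ Let $L_{(+,\dots,+)}(x)=L^+(x)$, and let $L_{(-,\dots,-)}(x)$ be $L^-(x)$ with blocks built from a second set of oscillators $(\mathsf a_{ij'},\bar{\mathsf a}_{j'i})$ by $\mathbf A_{j'i}=\mathsf a_{ij'}$, $\mathbf A_{i'j}=-\varepsilon\,\mathsf a_{ij'}$, $\bar{\mathbf A}_{ij'}=\bar{\mathsf a}_{j'i}$, $\bar{\mathbf A}_{ji'}=-\varepsilon\,\bar{\mathsf a}_{j'i}$ for $i<j$, and $\mathbf A_{i'i}=2\mathsf a_{ii'}$, $\bar{\mathbf A}_{ii'}=\bar{\mathsf a}_{i'i}$ in type $C$, both $0$ in type $D$. Let $Q_{(\pm,\dots,\pm)}(x)=\widehat{\operatorname{tr}}_{D_\pm}L_{(\pm,\dots,\pm)}(x)^{\otimes N}$ with $D_\pm$ the product of $(\tau_i\tau_j)^{-\bar{\mathsf a}\mathsf a}$ over the pairs; these traces converge absolutely if $|\tau_i\tau_j|>1$ for all $i\le j$ (resp. $i<j$), and are regular where all these $\tau_i\tau_j\ne1$. Put $$Q_{\vec\mu}(x)=B_{\vec\mu}^{\otimes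 N}\,Q_{(+,\dots,+)}(x)\,(B_{\vec\mu}^{\otimes N})^{-1}\Big|_{\tau_i\mapsto\tau_i^{-1}\text{ for }\mu_i=-1}.$$ If $|\tau_i\tau_j^{\mu_i\mu_j}|>1$ for all $i\le j$ in type $C$ (resp. all $i<j$ in type $D$), then $Q_{-\vec\mu}(x)=B_{\vec\mu}^{\otimes N}Q_{(-,\dots,-)}(x)(B_{\vec\mu}^{\otimes N})^{-1}|_{\tau_i\mapsto\tau_i^{-1}\text{ for }\mu_i=-1}$ and $$T^+_{\vec\mu,t}(x)=\mathrm{ch}^+_{\vec\mu,t}\,Q_{\vec\mu}(x+t)\,Q_{-\vec\mu}(x-t-\kappa),\qquad \mathrm{ch}^+_{\vec\mu,t}=\frac{\prod_{i=1}^r\tau_i^{\mu_i\left(t+(\kappa-i)\delta^-_{\mu_i}+\sum_{k=1}^i\delta^-_{\mu_k}\right)}}{\prod(1-\tau_i^{-1}\tau_j^{-\mu_i\mu_j})},$$ with $\delta^-_{\mu}=1$ if $\mu=-1$ and $0$ otherwise, the product in the denominator being over $i\le j$ (type $C$) resp. $i<j$ (type $D$). **Types B and D, first node ($\mathsf K\ge5$,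 $r=\lfloor\mathsf K/2\rfloor$).** Put $i'=\mathsf K+1-i$, let $\wp=(\bar{\mathsf a}_2,\dots,\bar{\mathsf a}_{\mathsf K-1})$, $\mathbf w=(\mathsf a_2,\dots,\mathsf a_{\mathsf K-1})^T$, $\mathrm J$ the antidiagonal matrix of size $\mathsf K-2$, $U(\wp)=\begin{pmatrix}1&\wp&-\frac12\wp\mathrm J\wp^T\\0&1&-\mathrm J\wp^T\\0&0&1\end{pmatrix}$ and $$\mathfrak L_{x_1,x_2}(x)=U(\wp)\begin{pmatrix}(x-x_1)(x-x_1-\frac{\mathsf K}2+2)&0&0\\-(x-x_1)\mathbf w&(x-x_1)(x-x_2)&0\\-\frac12\mathbf w^T\mathrm J\mathbf w&(x-x_2)\mathbf w^T\mathrm J&(x-x_2)(x-x_2-\frac{\mathsf K}2+2)\end{pmatrix}U(-\wp).$$ Let $\mathcal L(x)=\mathfrak L_{x_1,x_2}(x+\frac{x_1+x_2-1}2)$ with $x_1=1-t-\frac{\mathsf K}2$, $x_2=0$. Let $\hat B_1=\mathrm{Id}$, $\hat B_{1'}=\sum_je_{jj'}$, and $\hat B_k=e_{1k}+e_{k1}+e_{1'k'}+e_{k'1'}+\sum_{1<j<1',\,j\ne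 k,k'}b_j$, where $b_j=e_{jj}$ for $1<k\le r$ and $b_j=e_{jj'}$ for $r'\le k<1'$. For $k\in\{1,\dots,r\}\cup\{r',\dots,1'\}$ let $\mathcal L_k(x)=\hat B_k\mathcal L(x)\hat B_k^{-1}$ with p.h. on the oscillators with $1<j\le k$ if $k\le r$, resp. $k'<j<1'$ if $k\ge r'$; let $\mathcal F^k_{ii}$ be the coefficient of $x$ in its $(i,i)$ entry, and $$T^+_{k,t}(x)=\operatorname{tr}\prod_{i=1}^r\tau_i^{\mathcal F^k_{ii}}\,\mathcal L_k(x)^{\otimes N},\qquad \mathrm{ch}^+_{k,t}=\operatorname{tr}\prod_{i=1}^r\tau_i^{\mathcal F^k_{ii}}.$$ Let $$L_1(x)=\begin{pmatrix}x^2+x(2-\frac{\mathsf K}2-\wp\mathbf w)+\frac14\wp\mathrm J\wp^T\mathbf w^T\mathrm J\mathbf w&x\wp-\frac12\wp\mathrm J\wp^T\mathbf w^T\mathrm J&-\frac12\wp\mathrm J\wp^T\\-x\mathbf w+\frac12\mathrm J\wp^T\mathbf w^T\mathrm J\mathbf w&x-\mathrm J\wp^T\mathbf w^T\mathrm J&-\mathrm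 J\wp^T\\-\frac12\mathbf w^T\mathrm J\mathbf w&\mathbf w^T\mathrm J&1\end{pmatrix},$$ $$L_{\mathsf K}(x)=\begin{pmatrix}1&\wp&-\frac12\wp\mathrm J\wp^T\\\mathbf w&x+\mathbf w\wp&-x\mathrm J\wp^T-\frac12\mathbf w\wp\mathrm J\wp^T\\-\frac12\mathbf w^T\mathrm J\mathbf w&-x\mathbf w^T\mathrm J-\frac12\mathbf w^T\mathrm J\mathbf w\,\wp&x^2+x(2-\frac{\mathsf K}2+\mathbf w^T\wp^T)+\frac14\mathbf w^T\mathrm J\mathbf w\,\wp\mathrm J\wp^T\end{pmatrix},$$ $Q_1(x)=\widehat{\operatorname{tr}}_{D_1}L_1(x)^{\otimes N}$ and $Q_{\mathsf K}(x)=\widehat{\operatorname{tr}}_{D_1}L_{\mathsf K}(x)^{\otimes N}$ with $D_1=\prod_{j=2}^{\mathsf K-1}(\tau_j/\tau_1)^{\bar{\mathsf a}_j\mathsf a_j}$, where $\tau_{j'}=\tau_j^{-1}$ and $\tau_{r+1}=1$ if $\mathsf K=2r+1$; these traces converge absolutely if $|\tau_j|<|\tau_1|$ for $1<j<\mathsf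 K$, and are regular where $\tau_j\ne\tau_1$ for $1<j<\mathsf K$. For $1\le k\le r$ put $$Q_k(x)=\hat B_k^{\otimes N}Q_1(x)(\hat B_k^{\otimes N})^{-1}\big|_{\tau_1\leftrightarrow\tau_k},\qquad Q_{k'}(x)=\hat B_{k'}^{\otimes N}\,Q_1(x)\big|_{\tau_i\mapsto\tau_i^{-1}\ \forall i}\,(\hat B_{k'}^{\otimes N})^{-1}\big|_{\tau_1\leftrightarrow\tau_k}.$$ If $|\tau_k|<|\tau_\ell|$ for $\ell<k$, $|\tau_\ell|<|\tau_k|$ for $k<\ell\le r$, $|\tau_k\tau_\ell|>1$ for $\ell\ne k$ and, for odd $\mathsf K$, $|\tau_k|>1$, then $Q_{k'}(x)=\hat B_k^{\otimes N}Q_{\mathsf K}(x)(\hat B_k^{\otimes N})^{-1}|_{\tau_1\leftrightarrow\tau_k}$, $Q_k(x)=\hat B_{k'}^{\otimes N}Q_{\mathsf K}(x)|_{\tau_i\mapsto\tau_i^{-1}\ \forall i}(\hat B_{k'}^{\otimes N})^{-1}|_{\tau_1\leftrightarrow\tau_k}$, and $$T^+_{k,t}(x)=\mathrm{ch}^+_{k,t}\,Q_k\big(x-1+\tfrac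 t2+\tfrac{\mathsf K}4\big)Q_{k'}\big(x-\tfrac t2-\tfrac{\mathsf K}4\big),\qquad T^+_{k',t}(x)=\mathrm{ch}^+_{k',t}\,Q_{k'}\big(x-1+\tfrac t2+\tfrac{\mathsf K}4\big)Q_k\big(x-\tfrac t2-\tfrac{\mathsf K}4\big),$$ $$\mathrm{ch}^+_{k,t}=\frac{\tau_1^{-1}\cdots\tau_{k-1}^{-1}\,\tau_k^{t+k-1}}{\Delta_k},\qquad \mathrm{ch}^+_{k',t}=\frac{\tau_1^{-1}\cdots\tau_{k-1}^{-1}\,\tau_k^{k+1-\mathsf K-t}}{\Delta_k},$$ $$\Delta_k=\big(1-\tau_k^{-1}\big)^{\delta}\prod_{\ell<k}\Big(1-\frac{\tau_k}{\tau_\ell}\Big)\prod_{k<\ell\le r}\Big(1-\frac{\tau_\ell}{\tau_k}\Big)\prod_{\ell\ne k}\Big(1-\frac1{\tau_k\tau_\ell}\Big),$$ with $\delta=1$ for odd $\mathsf K$ and $\delta=0$ for even $\mathsf K$. -/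

import Mathlib

noncomputable section

namespace BaxterQ

/-! ## Oscillators on the Fock module -/

section Fock

variable {ι : Type}

/-- The Fock module of the oscillator algebra with generators `a_i`, `ā_i` (`i : ι`):
polynomials in the pairwise commuting creation operators, the vacuum being `1` and the
basis state `|m⟩ = ∏ ā_i ^ (m i) |0⟩` being `monomial m 1`. -/
abbrev Fock (ι : Type) : Type := MvPolynomial ι ℂ

/-- Linear operators on the Fock module. -/
abbrev FockOp (ι : Type) : Type := Module.End ℂ (Fock ι)

/-- The creation operator `ā_i`. -/
def cr (i : ι) : FockOp ι := LinearMap.mulLeft ℂ (MvPolynomial.X i)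

/-- The annihilation operator `a_i`. -/
def an (i : ι) : FockOp ι := (MvPolynomial.pderiv i : Derivation ℂ (Fock ι) (Fock ι)).toLinearMap

/-- The oscillator relation `[a_i, ā_j] = δ_ij`. -/
theorem an_mul_cr_sub [DecidableEq ι] (i j : ι) :
    an i * cr j - cr j * an i = if i = j then 1 else 0 := by
  ext m : 2
  by_cases h : i = j
  · subst h
    simp [an, cr]
  · have h' : j ≠ i := fun e => h e.symm
    simp [an, cr, h, MvPolynomial.pderiv_X_of_ne h']

/-- The annihilation operators kill the vacuum. -/
theorem an_vacuum (i : ι) : an i (1 : Fock ι) = 0 := by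
  simp [an]

/-- The diagonal matrix coefficient `⟨m|X|m⟩`. -/
def diagCoeff (X : FockOp ι) (m : ι →₀ ℕ) : ℂ :=
  MvPolynomial.coeff m (X (MvPolynomial.monomial m 1))

/-- The trace `∑_m ⟨m|X|m⟩` over the Fock module
(meaningful when `diagCoeff X` is summable). -/
def fockTrace (X : FockOp ι) : ℂ := ∑' m, diagCoeff X m

/-- The exponential of an operator `X` that is diagonal in the basis `|m⟩`. It is only applied to
such operators, namely to linear combinations of constants and of products `ā_i a_i`, `a_i ā_i`. -/
def expDiag (X : FockOp ι) : FockOp ι :=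
  (MvPolynomial.basisMonomials ι ℂ).constr ℂ fun m =>
    MvPolynomial.monomial m (Complex.exp (diagCoeff X m))

theorem expDiag_apply (X : FockOp ι) (m : ι →₀ ℕ) (c : ℂ)
    (h : X (MvPolynomial.monomial m 1) = c • MvPolynomial.monomial m 1) :
    expDiag X (MvPolynomial.monomial m 1) = Complex.exp c • MvPolynomial.monomial m 1 := by
  have h1 : diagCoeff X m = c := by
    classical
    rw [diagCoeff, h, MvPolynomial.coeff_smul, MvPolynomial.coeff_monomial, if_pos rfl, smul_eq_mul,
      mul_one]
  have h2 := (MvPolynomial.basisMonomials ι ℂ).constr_basis ℂ (fun m =>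
    (MvPolynomial.monomial m (Complex.exp (diagCoeff X m)) : Fock ι)) m
  rw [MvPolynomial.coe_basisMonomials] at h2
  rw [expDiag, h2, h1]
  simp [MvPolynomial.smul_monomial]

end Fock

/-! ## Monodromy matrices and traces

`End(ℂ^K)^{⊗N}` is realised as matrices with rows and columns indexed by `Fin N → K`. -/

section Trace

variable {ι K R : Type}

/-- The monodromy matrix `L ⊗ ⋯ ⊗ L` (`N` factors): tensor product in the quantum space,
ordered product of the matrix entries in the auxiliary space. -/
def monodromy [Ring R] (L : Matrix K K R) (N : ℕ) : Matrix (Fin N → K) (Fin N → K) R :=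
  Matrix.of fun k l => (List.ofFn fun s => L (k s) (l s)).prod

/-- `tr (Y · L ⊗ ⋯ ⊗ L)`, the trace being taken over the Fock module. -/
def twistedTrace (Y : FockOp ι) (L : Matrix K K (FockOp ι)) (N : ℕ) :
    Matrix (Fin N → K) (Fin N → K) ℂ :=
  Matrix.of fun k l => fockTrace (Y * monodromy L N k l)

/-- The normalized trace `tr (Y · L ⊗ ⋯ ⊗ L) / tr Y`. -/
def normTrace (Y : FockOp ι) (L : Matrix K K (FockOp ι)) (N : ℕ) :
    Matrix (Fin N → K) (Fin N → K) ℂ :=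
  (fockTrace Y)⁻¹ • twistedTrace Y L N

/-- The series defining `tr Y` and all entries of `tr (Y · L ⊗ ⋯ ⊗ L)` converge absolutely. -/
def TraceConverges (Y : FockOp ι) (L : Matrix K K (FockOp ι)) (N : ℕ) : Prop :=
  Summable (diagCoeff Y) ∧ ∀ k l, Summable (diagCoeff (Y * monodromy L N k l))

/-- The normalized trace is well defined. -/
def NormTraceConverges (Y : FockOp ι) (L : Matrix K K (FockOp ι)) (N : ℕ) : Prop :=
  TraceConverges Y L N ∧ fockTrace Y ≠ 0

/-- `B ⊗ ⋯ ⊗ B` (`N` factors). -/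
def tensorPow (B : Matrix K K ℂ) (N : ℕ) : Matrix (Fin N → K) (Fin N → K) ℂ :=
  Matrix.of fun k l => ∏ s, B (k s) (l s)

variable [Fintype K] [DecidableEq K]

/-- `(B ⊗ ⋯ ⊗ B) Q (B ⊗ ⋯ ⊗ B)⁻¹`. -/
def conjQ (B : Matrix K K ℂ) (N : ℕ) (Q : Matrix (Fin N → K) (Fin N → K) ℂ) :
    Matrix (Fin N → K) (Fin N → K) ℂ :=
  tensorPow B N * Q * (tensorPow B N)⁻¹

/-- `B L B⁻¹` for a numerical matrix `B` and a Lax matrix `L`. -/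
def conjLax [Ring R] [Algebra ℂ R] (B : Matrix K K ℂ) (L : Matrix K K R) : Matrix K K R :=
  B.map (algebraMap ℂ R) * L * B⁻¹.map (algebraMap ℂ R)

end Trace

/-! ## Rational continuation in the twist parameters

The twist parameters are `τ_i = exp (h_i)`, so that `τ_i ^ c = exp (c h_i)`. -/

section Continuation

variable {σ S : Type}

/-- On `V`, the entries of `g` are regular rational functions of the `τ_i = exp (h_i)`; on `U` they
coincide with those of `f`. -/
def IsRatCont (U V : Set (σ → ℂ)) (f g : (σ → ℂ) → Matrix S S ℂ) : Prop :=
  (∀ k l, ∃ P D : MvPolynomial σ ℂ, ∀ h ∈ V,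
    MvPolynomial.eval (fun i => Complex.exp (h i)) D ≠ 0 ∧
    g h k l = MvPolynomial.eval (fun i => Complex.exp (h i)) P /
      MvPolynomial.eval (fun i => Complex.exp (h i)) D) ∧
  ∀ h ∈ U, g h = f h

/-- The rational continuation is unique. -/
theorem IsRatCont.unique [Fintype σ] {U V : Set (σ → ℂ)} (hU : IsOpen U) (hne : U.Nonempty)
    (hUV : U ⊆ V) {f g₁ g₂ : (σ → ℂ) → Matrix S S ℂ}
    (h₁ : IsRatCont U V f g₁) (h₂ : IsRatCont U V f g₂) : ∀ h ∈ V, g₁ h = g₂ h := by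
  intro h hh
  ext k l
  obtain ⟨P₁, D₁, H₁⟩ := h₁.1 k l
  obtain ⟨P₂, D₂, H₂⟩ := h₂.1 k l
  have key : P₁ * D₂ = P₂ * D₁ := by
    obtain ⟨u, hu⟩ := hne
    obtain ⟨ε, hε, hball⟩ := Metric.isOpen_iff.1 hU u hu
    refine MvPolynomial.funext_set (fun i => Complex.exp '' Metric.ball (u i) ε) (fun i => ?_) ?_
    · exact infinite_of_mem_nhds (Complex.exp (u i))
        ((Complex.isOpenMap_exp _ Metric.isOpen_ball).mem_nhds
          ⟨u i, Metric.mem_ball_self hε, rfl⟩)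
    · intro x hx
      choose v hv hvx using fun i => hx i (Set.mem_univ i)
      have hvU : v ∈ U := hball (by
        rw [Metric.mem_ball, dist_pi_lt_iff hε]
        exact fun i => hv i)
      have hx' : x = fun i => Complex.exp (v i) := funext fun i => (hvx i).symm
      have e₁ := H₁ v (hUV hvU)
      have e₂ := H₂ v (hUV hvU)
      have e : g₁ v k l = g₂ v k l := by rw [h₁.2 v hvU, h₂.2 v hvU]
      rw [e₁.2, e₂.2, div_eq_div_iff e₁.1 e₂.1] at e
      rw [hx', map_mul, map_mul]
      exact e
  have e₁ := H₁ h hh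
  have e₂ := H₂ h hh
  rw [e₁.2, e₂.2, div_eq_div_iff e₁.1 e₂.1, ← map_mul, ← map_mul, key]

open Classical in
/-- The rational continuation to `V` of a function `f` given on `U`
(junk if there is none). -/
def ratCont (U V : Set (σ → ℂ)) (f : (σ → ℂ) → Matrix S S ℂ) : (σ → ℂ) → Matrix S S ℂ :=
  if H : ∃ g, IsRatCont U V f g then H.choose else 0

end Continuation

/-! ## Linear Lax matrices in block form and particle-hole transformations -/

section Linear

variable {p q R ι : Type} [Fintype p] [Fintype q] [DecidableEq p] [DecidableEq q]
  [Ring R] [Algebra ℂ R]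

/-- The non-degenerate linear Lax matrix with blocks `u - Ā A`, `-Ā (u - v - A Ā)`, `-A`,
`v + A Ā`. -/
def laxLin (A : Matrix q p R) (Ab : Matrix p q R) (u v : ℂ) : Matrix (p ⊕ q) (p ⊕ q) R :=
  Matrix.fromBlocks (u • (1 : Matrix p p R) - Ab * A) (-(Ab * ((u - v) • (1 : Matrix q q R) - A * Ab)))
    (-A) (v • (1 : Matrix q q R) + A * Ab)

/-- The degenerate linear Lax matrix with blocks `x - Ā A`, `Ā`, `-A`, `1`. -/
def laxPlus (A : Matrix q p R) (Ab : Matrix p q R) (x : ℂ) : Matrix (p ⊕ q) (p ⊕ q) R :=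
  Matrix.fromBlocks (x • (1 : Matrix p p R) - Ab * A) Ab (-A) 1

/-- The degenerate linear Lax matrix with blocks `1`, `Ā`, `A`, `y + A Ā`. -/
def laxMinus (A : Matrix q p R) (Ab : Matrix p q R) (y : ℂ) : Matrix (p ⊕ q) (p ⊕ q) R :=
  Matrix.fromBlocks 1 Ab A (y • (1 : Matrix q q R) + A * Ab)

/-- Image of `a_i` under the particle-hole automorphism `ā_i ↦ -a_i`, `a_i ↦ ā_i` of the
oscillators in `s`. -/
def anPH (s : ι → Prop) [DecidablePred s] (i : ι) : FockOp ι := if s i then cr i else an i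

/-- Image of `ā_i` under the particle-hole automorphism `ā_i ↦ -a_i`, `a_i ↦ ā_i` of the
oscillators in `s`. -/
def crPH (s : ι → Prop) [DecidablePred s] (i : ι) : FockOp ι := if s i then -an i else cr i

/-- Image of `a_i` under the particle-hole automorphism `ā_i ↦ a_i`, `a_i ↦ -ā_i` of the
oscillators in `s`. -/
def anPH' (s : ι → Prop) [DecidablePred s] (i : ι) : FockOp ι := if s i then -cr i else an i

/-- Image of `ā_i` under the particle-hole automorphism `ā_i ↦ a_i`, `a_i ↦ -ā_i` of the
oscillators in `s`. -/
def crPH' (s : ι → Prop) [DecidablePred s] (i : ι) : FockOp ι := if s i then an i else cr i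

end Linear

/-! ## Type A -/

section TypeA

variable {n : ℕ}

/-- The permutation `σ_I`: it maps `1, …, |I|` increasingly onto `I` and `|I| + 1, …, n`
increasingly onto the complement of `I`. -/
def sigmaA (I : Finset (Fin n)) : Fin I.card ⊕ Fin Iᶜ.card ≃ Fin n := finSumEquivOfFinset rfl rfl

/-- The labels `(i, j)`, `i ≤ |I| < j`, of the oscillators `(a_{j,i}, ā_{i,j})`. -/
abbrev OscA (I : Finset (Fin n)) : Type := Fin I.card × Fin Iᶜ.card

/-- `σ_I(i)`, an element of `I`. -/
def inA (I : Finset (Fin n)) (p : OscA I) : Fin n := sigmaA I (Sum.inl p.1)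

/-- `σ_I(j)`, an element of the complement of `I`. -/
def outA (I : Finset (Fin n)) (p : OscA I) : Fin n := sigmaA I (Sum.inr p.2)

/-- The oscillators subject to the particle-hole transformation: `σ_I(j) < σ_I(i)`. -/
abbrev flipA (I : Finset (Fin n)) (p : OscA I) : Prop := outA I p < inA I p

/-- The Lax matrix `𝓛_I(x) = B_I 𝓛_a(x) B_I⁻¹ |_{p.h.}`, `a = |I|`; conjugation by the permutation
matrix `B_I` is reindexing along `σ_I`. -/
def laxA (I : Finset (Fin n)) (t x : ℂ) : Matrix (Fin n) (Fin n) (FockOp (OscA I)) :=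
  Matrix.reindex (sigmaA I) (sigmaA I)
    (laxLin (Matrix.of fun j i => anPH (flipA I) (i, j)) (Matrix.of fun i j => crPH (flipA I) (i, j))
      (x + t) (x - (I.card : ℂ)))

/-- The twist `∏ τ_i ^ {𝓔^I_ii}`, where `𝓛_I(x) = x + ∑ e_ij 𝓔^I_ji`. -/
def twistA (I : Finset (Fin n)) (t : ℂ) (h : Fin n → ℂ) : FockOp (OscA I) :=
  expDiag (∑ i, h i • laxA I t 0 i i)

/-- The degenerate Lax matrix `L_I(x)`. -/
def laxQA (I : Finset (Fin n)) (x : ℂ) : Matrix (Fin n) (Fin n) (FockOp (OscA I)) :=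
  Matrix.reindex (sigmaA I) (sigmaA I)
    (laxPlus (Matrix.of fun j i => anPH' (flipA I) (i, j))
      (Matrix.of fun i j => crPH' (flipA I) (i, j)) x)

/-- The twist `D_I`: the product over `i ∈ I`, `j ∉ I` of `(τ_j / τ_i) ^ (ā_ij a_ji)` for `i < j` and
of `(τ_i / τ_j) ^ (a_ji ā_ij)` for `i > j`. -/
def twistQA (I : Finset (Fin n)) (h : Fin n → ℂ) : FockOp (OscA I) :=
  expDiag (∑ p, if outA I p < inA I p then (h (inA I p) - h (outA I p)) • (an p * cr p)
    else (h (outA I p) - h (inA I p)) • (cr p * an p))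

/-- The transfer matrix `T⁺_{I,t}(x)`. -/
def TA (I : Finset (Fin n)) (N : ℕ) (t x : ℂ) (h : Fin n → ℂ) :
    Matrix (Fin N → Fin n) (Fin N → Fin n) ℂ :=
  twistedTrace (twistA I t h) (laxA I t x) N

/-- The character `ch⁺_{I,t}`. -/
def chA (I : Finset (Fin n)) (t : ℂ) (h : Fin n → ℂ) : ℂ := fockTrace (twistA I t h)

/-- The `Q`-operator `Q_I(x)`. -/
def QA (I : Finset (Fin n)) (N : ℕ) (x : ℂ) (h : Fin n → ℂ) :
    Matrix (Fin N → Fin n) (Fin N → Fin n) ℂ :=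
  normTrace (twistQA I h) (laxQA I x) N

/-- The twists for which the traces labelled by `I` converge: for `i ∈ I`, `j ∉ I` the one of
`τ_i, τ_j` with the smaller index has the larger modulus. -/
def domA (I : Finset (Fin n)) : Set (Fin n → ℂ) :=
  {h | ∀ i ∈ I, ∀ j ∉ I, (i < j → (h j).re < (h i).re) ∧ (j < i → (h i).re < (h j).re)}

end TypeA

/-! ## Types C and D (linear Lax matrices)

The standard basis `e_1, …, e_r, e_{r'}, …, e_{1'}` of `ℂ^{2r}` is labelled by `Fin r ⊕ Fin r`:
`inl i` stands for `e_i` and `inr i` for `e_{i'}`. -/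

section TypesCD

variable {r : ℕ}

/-- The endomorphism `B_μ = ∏_{μ_i = -1} B_i` with
`B_i = e_{ii'} + ε e_{i'i} + ∑_{j ≠ i} (e_jj + e_{j'j'})`. -/
def weylMat (ε : ℂ) (μ : Fin r → ℤˣ) : Matrix (Fin r ⊕ Fin r) (Fin r ⊕ Fin r) ℂ :=
  Matrix.fromBlocks
    (Matrix.diagonal fun i => if μ i = 1 then 1 else 0)
    (Matrix.diagonal fun i => if μ i = 1 then 0 else 1)
    (Matrix.diagonal fun i => if μ i = 1 then 0 else ε)
    (Matrix.diagonal fun i => if μ i = 1 then 1 else 0)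

/-- `μ_i` as a complex number. -/
def sgn (μ : Fin r → ℤˣ) (i : Fin r) : ℂ := ((μ i : ℤ) : ℂ)

/-- `δ_{μ_i}^-`. -/
def neg (μ : Fin r → ℤˣ) (i : Fin r) : ℂ := if μ i = -1 then 1 else 0

/-- The substitution `τ_i ↦ τ_i⁻¹` for all `i` with `μ_i = -1`. -/
def flipTwist (μ : Fin r → ℤˣ) (h : Fin r → ℂ) : Fin r → ℂ := fun i => sgn μ i * h i

/-- Labels `i ≤ j` of the oscillators `(a_{j',i}, ā_{i,j'})` in type C. -/
abbrev OscC (r : ℕ) : Type := {p : Fin r × Fin r // p.1 ≤ p.2}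

/-- Labels `i < j` of the oscillators `(a_{j',i}, ā_{i,j'})` in type D. -/
abbrev OscD (r : ℕ) : Type := {p : Fin r × Fin r // p.1 < p.2}

/-- The block of type C with `(i, j')` and `(j, i')` entries `f (i, j)` for `i < j`,
and `(i, i')` entries `c f (i, i)`. Equally the block with `(j', i)` and `(i', j)` entries
`f (i, j)`. -/
def symMat {R : Type} [Ring R] [Algebra ℂ R] (c : ℂ) (f : OscC r → R) : Matrix (Fin r) (Fin r) R :=
  Matrix.of fun i j => (if i = j then c else 1) • f ⟨(min i j, max i j), min_le_max⟩

/-- The block of type D with `(i, j')` entry `f (i, j)` and `(j, i')` entry `-f (i, j)`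
for `i < j`, and `(i, i')` entries `0`. -/
def altMat {R : Type} [Ring R] (f : OscD r → R) : Matrix (Fin r) (Fin r) R :=
  Matrix.of fun i j =>
    if hij : i < j then f ⟨(i, j), hij⟩ else if hji : j < i then -f ⟨(j, i), hji⟩ else 0

/-- The Lax matrix `𝓛_μ(x) = B_μ 𝓛(x) B_μ⁻¹ |_{p.h.}` of type C. -/
def laxC (μ : Fin r → ℤˣ) (t x : ℂ) : Matrix (Fin r ⊕ Fin r) (Fin r ⊕ Fin r) (FockOp (OscC r)) :=
  conjLax (weylMat (-1) μ)
    (laxLin (symMat 1 (anPH fun p : OscC r => μ p.1.1 = -1))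
      (symMat 2 (crPH fun p : OscC r => μ p.1.1 = -1)) (x + t) (x - t - r - 1))

/-- The Lax matrix `𝓛_μ(x) = B_μ 𝓛(x) B_μ⁻¹ |_{p.h.}` of type D. -/
def laxD (μ : Fin r → ℤˣ) (t x : ℂ) : Matrix (Fin r ⊕ Fin r) (Fin r ⊕ Fin r) (FockOp (OscD r)) :=
  conjLax (weylMat 1 μ)
    (laxLin (altMat (anPH fun p : OscD r => μ p.1.1 = -1)).transpose
      (altMat (crPH fun p : OscD r => μ p.1.1 = -1)) (x + t) (x - t - r + 1))

/-- The twist `∏_{i ≤ r} τ_i ^ {𝓕^μ_ii}`, where `𝓛_μ(x) = x + ∑ e_ij 𝓕^μ_ji`, in type C. -/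
def twistC (μ : Fin r → ℤˣ) (t : ℂ) (h : Fin r → ℂ) : FockOp (OscC r) :=
  expDiag (∑ i : Fin r, h i • laxC μ t 0 (Sum.inl i) (Sum.inl i))

/-- The twist `∏_{i ≤ r} τ_i ^ {𝓕^μ_ii}`, where `𝓛_μ(x) = x + ∑ e_ij 𝓕^μ_ji`, in type D. -/
def twistD (μ : Fin r → ℤˣ) (t : ℂ) (h : Fin r → ℂ) : FockOp (OscD r) :=
  expDiag (∑ i : Fin r, h i • laxD μ t 0 (Sum.inl i) (Sum.inl i))

/-- The degenerate Lax matrix `L_{(+,…,+)}(x)` of type C. -/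
def laxPlusC (r : ℕ) (x : ℂ) : Matrix (Fin r ⊕ Fin r) (Fin r ⊕ Fin r) (FockOp (OscC r)) :=
  laxPlus (symMat 1 an) (symMat 2 cr) x

/-- The degenerate Lax matrix `L_{(-,…,-)}(x)` of type C; the label `(i, j)` now stands for the
oscillators `(a_{i,j'}, ā_{j',i})`. -/
def laxMinusC (r : ℕ) (x : ℂ) : Matrix (Fin r ⊕ Fin r) (Fin r ⊕ Fin r) (FockOp (OscC r)) :=
  laxMinus (symMat 2 an) (symMat 1 cr) x

/-- The degenerate Lax matrix `L_{(+,…,+)}(x)` of type D. -/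
def laxPlusD (r : ℕ) (x : ℂ) : Matrix (Fin r ⊕ Fin r) (Fin r ⊕ Fin r) (FockOp (OscD r)) :=
  laxPlus (altMat an).transpose (altMat cr) x

/-- The degenerate Lax matrix `L_{(-,…,-)}(x)` of type D; the label `(i, j)` now stands for the
oscillators `(a_{i,j'}, ā_{j',i})`. -/
def laxMinusD (r : ℕ) (x : ℂ) : Matrix (Fin r ⊕ Fin r) (Fin r ⊕ Fin r) (FockOp (OscD r)) :=
  laxMinus (altMat an).transpose (altMat cr) x

/-- The twists `D_{(+,…,+)}` and `D_{(-,…,-)}` of type C: the product of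
`(τ_i τ_j) ^ {-ā a}` over the oscillators labelled by `(i, j)`. -/
def twistQC (h : Fin r → ℂ) : FockOp (OscC r) :=
  expDiag (∑ p : OscC r, (-(h p.1.1 + h p.1.2)) • (cr p * an p))

/-- The twists `D_{(+,…,+)}` and `D_{(-,…,-)}` of type D: the product of
`(τ_i τ_j) ^ {-ā a}` over the oscillators labelled by `(i, j)`. -/
def twistQD (h : Fin r → ℂ) : FockOp (OscD r) :=
  expDiag (∑ p : OscD r, (-(h p.1.1 + h p.1.2)) • (cr p * an p))

/-- Twists for which the traces defining `Q_{(±,…,±)}` converge in type C. -/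
def domQC (r : ℕ) : Set (Fin r → ℂ) := {h | ∀ i j, i ≤ j → 0 < (h i + h j).re}

/-- Twists at which `Q_{(±,…,±)}` is regular in type C: `τ_i τ_j ≠ 1`. -/
def regQC (r : ℕ) : Set (Fin r → ℂ) := {h | ∀ i j, i ≤ j → Complex.exp (h i + h j) ≠ 1}

/-- Twists for which the traces defining `Q_{(±,…,±)}` converge in type D. -/
def domQD (r : ℕ) : Set (Fin r → ℂ) := {h | ∀ i j, i < j → 0 < (h i + h j).re}

/-- Twists at which `Q_{(±,…,±)}` is regular in type D: `τ_i τ_j ≠ 1`. -/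
def regQD (r : ℕ) : Set (Fin r → ℂ) := {h | ∀ i j, i < j → Complex.exp (h i + h j) ≠ 1}

/-- Twists for which the traces labelled by `μ` converge in type C. -/
def domC (μ : Fin r → ℤˣ) : Set (Fin r → ℂ) :=
  {h | ∀ i j, i ≤ j → 0 < (h i + sgn μ i * sgn μ j * h j).re}

/-- Twists for which the traces labelled by `μ` converge in type D. -/
def domD (μ : Fin r → ℤˣ) : Set (Fin r → ℂ) :=
  {h | ∀ i j, i < j → 0 < (h i + sgn μ i * sgn μ j * h j).re}

/-- The `Q`-operator `Q_{(+,…,+)}(x)` of type C, as a rational function of the twist. -/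
def QplusC (r N : ℕ) (x : ℂ) :
    (Fin r → ℂ) → Matrix (Fin N → Fin r ⊕ Fin r) (Fin N → Fin r ⊕ Fin r) ℂ :=
  ratCont (domQC r) (regQC r) fun h => normTrace (twistQC h) (laxPlusC r x) N

/-- The `Q`-operator `Q_{(-,…,-)}(x)` of type C, as a rational function of the twist. -/
def QminusC (r N : ℕ) (x : ℂ) :
    (Fin r → ℂ) → Matrix (Fin N → Fin r ⊕ Fin r) (Fin N → Fin r ⊕ Fin r) ℂ :=
  ratCont (domQC r) (regQC r) fun h => normTrace (twistQC h) (laxMinusC r x) N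

/-- The `Q`-operator `Q_{(+,…,+)}(x)` of type D, as a rational function of the twist. -/
def QplusD (r N : ℕ) (x : ℂ) :
    (Fin r → ℂ) → Matrix (Fin N → Fin r ⊕ Fin r) (Fin N → Fin r ⊕ Fin r) ℂ :=
  ratCont (domQD r) (regQD r) fun h => normTrace (twistQD h) (laxPlusD r x) N

/-- The `Q`-operator `Q_{(-,…,-)}(x)` of type D, as a rational function of the twist. -/
def QminusD (r N : ℕ) (x : ℂ) :
    (Fin r → ℂ) → Matrix (Fin N → Fin r ⊕ Fin r) (Fin N → Fin r ⊕ Fin r) ℂ :=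
  ratCont (domQD r) (regQD r) fun h => normTrace (twistQD h) (laxMinusD r x) N

/-- The `Q`-operator `Q_μ(x)` of type C: conjugate `Q_{(+,…,+)}(x)` by `B_μ ⊗ ⋯ ⊗ B_μ` and substitute
`τ_i ↦ τ_i⁻¹` for all `i` with `μ_i = -1`. -/
def QC (μ : Fin r → ℤˣ) (N : ℕ) (x : ℂ) (h : Fin r → ℂ) :
    Matrix (Fin N → Fin r ⊕ Fin r) (Fin N → Fin r ⊕ Fin r) ℂ :=
  conjQ (weylMat (-1) μ) N (QplusC r N x (flipTwist μ h))

/-- The `Q`-operator `Q_μ(x)` of type D: conjugate `Q_{(+,…,+)}(x)` by `B_μ ⊗ ⋯ ⊗ B_μ` and substitute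
`τ_i ↦ τ_i⁻¹` for all `i` with `μ_i = -1`. -/
def QD (μ : Fin r → ℤˣ) (N : ℕ) (x : ℂ) (h : Fin r → ℂ) :
    Matrix (Fin N → Fin r ⊕ Fin r) (Fin N → Fin r ⊕ Fin r) ℂ :=
  conjQ (weylMat 1 μ) N (QplusD r N x (flipTwist μ h))

/-- The transfer matrix `T⁺_{μ,t}(x)` of type C. -/
def TC (μ : Fin r → ℤˣ) (N : ℕ) (t x : ℂ) (h : Fin r → ℂ) :
    Matrix (Fin N → Fin r ⊕ Fin r) (Fin N → Fin r ⊕ Fin r) ℂ :=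
  twistedTrace (twistC μ t h) (laxC μ t x) N

/-- The transfer matrix `T⁺_{μ,t}(x)` of type D. -/
def TD (μ : Fin r → ℤˣ) (N : ℕ) (t x : ℂ) (h : Fin r → ℂ) :
    Matrix (Fin N → Fin r ⊕ Fin r) (Fin N → Fin r ⊕ Fin r) ℂ :=
  twistedTrace (twistD μ t h) (laxD μ t x) N

/-- The character `ch⁺_{μ,t}` of type C. -/
def chC (μ : Fin r → ℤˣ) (t : ℂ) (h : Fin r → ℂ) : ℂ := fockTrace (twistC μ t h)

/-- The character `ch⁺_{μ,t}` of type D. -/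
def chD (μ : Fin r → ℤˣ) (t : ℂ) (h : Fin r → ℂ) : ℂ := fockTrace (twistD μ t h)

end TypesCD

/-! ## Types B and D (quadratic Lax matrices)

Here `K = m + 2`, the basis of `ℂ^K` is labelled by `Fin (m + 2)`, `i' = Fin.rev i`, and the middle
indices `2, …, K - 1`, which label the oscillators, are labelled by `Fin m`. -/

section TypesBD

variable {m : ℕ}

/-- The rank `⌊K / 2⌋`. -/
def rk (m : ℕ) : ℕ := (m + 2) / 2

instance (m : ℕ) : NeZero (rk m) := ⟨by unfold rk; omega⟩

/-- The inclusion of `{1, …, r}` into `{1, …, K}`. -/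
def idx (k : Fin (rk m)) : Fin (m + 2) :=
  ⟨k.1, lt_of_lt_of_le k.2 (by unfold rk; omega)⟩

/-- The exponents of the diagonal twist `D = diag(τ_1, …, τ_r, (1,) τ_r⁻¹, …, τ_1⁻¹)`. -/
def fullTwist (h : Fin (rk m) → ℂ) (i : Fin (m + 2)) : ℂ :=
  if hi : i.1 < rk m then h ⟨i.1, hi⟩
  else if hi : i.rev.1 < rk m then -h ⟨i.rev.1, hi⟩ else 0

/-- The middle index `j + 1` (in the range `2, …, K - 1`) of `{1, …, K}`. -/
def mid (j : Fin m) : Fin (m + 2) := j.castSucc.succ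

/-- A vector of length `K`, cut into pieces of lengths `1, K - 2, 1`. -/
def vec3 {α : Type} (a : α) (b : Fin m → α) (c : α) : Fin (m + 2) → α :=
  Fin.cons (α := fun _ => α) a (Fin.snoc (α := fun _ => α) b c)

section Ring

variable {R : Type} [Ring R] [Algebra ℂ R]

/-- A `K × K` matrix in block form with blocks of sizes `1, K - 2, 1`. -/
def blk3 (a : R) (b : Fin m → R) (c : R) (d : Fin m → R) (E : Matrix (Fin m) (Fin m) R)
    (f : Fin m → R) (g : R) (k : Fin m → R) (l : R) : Matrix (Fin (m + 2)) (Fin (m + 2)) R :=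
  Matrix.of (vec3 (vec3 a b c) (fun i => vec3 (d i) (E i) (f i)) (vec3 g k l))

/-- `u J v = ∑_j u_j v_{j'}`, with `J` the antidiagonal matrix. -/
def pairJ (u v : Fin m → R) : R := ∑ j, u j * v j.rev

/-- The unitriangular matrix with blocks `1, ℘, -½ ℘ J ℘ᵀ`; `0, I, -J ℘ᵀ`; `0, 0, 1`. -/
def unipBD (p : Fin m → R) : Matrix (Fin (m + 2)) (Fin (m + 2)) R :=
  blk3 1 p (-((1 / 2 : ℂ) • pairJ p p)) 0 1 (fun i => -p i.rev) 0 0 1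

/-- The Lax matrix `𝔏_{x₁,x₂}(x)` built from the row `℘ = p` and the column `𝐰 = w`. -/
def laxFrak (p w : Fin m → R) (x₁ x₂ x : ℂ) : Matrix (Fin (m + 2)) (Fin (m + 2)) R :=
  unipBD p *
    blk3 (algebraMap ℂ R ((x - x₁) * (x - x₁ - ((m : ℂ) + 2) / 2 + 2))) 0 0
      (fun i => -((x - x₁) • w i)) (((x - x₁) * (x - x₂)) • (1 : Matrix (Fin m) (Fin m) R)) 0
      (-((1 / 2 : ℂ) • pairJ w w)) (fun j => (x - x₂) • w j.rev)
      (algebraMap ℂ R ((x - x₂) * (x - x₂ - ((m : ℂ) + 2) / 2 + 2))) *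
    unipBD (-p)

/-- The Lax matrix `L_{x₁₂}(x) = 𝔏_{x₁,x₂}(x + (x₁ + x₂ - 1)/2)`, which only depends on
`x₁₂ = x₁ - x₂`; we take `x₁ = x₁₂` and `x₂ = 0`. -/
def laxDiff (p w : Fin m → R) (x₁₂ x : ℂ) : Matrix (Fin (m + 2)) (Fin (m + 2)) R :=
  laxFrak p w x₁₂ 0 (x + (x₁₂ - 1) / 2)

/-- The degenerate Lax matrix `L_1(x)`. -/
def laxFirst (p w : Fin m → R) (x : ℂ) : Matrix (Fin (m + 2)) (Fin (m + 2)) R :=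
  blk3
    (algebraMap ℂ R (x ^ 2)
      + x • (algebraMap ℂ R (2 - ((m : ℂ) + 2) / 2) - ∑ j, p j * w j)
      + (1 / 4 : ℂ) • (pairJ p p * pairJ w w))
    (fun j => x • p j - (1 / 2 : ℂ) • (pairJ p p * w j.rev))
    (-((1 / 2 : ℂ) • pairJ p p))
    (fun i => -(x • w i) + (1 / 2 : ℂ) • (p i.rev * pairJ w w))
    (x • (1 : Matrix (Fin m) (Fin m) R) - Matrix.of fun i j => p i.rev * w j.rev)
    (fun i => -p i.rev)
    (-((1 / 2 : ℂ) • pairJ w w))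
    (fun j => w j.rev)
    1

/-- The degenerate Lax matrix `L_K(y)`. -/
def laxLast (p w : Fin m → R) (y : ℂ) : Matrix (Fin (m + 2)) (Fin (m + 2)) R :=
  blk3
    1
    p
    (-((1 / 2 : ℂ) • pairJ p p))
    w
    (y • (1 : Matrix (Fin m) (Fin m) R) + Matrix.of fun i j => w i * p j)
    (fun i => -(y • p i.rev) - (1 / 2 : ℂ) • (w i * pairJ p p))
    (-((1 / 2 : ℂ) • pairJ w w))
    (fun j => -(y • w j.rev) - (1 / 2 : ℂ) • (pairJ w w * p j))
    (algebraMap ℂ R (y ^ 2)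
      + y • (algebraMap ℂ R (2 - ((m : ℂ) + 2) / 2) + ∑ j, w j * p j)
      + (1 / 4 : ℂ) • (pairJ w w * pairJ p p))

end Ring

/-- The endomorphism `B̂_k`, `k ∈ {1, …, r} ∪ {r', …, 1'}`. -/
def bhat (k : Fin (m + 2)) : Matrix (Fin (m + 2)) (Fin (m + 2)) ℂ :=
  if k = 0 then 1
  else if k = Fin.last (m + 1) then ∑ j : Fin (m + 2), Matrix.single j j.rev 1
  else Matrix.single 0 k 1 + Matrix.single k 0 1
    + Matrix.single (Fin.last (m + 1)) k.rev 1 + Matrix.single k.rev (Fin.last (m + 1)) 1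
    + ∑ j : Fin (m + 2), if j ≠ 0 ∧ j ≠ Fin.last (m + 1) ∧ j ≠ k ∧ j ≠ k.rev then
        (if k < k.rev then Matrix.single j j 1 else Matrix.single j j.rev 1) else 0

/-- The oscillators subject to the particle-hole transformation: those with index `1 < j ≤ k` if
`k ≤ r`, and those with index `k' < j < 1'` if `k ≥ r'`. -/
abbrev flipBD (k : Fin (m + 2)) (j : Fin m) : Prop :=
  if k < k.rev then mid j ≤ k else k.rev < mid j

/-- The Lax matrix `𝓛_k(x) = B̂_k L_{x₁₂ = 1 - t - K/2}(x) B̂_k⁻¹ |_{p.h.}`. -/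
def laxBD (k : Fin (m + 2)) (t x : ℂ) : Matrix (Fin (m + 2)) (Fin (m + 2)) (FockOp (Fin m)) :=
  conjLax (bhat k) (laxDiff (crPH (flipBD k)) (anPH (flipBD k)) (1 - t - ((m : ℂ) + 2) / 2) x)

/-- The generator `𝓕^k_ii`: the `(i, i)` entry of the coefficient of `x` in the
quadratic polynomial `𝓛_k(x)`. -/
def cartanBD (k : Fin (m + 2)) (t : ℂ) (i : Fin (rk m)) : FockOp (Fin m) :=
  (1 / 2 : ℂ) • (laxBD k t 1 (idx i) (idx i) - laxBD k t (-1) (idx i) (idx i))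

/-- The twist `∏_{i ≤ r} τ_i ^ {𝓕^k_ii}`. -/
def twistBD (k : Fin (m + 2)) (t : ℂ) (h : Fin (rk m) → ℂ) : FockOp (Fin m) :=
  expDiag (∑ i, h i • cartanBD k t i)

/-- The twists `D_1` and `D_K`: the product of `τ_1^{-ā_j a_j}` over all oscillators, of
`τ_j^{ā_j a_j}` over `2 ≤ j ≤ r`, and of `τ_j^{-ā_{j'} a_{j'}}` over `2 ≤ j ≤ r`. -/
def twistQBD (h : Fin (rk m) → ℂ) : FockOp (Fin m) :=
  expDiag (∑ j : Fin m, (fullTwist h (mid j) - h 0) • (cr j * an j))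

/-- Twists for which the traces defining `Q_1` and `Q_K` converge. -/
def domQBD (m : ℕ) : Set (Fin (rk m) → ℂ) := {h | ∀ j : Fin m, (fullTwist h (mid j)).re < (h 0).re}

/-- Twists at which `Q_1` and `Q_K` are regular. -/
def regQBD (m : ℕ) : Set (Fin (rk m) → ℂ) :=
  {h | ∀ j : Fin m, Complex.exp (fullTwist h (mid j) - h 0) ≠ 1}

/-- Twists for which the traces labelled by `k` and `k'` converge, `1 ≤ k ≤ r`. -/
def domBD (k : Fin (rk m)) : Set (Fin (rk m) → ℂ) :=
  {h | (∀ l, l < k → (h k).re < (h l).re) ∧ (∀ l, k < l → (h l).re < (h k).re) ∧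
    (∀ l, l ≠ k → 0 < (h k + h l).re) ∧ (Odd m → 0 < (h k).re)}

/-- The `Q`-operator `Q_1(x)`, as a rational function of the twist. -/
def QfirstBD (m N : ℕ) (x : ℂ) :
    (Fin (rk m) → ℂ) → Matrix (Fin N → Fin (m + 2)) (Fin N → Fin (m + 2)) ℂ :=
  ratCont (domQBD m) (regQBD m) fun h => normTrace (twistQBD h) (laxFirst cr an x) N

/-- The `Q`-operator `Q_K(x)`, as a rational function of the twist. -/
def QlastBD (m N : ℕ) (x : ℂ) :
    (Fin (rk m) → ℂ) → Matrix (Fin N → Fin (m + 2)) (Fin N → Fin (m + 2)) ℂ :=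
  ratCont (domQBD m) (regQBD m) fun h => normTrace (twistQBD h) (laxLast cr an x) N

/-- The substitution `τ_1 ↔ τ_k`. -/
def swapTwist (k : Fin (rk m)) (h : Fin (rk m) → ℂ) : Fin (rk m) → ℂ := fun i => h (Equiv.swap 0 k i)

/-- The `Q`-operator `Q_k(x)`, `1 ≤ k ≤ r`: conjugate `Q_1(x)` by `B̂_k ⊗ ⋯ ⊗ B̂_k` and exchange
`τ_1` and `τ_k`. -/
def QBD (k : Fin (rk m)) (N : ℕ) (x : ℂ) (h : Fin (rk m) → ℂ) :
    Matrix (Fin N → Fin (m + 2)) (Fin N → Fin (m + 2)) ℂ :=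
  conjQ (bhat (idx k)) N (QfirstBD m N x (swapTwist k h))

/-- The `Q`-operator `Q_{k'}(x)`, `1 ≤ k ≤ r`: invert all twists in `Q_1(x)`, conjugate by
`B̂_{k'} ⊗ ⋯ ⊗ B̂_{k'}` and exchange `τ_1` and `τ_k`. -/
def QBD' (k : Fin (rk m)) (N : ℕ) (x : ℂ) (h : Fin (rk m) → ℂ) :
    Matrix (Fin N → Fin (m + 2)) (Fin N → Fin (m + 2)) ℂ :=
  conjQ (bhat (idx k).rev) N (QfirstBD m N x (-swapTwist k h))

/-- The transfer matrix `T⁺_{k,t}(x)`, `k ∈ {1, …, r} ∪ {r', …, 1'}`. -/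
def TBD (k : Fin (m + 2)) (N : ℕ) (t x : ℂ) (h : Fin (rk m) → ℂ) :
    Matrix (Fin N → Fin (m + 2)) (Fin N → Fin (m + 2)) ℂ :=
  twistedTrace (twistBD k t h) (laxBD k t x) N

/-- The character `ch⁺_{k,t}`, `k ∈ {1, …, r} ∪ {r', …, 1'}`. -/
def chBD (k : Fin (m + 2)) (t : ℂ) (h : Fin (rk m) → ℂ) : ℂ := fockTrace (twistBD k t h)

/-- The product of the factors `1 - q⁻¹` in the denominators of the characters `ch⁺_{k,t}`
and `ch⁺_{k',t}`, `1 ≤ k ≤ r`. -/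
def denBD (k : Fin (rk m)) (h : Fin (rk m) → ℂ) : ℂ :=
  (if Odd m then 1 - Complex.exp (-h k) else 1) *
    (∏ l, if l < k then 1 - Complex.exp (h k - h l) else 1) *
    (∏ l, if k < l then 1 - Complex.exp (h l - h k) else 1) *
    ∏ l, if l ≠ k then 1 - Complex.exp (-(h k + h l)) else 1

end TypesBD

end BaxterQ

end

open BaxterQ

noncomputable section

namespace BaxterQ

/-! ## Quasi-free functionals on free algebras -/

section Wick

open FreeAlgebra (ι)

variable {S S₀ S₁ S₂ : Type}

/-- The noncommutative monomial of a list of generators. -/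
def word (w : List S) : FreeAlgebra ℂ S := (w.map (ι ℂ)).prod

@[simp] theorem word_nil : word ([] : List S) = 1 := rfl

@[simp] theorem word_cons (s : S) (w : List S) : word (s :: w) = ι ℂ s * word w := by
  simp [word]

theorem word_append (v w : List S) : word (v ++ w) = word v * word w := by
  simp [word]

/-- The sum of the contractions of a generator, with contraction coefficients `c`, with the letters
of a word. -/
def contr (c : S → ℂ) : List S → FreeAlgebra ℂ S
  | [] => 0
  | t :: w => c t • word w + ι ℂ t * contr c w

theorem span_word : Submodule.span ℂ (Set.range (word (S := S))) = ⊤ := by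
  have h := congrArg Subalgebra.toSubmodule (FreeAlgebra.adjoin_range_ι ℂ S)
  rw [Algebra.adjoin_eq_span, Algebra.top_toSubmodule] at h
  rw [eq_top_iff, ← h]
  refine Submodule.span_mono fun x hx => ?_
  induction hx using Submonoid.closure_induction with
  | mem x hx =>
    obtain ⟨s, rfl⟩ := hx
    exact ⟨[s], by simp⟩
  | one => exact ⟨[], rfl⟩
  | mul x y _ _ hx hy =>
    obtain ⟨v, rfl⟩ := hx
    obtain ⟨w, rfl⟩ := hy
    exact ⟨v ++ w, word_append v w⟩

theorem contr_mem_span (c : S → ℂ) (w : List S) :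
    contr c w ∈ Submodule.span ℂ (word '' {u : List S | u.length + 1 = w.length}) := by
  induction w with
  | nil => simp [contr]
  | cons t w ih =>
    refine Submodule.add_mem _ (Submodule.smul_mem _ _ (Submodule.subset_span ⟨w, rfl, rfl⟩)) ?_
    generalize contr c w = z at ih ⊢
    induction ih using Submodule.span_induction with
    | mem x hx =>
      obtain ⟨u, hu, rfl⟩ := hx
      refine Submodule.subset_span ⟨t :: u, ?_, by simp⟩
      simpa using hu
    | zero => simp
    | add x y _ _ hx hy => rw [mul_add]; exact Submodule.add_mem _ hx hy
    | smul a x _ hx => rw [mul_smul_comm]; exact Submodule.smul_mem _ _ hx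

theorem contr_smul (a : ℂ) (c : S → ℂ) (w : List S) :
    contr (fun t => a * c t) w = a • contr c w := by
  induction w with
  | nil => simp [contr]
  | cons t w ih => simp [contr, ih, mul_smul]

/-- Moving an element with scalar commutators through a word. -/
theorem mul_lift_word {R : Type} [Ring R] [Algebra ℂ R] (f : S → R) (D : R) (c : S → ℂ)
    (h : ∀ t, D * f t = f t * D + algebraMap ℂ R (c t)) (w : List S) :
    D * FreeAlgebra.lift ℂ f (word w) =
      FreeAlgebra.lift ℂ f (word w) * D + FreeAlgebra.lift ℂ f (contr c w) := by
  induction w with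
  | nil => simp [contr]
  | cons t w ih =>
    rw [word_cons, map_mul, FreeAlgebra.lift_ι_apply, ← mul_assoc, h, add_mul, mul_assoc (f t), ih,
      contr, map_add, map_mul, map_smul, FreeAlgebra.lift_ι_apply, mul_add, Algebra.smul_def]
    noncomm_ring

/-- The derivation of the polynomial ring with constant coefficients `c`. -/
def annih (c : S → ℂ) : Module.End ℂ (MvPolynomial S ℂ) :=
  (MvPolynomial.mkDerivation ℂ fun t => MvPolynomial.C (c t) :
    Derivation ℂ (MvPolynomial S ℂ) (MvPolynomial S ℂ)).toLinearMap

theorem annih_one (c : S → ℂ) : annih c 1 = 0 := by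
  simp [annih]

theorem annih_X_mul (c : S → ℂ) (t : S) (p : MvPolynomial S ℂ) :
    annih c (MvPolynomial.X t * p) = MvPolynomial.X t * annih c p + c t • p := by
  simp only [annih, Derivation.coeFn_coe, Derivation.leibniz,
    MvPolynomial.mkDerivation_X, MvPolynomial.smul_eq_C_mul, smul_eq_mul]
  ring

theorem annih_comm (c d : S → ℂ) (p : MvPolynomial S ℂ) :
    annih c (annih d p) = annih d (annih c p) := by
  induction p using MvPolynomial.induction_on with
  | C a => simp [annih]
  | add p q hp hq => simp [hp, hq]
  | mul_X p t hp =>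
    rw [mul_comm]
    simp only [annih_X_mul, map_add, map_smul, hp]
    abel

/-- The operator attached to a generator in the representation with contractions `c`. -/
def wickOp (c : S → S → ℂ) (s : S) : Module.End ℂ (MvPolynomial S ℂ) :=
  LinearMap.mulLeft ℂ (MvPolynomial.X s) + annih (c s)

theorem annih_mul_wickOp (d : S → ℂ) (c : S → S → ℂ) (t : S) :
    annih d * wickOp c t = wickOp c t * annih d + algebraMap ℂ _ (d t) := by
  refine LinearMap.ext fun p => ?_
  simp only [wickOp, Module.End.mul_apply, LinearMap.add_apply, LinearMap.mulLeft_apply, map_add,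
    annih_X_mul, annih_comm d, Module.algebraMap_end_apply]
  abel

theorem wickOp_comm (c : S → S → ℂ) (s t : S) :
    wickOp c s * wickOp c t = wickOp c t * wickOp c s + algebraMap ℂ _ (c s t - c t s) := by
  refine LinearMap.ext fun p => ?_
  simp only [wickOp, Module.End.mul_apply, LinearMap.add_apply, LinearMap.mulLeft_apply, map_add,
    annih_X_mul, annih_comm (c s) (c t), Module.algebraMap_end_apply, sub_smul]
  rw [mul_left_comm]
  abel

/-- The representation of the free algebra with contractions `c`. -/
def wickRep (c : S → S → ℂ) : FreeAlgebra ℂ S →ₐ[ℂ] Module.End ℂ (MvPolynomial S ℂ) :=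
  FreeAlgebra.lift ℂ (wickOp c)

@[simp] theorem wickRep_ι (c : S → S → ℂ) (s : S) : wickRep c (ι ℂ s) = wickOp c s := by
  simp [wickRep]

/-- The vacuum expectation value. -/
def vev : Module.End ℂ (MvPolynomial S ℂ) →ₗ[ℂ] ℂ where
  toFun Z := MvPolynomial.constantCoeff (Z 1)
  map_add' := by simp
  map_smul' := by simp [MvPolynomial.smul_eq_C_mul]

theorem vev_apply (Z : Module.End ℂ (MvPolynomial S ℂ)) :
    vev Z = MvPolynomial.constantCoeff (Z 1) := rfl

/-- The quasi-free functional with two-point function `c`. -/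
def wick (c : S → S → ℂ) : FreeAlgebra ℂ S →ₗ[ℂ] ℂ := vev ∘ₗ (wickRep c).toLinearMap

theorem wick_apply (c : S → S → ℂ) (x : FreeAlgebra ℂ S) : wick c x = vev (wickRep c x) := rfl

@[simp] theorem wick_one (c : S → S → ℂ) : wick c 1 = 1 := by
  simp [wick_apply, vev_apply]

theorem vev_wickOp_mul (c : S → S → ℂ) (s : S) (Z : Module.End ℂ (MvPolynomial S ℂ)) :
    vev (wickOp c s * Z) = vev (annih (c s) * Z) := by
  simp [vev_apply, wickOp]

theorem vev_mul_annih (d : S → ℂ) (Z : Module.End ℂ (MvPolynomial S ℂ)) :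
    vev (Z * annih d) = 0 := by
  simp [vev_apply, annih_one]

theorem wick_ι_mul_word (c : S → S → ℂ) (s : S) (w : List S) :
    wick c (ι ℂ s * word w) = wick c (contr (c s) w) := by
  rw [wick_apply, map_mul, wickRep_ι, vev_wickOp_mul, wickRep,
    mul_lift_word _ _ (c s) (annih_mul_wickOp (c s) c), map_add, vev_mul_annih, zero_add]
  rfl

/-- Wick's recursion determines a functional up to normalization. -/
theorem eq_mul_wick (c : S → S → ℂ) (χ : FreeAlgebra ℂ S →ₗ[ℂ] ℂ)
    (h : ∀ s w, χ (ι ℂ s * word w) = χ (contr (c s) w)) (x : FreeAlgebra ℂ S) :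
    χ x = χ 1 * wick c x := by
  have key : ∀ n, ∀ w : List S, w.length = n → χ (word w) = (χ 1 • wick c) (word w) := by
    intro n
    induction n using Nat.strong_induction_on with
    | _ n ih =>
      intro w hw
      cases w with
      | nil => simp
      | cons s w =>
        rw [word_cons, h, LinearMap.smul_apply, wick_ι_mul_word, ← LinearMap.smul_apply]
        refine LinearMap.eqOn_span (f := χ) (g := χ 1 • wick c) ?_ (contr_mem_span (c s) w)
        rintro _ ⟨u, hu, rfl⟩
        refine ih u.length ?_ u rfl
        simp only [Set.mem_ofPred_eq] at hu
        simp only [List.length_cons] at hw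
        omega
  have h2 : χ = χ 1 • wick c := by
    refine LinearMap.ext_on span_word ?_
    rintro _ ⟨w, rfl⟩
    exact key _ w rfl
  conv_lhs => rw [h2]
  rfl

/-- The linear span of the generators. -/
def linSpan (S : Type) : Submodule ℂ (FreeAlgebra ℂ S) := Submodule.span ℂ (Set.range (ι ℂ))

theorem ι_mem_linSpan (s : S) : ι ℂ s ∈ linSpan S := Submodule.subset_span ⟨s, rfl⟩

@[simp] theorem wick_ι_mul_ι (c : S → S → ℂ) (s t : S) : wick c (ι ℂ s * ι ℂ t) = c s t := by
  have := wick_ι_mul_word c s [t]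
  simpa [contr] using this

theorem exists_annih (c : S → S → ℂ) {v : FreeAlgebra ℂ S} (hv : v ∈ linSpan S) :
    ∃ d : S → ℂ, (∀ Z, vev (wickRep c v * Z) = vev (annih d * Z)) ∧
      ∀ v' ∈ linSpan S,
        annih d * wickRep c v' = wickRep c v' * annih d + algebraMap ℂ _ (wick c (v * v')) := by
  have hlin : ∀ (d : S → ℂ) (v : FreeAlgebra ℂ S), (∀ t, d t = wick c (v * ι ℂ t)) →
      ∀ v' ∈ linSpan S,
        annih d * wickRep c v' = wickRep c v' * annih d + algebraMap ℂ _ (wick c (v * v')) := by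
    intro d v hd v' hv'
    induction hv' using Submodule.span_induction with
    | mem x hx =>
      obtain ⟨t, rfl⟩ := hx
      rw [wickRep_ι, annih_mul_wickOp, hd]
    | zero => simp
    | add x y _ _ hx hy => simp only [map_add, mul_add, add_mul, hx, hy]; abel
    | smul a x _ hx =>
      simp only [map_smul, mul_smul_comm, smul_mul_assoc, hx, smul_add, smul_eq_mul, map_mul,
        Algebra.smul_def a (algebraMap ℂ (Module.End ℂ (MvPolynomial S ℂ)) _)]
  have hadd : ∀ d e : S → ℂ, annih (d + e) = annih d + annih e := by
    intro d e
    refine LinearMap.ext fun p => ?_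
    induction p using MvPolynomial.induction_on with
    | C a => simp [annih]
    | add p q hp hq => simp only [map_add, hp, hq]
    | mul_X p t hp =>
      rw [mul_comm]
      simp only [annih_X_mul, LinearMap.add_apply, hp, Pi.add_apply, add_smul, mul_add]
      abel
  have hsmul : ∀ (a : ℂ) (d : S → ℂ), annih (a • d) = a • annih d := by
    intro a d
    refine LinearMap.ext fun p => ?_
    induction p using MvPolynomial.induction_on with
    | C a => simp [annih]
    | add p q hp hq => simp only [map_add, hp, hq]
    | mul_X p t hp =>
      rw [mul_comm]
      simp only [annih_X_mul, LinearMap.smul_apply, hp, Pi.smul_apply, smul_add, mul_smul_comm,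
        smul_eq_mul, mul_smul]
  refine ⟨fun t => wick c (v * ι ℂ t), ?_, hlin _ v fun _ => rfl⟩
  induction hv using Submodule.span_induction with
  | mem x hx =>
    obtain ⟨s, rfl⟩ := hx
    intro Z
    simp only [wick_ι_mul_ι, wickRep_ι, vev_wickOp_mul]
  | zero =>
    intro Z
    have : (fun t : S => wick c (0 * ι ℂ t)) = (0 : ℂ) • (0 : S → ℂ) := by ext; simp
    rw [this, hsmul]; simp
  | add x y _ _ hx hy =>
    intro Z
    have : (fun t => wick c ((x + y) * ι ℂ t)) =
        (fun t => wick c (x * ι ℂ t)) + fun t => wick c (y * ι ℂ t) := by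
      ext; simp [add_mul]
    rw [this, hadd, map_add, add_mul, add_mul, map_add, map_add, hx, hy]
  | smul a x _ hx =>
    intro Z
    have : (fun t => wick c ((a • x) * ι ℂ t)) = a • fun t => wick c (x * ι ℂ t) := by
      ext; simp
    rw [this, hsmul, map_smul, smul_mul_assoc, smul_mul_assoc, map_smul, map_smul, hx]

theorem commute_wickRep (c : S → S → ℂ) {v v' : FreeAlgebra ℂ S} (hv : v ∈ linSpan S)
    (hv' : v' ∈ linSpan S) (h : wick c (v * v') = wick c (v' * v)) :
    Commute (wickRep c v) (wickRep c v') := by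
  have key : wickRep c v * wickRep c v' =
      wickRep c v' * wickRep c v + algebraMap ℂ _ (wick c (v * v') - wick c (v' * v)) := by
    clear h
    induction hv, hv' using Submodule.span_induction₂ with
    | mem_mem x y hx hy =>
      obtain ⟨s, rfl⟩ := hx
      obtain ⟨t, rfl⟩ := hy
      simp only [wickRep_ι, wickOp_comm c s t, wick_ι_mul_ι]
    | zero_left y hy => simp
    | zero_right x hx => simp
    | add_left x y z _ _ _ hx hy =>
      simp only [map_add, mul_add, add_mul, hx, hy, map_sub]; abel
    | add_right x y z _ _ _ hx hy =>
      simp only [map_add, mul_add, add_mul, hx, hy, map_sub]; abel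
    | smul_left a x y _ _ hx =>
      simp only [map_smul, mul_smul_comm, smul_mul_assoc, hx, smul_add, smul_eq_mul, map_mul,
        map_sub, Algebra.smul_def a (algebraMap ℂ (Module.End ℂ (MvPolynomial S ℂ)) _), smul_sub]
    | smul_right a x y _ _ hx =>
      simp only [map_smul, mul_smul_comm, smul_mul_assoc, hx, smul_add, smul_eq_mul, map_mul,
        map_sub, Algebra.smul_def a (algebraMap ℂ (Module.End ℂ (MvPolynomial S ℂ)) _), smul_sub]
  rw [Commute, SemiconjBy, key, h, sub_self, map_zero, add_zero]

/-- Quasi-free functionals under linear substitutions into two independent sets of generators. -/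
theorem wick_lift_mul_lift {c₀ : S₀ → S₀ → ℂ} {c₁ : S₁ → S₁ → ℂ} {f₁ : S₁ → FreeAlgebra ℂ S₀}
    {f₂ : S₂ → FreeAlgebra ℂ S₀} (h₁ : ∀ s, f₁ s ∈ linSpan S₀) (h₂ : ∀ s, f₂ s ∈ linSpan S₀)
    (hc : ∀ s t, wick c₀ (f₁ s * f₁ t) = c₁ s t) (h₁₂ : ∀ s t, wick c₀ (f₁ s * f₂ t) = 0)
    (x : FreeAlgebra ℂ S₁) (y : FreeAlgebra ℂ S₂) :
    wick c₀ (FreeAlgebra.lift ℂ f₁ x * FreeAlgebra.lift ℂ f₂ y) =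
      wick c₁ x * wick c₀ (FreeAlgebra.lift ℂ f₂ y) := by
  have := eq_mul_wick c₁ (wick c₀ ∘ₗ LinearMap.mulRight ℂ (FreeAlgebra.lift ℂ f₂ y) ∘ₗ
    (FreeAlgebra.lift ℂ f₁).toLinearMap) ?_ x
  · simpa [mul_comm] using this
  intro s w
  obtain ⟨d, hd, hd'⟩ := exists_annih c₀ (h₁ s)
  have hw := mul_lift_word (fun t => wickRep c₀ (f₁ t)) (annih d) (c₁ s)
    (fun t => by rw [hd' _ (h₁ t), hc]) w
  have hcomp : ∀ z, FreeAlgebra.lift ℂ (fun t => wickRep c₀ (f₁ t)) z =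
      wickRep c₀ (FreeAlgebra.lift ℂ f₁ z) := by
    intro z
    have : FreeAlgebra.lift ℂ (fun t => wickRep c₀ (f₁ t)) =
        (wickRep c₀).comp (FreeAlgebra.lift ℂ f₁) := by
      ext; simp
    rw [this]; rfl
  have hY : Commute (annih d) (wickRep c₀ (FreeAlgebra.lift ℂ f₂ y)) := by
    induction y using FreeAlgebra.induction with
    | grade0 r => rw [AlgHom.commutes, AlgHom.commutes]; exact (Algebra.commutes r (annih d)).symm
    | grade1 t =>
      rw [FreeAlgebra.lift_ι_apply, Commute, SemiconjBy, hd' _ (h₂ t), h₁₂]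
      simp
    | mul a b ha hb => simpa using ha.mul_right hb
    | add a b ha hb => simpa using ha.add_right hb
  rw [hcomp, hcomp] at hw
  simp only [LinearMap.comp_apply, LinearMap.mulRight_apply, AlgHom.toLinearMap_apply, map_mul,
    FreeAlgebra.lift_ι_apply, wick_apply, mul_assoc]
  rw [hd, ← mul_assoc, hw, add_mul, map_add, mul_assoc, hY.eq, ← mul_assoc, vev_mul_annih, zero_add]

theorem wick_lift {c₀ : S₀ → S₀ → ℂ} {c₁ : S₁ → S₁ → ℂ} {f : S₁ → FreeAlgebra ℂ S₀}
    (hf : ∀ s, f s ∈ linSpan S₀) (hc : ∀ s t, wick c₀ (f s * f t) = c₁ s t)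
    (x : FreeAlgebra ℂ S₁) : wick c₀ (FreeAlgebra.lift ℂ f x) = wick c₁ x := by
  have := wick_lift_mul_lift (c₀ := c₀) (f₂ := fun e : Empty => e.elim) hf (fun e => e.elim) hc
    (fun _ e => e.elim) x 1
  simpa using this

end Wick

/-! ## Traces over the Fock module -/

section Series

theorem hasSum_mul_prod {𝕜 α β : Type} [RCLike 𝕜] {f : α → 𝕜} {g : β → 𝕜} {a b : 𝕜} (hf : HasSum f a)
    (hg : HasSum g b) : HasSum (fun x : α × β => f x.1 * g x.2) (a * b) := by
  have h1 : Summable fun x => ‖f x‖ := hf.summable.norm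
  have h2 : Summable fun x => ‖g x‖ := hg.summable.norm
  exact hf.mul hg (summable_mul_of_summable_norm h1 h2)

theorem hasSum_pi_fin_prod {𝕜 : Type} [RCLike 𝕜] (n : ℕ) (f : Fin n → ℕ → 𝕜) (a : Fin n → 𝕜)
    (h : ∀ i, HasSum (f i) (a i)) :
    HasSum (fun m : Fin n → ℕ => ∏ i, f i (m i)) (∏ i, a i) := by
  induction n with
  | zero => simp
  | succ n ih =>
    have h1 := ih (fun i => f i.succ) (fun i => a i.succ) fun i => h i.succ
    rw [← (Fin.consEquiv fun _ => ℕ).hasSum_iff, Fin.prod_univ_succ]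
    have h3 := hasSum_mul_prod (h 0) h1
    convert h3 using 2 with m
    rw [Function.comp_apply, Fin.prod_univ_succ]
    simp [Fin.consEquiv]

theorem hasSum_finsupp_prod {𝕜 : Type} [RCLike 𝕜] {κ : Type} [Fintype κ] (f : κ → ℕ → 𝕜)
    (a : κ → 𝕜) (h : ∀ i, HasSum (f i) (a i)) :
    HasSum (fun m : κ →₀ ℕ => ∏ i, f i (m i)) (∏ i, a i) := by
  have e := Fintype.equivFin κ
  have h1 := hasSum_pi_fin_prod _ (fun i => f (e.symm i)) (fun i => a (e.symm i)) fun i => h _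
  rw [← (Finsupp.equivFunOnFinite.trans (Equiv.arrowCongr e (Equiv.refl ℕ))).hasSum_iff,
    e.symm.prod_comp a] at h1
  convert h1 using 2 with m
  rw [Function.comp_apply, ← e.symm.prod_comp]
  simp

end Series

section FockTrace

open FreeAlgebra (ι)

variable {κ : Type}

/-- The representation of the free algebra on the Fock module: the generators `inl i`, `inr i` act
as `a_i`, `ā_i`. -/
def fockRep (κ : Type) : FreeAlgebra ℂ (κ ⊕ κ) →ₐ[ℂ] FockOp κ :=
  FreeAlgebra.lift ℂ (Sum.elim an cr)

@[simp] theorem fockRep_inl (i : κ) : fockRep κ (ι ℂ (Sum.inl i)) = an i := by simp [fockRep]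

@[simp] theorem fockRep_inr (i : κ) : fockRep κ (ι ℂ (Sum.inr i)) = cr i := by simp [fockRep]

theorem an_comm (i j : κ) (p : Fock κ) : an i (an j p) = an j (an i p) := by
  classical
  ext m
  simp only [an, Derivation.coeFn_coe, MvPolynomial.coeff_pderiv]
  rw [add_right_comm]
  rcases eq_or_ne i j with rfl | h
  · rfl
  · simp [h, h.symm]
    ring

variable [Fintype κ]

/-- `Y` acts diagonally, with eigenvalues `d ∏ z_i ^ m_i`. -/
def IsGeomDiag (Y : FockOp κ) (d : ℂ) (z : κ → ℂ) : Prop :=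
  ∀ p m, MvPolynomial.coeff m (Y p) = d * (∏ i, z i ^ m i) * MvPolynomial.coeff m p

variable {Y : FockOp κ} {d : ℂ} {z : κ → ℂ}

theorem IsGeomDiag.diagCoeff_mul (hY : IsGeomDiag Y d z) (X : FockOp κ) (m : κ →₀ ℕ) :
    diagCoeff (Y * X) m = d * (∏ i, z i ^ m i) *
      MvPolynomial.coeff m (X (MvPolynomial.monomial m 1)) :=
  hY _ _

theorem norm_coeff_fockRep_word_le (w : List (κ ⊕ κ)) (m m' : κ →₀ ℕ) :
    ‖MvPolynomial.coeff m' (fockRep κ (word w) (MvPolynomial.monomial m 1))‖ ≤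
      ((∑ i, m' i : ℕ) + w.length : ℝ) ^ w.length := by
  classical
  induction w generalizing m' with
  | nil =>
    simp only [word_nil, map_one, Module.End.one_apply, MvPolynomial.coeff_monomial]
    split_ifs <;> simp
  | cons s w ih =>
    rw [word_cons, map_mul, Module.End.mul_apply]
    have h0 : (0 : ℝ) ≤ (∑ i, m' i : ℕ) := Nat.cast_nonneg _
    rcases s with i | i
    · rw [fockRep_inl]
      simp only [an, Derivation.coeFn_coe, MvPolynomial.coeff_pderiv]
      have h1 := ih (m' + Finsupp.single i 1)
      have h2 : ∑ j, (m' + Finsupp.single i 1 : κ →₀ ℕ) j = ∑ j, m' j + 1 := by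
        simp [Finset.sum_add_distrib, Finsupp.single_apply]
      rw [h2] at h1
      have h3 : ‖((m' i : ℂ) + 1)‖ ≤ (∑ j, m' j : ℕ) + ((w.length + 1 : ℕ) : ℝ) := by
        rw [← Nat.cast_succ, Complex.norm_natCast, ← Nat.cast_add, Nat.cast_le]
        have := Finset.single_le_sum (f := fun j => m' j) (fun j _ => Nat.zero_le _)
          (Finset.mem_univ i)
        omega
      rw [norm_mul, List.length_cons, pow_succ]
      refine mul_le_mul (h1.trans (le_of_eq ?_)) h3 (norm_nonneg _) (by positivity)
      push_cast
      ring
    · rw [fockRep_inr]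
      simp only [cr, LinearMap.mulLeft_apply, MvPolynomial.coeff_X_mul']
      split_ifs with hi
      · refine (ih _).trans ?_
        have h2 : ∑ j, (m' - Finsupp.single i 1 : κ →₀ ℕ) j ≤ ∑ j, m' j :=
          Finset.sum_le_sum fun j _ => by rw [Finsupp.tsub_apply]; exact Nat.sub_le _ _
        have h4 : ((∑ j, (m' - Finsupp.single i 1 : κ →₀ ℕ) j : ℕ) : ℝ) ≤ (∑ j, m' j : ℕ) :=
          Nat.cast_le.2 h2
        have h5 : (0 : ℝ) ≤ (∑ j, (m' - Finsupp.single i 1 : κ →₀ ℕ) j : ℕ) := Nat.cast_nonneg _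
        rw [List.length_cons]
        calc _ ≤ (((∑ j, m' j : ℕ) : ℝ) + ((w.length + 1 : ℕ) : ℝ)) ^ w.length := by
              gcongr; omega
          _ ≤ _ := by
              refine pow_le_pow_right₀ ?_ (Nat.le_succ _)
              rw [Nat.cast_succ]
              linarith [(Nat.cast_nonneg w.length : (0 : ℝ) ≤ w.length)]
      · rw [norm_zero]; positivity

theorem summable_geom_mul_poly (hz : ∀ i, ‖z i‖ < 1) (L : ℕ) :
    Summable fun m : κ →₀ ℕ => (∏ i, ‖z i‖ ^ m i) * ((∑ i, m i : ℕ) + L : ℝ) ^ L := by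
  have h1 : ∀ i, Summable fun n : ℕ => ‖z i‖ ^ n * (1 + n : ℝ) ^ L := by
    intro i
    have := (summable_pow_mul_geometric_of_norm_lt_one (R := ℝ) L
      (r := ‖z i‖) (by simpa using hz i))
    have h0 := (summable_geometric_of_lt_one (norm_nonneg _) (hz i))
    refine Summable.of_nonneg_of_le (fun n => by positivity) (fun n => ?_)
      ((this.add h0).mul_left (2 ^ L))
    rcases Nat.eq_zero_or_pos n with rfl | hn
    · have : (1 : ℝ) ≤ 2 ^ L := one_le_pow₀ (by norm_num)
      simp only [pow_zero, Nat.cast_zero, add_zero, one_pow, mul_one]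
      have h3 : (0 : ℝ) ≤ 0 ^ L := by positivity
      nlinarith
    · have hn' : (1 : ℝ) ≤ n := by exact_mod_cast hn
      have : (1 + n : ℝ) ^ L ≤ 2 ^ L * n ^ L := by
        rw [← mul_pow]; gcongr; linarith
      have hp : 0 ≤ ‖z i‖ ^ n := by positivity
      have h2 : (0 : ℝ) ≤ 2 ^ L := by positivity
      nlinarith [mul_le_mul_of_nonneg_left this hp, mul_nonneg h2 hp]
  have h2 := (hasSum_finsupp_prod _ _ fun i => (h1 i).hasSum).summable
  refine Summable.of_nonneg_of_le (fun m => by positivity) (fun m => ?_)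
    (h2.mul_left ((L + 1 : ℝ) ^ L))
  have h3 : (1 + (∑ i, m i : ℕ) : ℝ) ≤ ∏ i, (1 + m i : ℝ) := by
    suffices ∀ s : Finset κ, (1 + ∑ i ∈ s, (m i : ℝ)) ≤ ∏ i ∈ s, (1 + m i : ℝ) by
      simpa using this Finset.univ
    intro s
    induction s using Finset.cons_induction with
    | empty => simp
    | cons a s _ ih =>
      rw [Finset.sum_cons, Finset.prod_cons]
      have h4 : (0 : ℝ) ≤ ∑ i ∈ s, (m i : ℝ) := Finset.sum_nonneg fun i _ => Nat.cast_nonneg _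
      have h5 : (0 : ℝ) ≤ m a := Nat.cast_nonneg _
      nlinarith [mul_le_mul_of_nonneg_left ih (by positivity : (0 : ℝ) ≤ 1 + m a), mul_nonneg h5 h4]
  rw [Finset.prod_mul_distrib, mul_left_comm]
  refine mul_le_mul_of_nonneg_left ?_ (by positivity)
  rw [Finset.prod_pow, ← mul_pow]
  gcongr
  have h4 : (0 : ℝ) ≤ (∑ i, m i : ℕ) := Nat.cast_nonneg _
  have h5 : (0 : ℝ) ≤ L := Nat.cast_nonneg _
  nlinarith [mul_le_mul_of_nonneg_left h3 (by positivity : (0 : ℝ) ≤ L + 1)]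

theorem IsGeomDiag.summable (hY : IsGeomDiag Y d z) (hz : ∀ i, ‖z i‖ < 1)
    (x : FreeAlgebra ℂ (κ ⊕ κ)) : Summable (diagCoeff (Y * fockRep κ x)) := by
  have hx : x ∈ Submodule.span ℂ (Set.range (word (S := κ ⊕ κ))) := by rw [span_word]; trivial
  induction hx using Submodule.span_induction with
  | mem x hx =>
    obtain ⟨w, rfl⟩ := hx
    refine Summable.of_norm_bounded ((summable_geom_mul_poly hz w.length).mul_left ‖d‖) fun m => ?_
    rw [hY.diagCoeff_mul, norm_mul, norm_mul, norm_prod, mul_assoc]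
    simp only [norm_pow]
    gcongr
    exact norm_coeff_fockRep_word_le w m m
  | zero => 
    have : diagCoeff (Y * fockRep κ 0) = 0 := by ext m; simp [diagCoeff]
    rw [this]; exact summable_zero
  | add x y _ _ hx hy =>
    have : diagCoeff (Y * fockRep κ (x + y)) =
        diagCoeff (Y * fockRep κ x) + diagCoeff (Y * fockRep κ y) := by
      ext m; simp [diagCoeff, mul_add]
    rw [this]; exact hx.add hy
  | smul a x _ hx =>
    have : diagCoeff (Y * fockRep κ (a • x)) = a • diagCoeff (Y * fockRep κ x) := by
      ext m; simp [diagCoeff]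
    rw [this]; exact hx.const_smul a

/-- The twisted trace as a functional on the free algebra. -/
def traceFun (hY : IsGeomDiag Y d z) (hz : ∀ i, ‖z i‖ < 1) : FreeAlgebra ℂ (κ ⊕ κ) →ₗ[ℂ] ℂ where
  toFun x := fockTrace (Y * fockRep κ x)
  map_add' x y := by
    rw [fockTrace, fockTrace, fockTrace, ← (hY.summable hz x).tsum_add (hY.summable hz y)]
    congr 1; ext m; simp [diagCoeff, mul_add]
  map_smul' a x := by
    rw [fockTrace, fockTrace, RingHom.id_apply, ← (hY.summable hz x).tsum_const_smul]
    congr 1; ext m; simp [diagCoeff]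

theorem traceFun_apply (hY : IsGeomDiag Y d z) (hz : ∀ i, ‖z i‖ < 1)
    (x : FreeAlgebra ℂ (κ ⊕ κ)) : traceFun hY hz x = fockTrace (Y * fockRep κ x) := rfl

theorem IsGeomDiag.trace (hY : IsGeomDiag Y d z) (hz : ∀ i, ‖z i‖ < 1) :
    fockTrace Y = d * ∏ i, (1 - z i)⁻¹ := by
  have h := (hasSum_finsupp_prod (fun i n => z i ^ n) _
    fun i => hasSum_geometric_of_norm_lt_one (hz i)).mul_left d
  rw [← h.tsum_eq]
  refine tsum_congr fun m => ?_
  have := hY.diagCoeff_mul 1 m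
  rw [mul_one] at this
  classical
  simp [this, MvPolynomial.coeff_monomial]

theorem prod_pow_single_add (z : κ → ℂ) (i : κ) (m : κ →₀ ℕ) :
    ∏ j, z j ^ (Finsupp.single i 1 + m : κ →₀ ℕ) j = z i * ∏ j, z j ^ m j := by
  classical
  simp only [Finsupp.add_apply, pow_add, Finset.prod_mul_distrib]
  congr 1
  rw [Finset.prod_eq_single i]
  · simp
  · intro j _ hj; simp [hj.symm]
  · simp

theorem IsGeomDiag.trace_cr_mul (hY : IsGeomDiag Y d z) (i : κ) (X : FockOp κ) :
    fockTrace (Y * (cr i * X)) = z i * fockTrace (Y * (X * cr i)) := by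
  classical
  rw [fockTrace, fockTrace, ← tsum_mul_left]
  have hinj : Function.Injective fun m : κ →₀ ℕ => Finsupp.single i 1 + m := by
    exact add_right_injective _
  rw [← hinj.tsum_eq]
  · refine tsum_congr fun m => ?_
    rw [hY.diagCoeff_mul, hY.diagCoeff_mul, prod_pow_single_add, Module.End.mul_apply,
      Module.End.mul_apply, cr, LinearMap.mulLeft_apply, MvPolynomial.coeff_X_mul,
      LinearMap.mulLeft_apply, MvPolynomial.X, MvPolynomial.monomial_mul, one_mul]
    ring
  · intro m hm
    rw [Function.mem_support, hY.diagCoeff_mul, Module.End.mul_apply, cr, LinearMap.mulLeft_apply,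
      MvPolynomial.coeff_X_mul'] at hm
    split_ifs at hm with h
    · refine ⟨m - Finsupp.single i 1, ?_⟩
      have hle : Finsupp.single i 1 ≤ m := by
        rw [Finsupp.single_le_iff]; exact Nat.one_le_iff_ne_zero.2 (Finsupp.mem_support_iff.1 h)
      exact add_tsub_cancel_of_le hle
    · simp at hm

theorem IsGeomDiag.trace_mul_an (hY : IsGeomDiag Y d z) (i : κ) (X : FockOp κ) :
    fockTrace (Y * (X * an i)) = z i * fockTrace (Y * (an i * X)) := by
  classical
  rw [fockTrace, fockTrace, ← tsum_mul_left]
  have hinj : Function.Injective fun m : κ →₀ ℕ => Finsupp.single i 1 + m := by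
    exact add_right_injective _
  rw [← hinj.tsum_eq]
  · refine tsum_congr fun m => ?_
    rw [hY.diagCoeff_mul, hY.diagCoeff_mul, prod_pow_single_add, Module.End.mul_apply,
      Module.End.mul_apply]
    simp only [an, Derivation.coeFn_coe, MvPolynomial.coeff_pderiv, MvPolynomial.pderiv_monomial]
    have h1 : Finsupp.single i 1 + m - Finsupp.single i 1 = m := by
      rw [add_tsub_cancel_left]
    have h2 : (MvPolynomial.monomial m ((1 : ℂ) * ((Finsupp.single i 1 + m : κ →₀ ℕ) i : ℂ))) =
        ((m i : ℂ) + 1) • MvPolynomial.monomial m (1 : ℂ) := by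
      simp [MvPolynomial.smul_monomial, add_comm]
    rw [h1, h2, map_smul, MvPolynomial.coeff_smul, smul_eq_mul, add_comm (Finsupp.single i 1) m]
    ring
  · intro m hm
    rw [Function.mem_support, hY.diagCoeff_mul, Module.End.mul_apply] at hm
    simp only [an, Derivation.coeFn_coe, MvPolynomial.pderiv_monomial] at hm
    refine ⟨m - Finsupp.single i 1, ?_⟩
    have hle : Finsupp.single i 1 ≤ m := by
      rw [Finsupp.single_le_iff, Nat.one_le_iff_ne_zero]
      intro h0
      rw [h0] at hm
      simp at hm
    exact add_tsub_cancel_of_le hle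

variable [DecidableEq κ]

/-- The two-point function of the normalized trace twisted by `∏ z_i ^ {ā_i a_i}`. -/
def oscC (z : κ → ℂ) : κ ⊕ κ → κ ⊕ κ → ℂ
  | Sum.inl i, Sum.inr j => if i = j then (1 - z i)⁻¹ else 0
  | Sum.inr i, Sum.inl j => if i = j then z i * (1 - z i)⁻¹ else 0
  | _, _ => 0

theorem IsGeomDiag.trace_mul (hY : IsGeomDiag Y d z) (hz : ∀ i, ‖z i‖ < 1)
    (x : FreeAlgebra ℂ (κ ⊕ κ)) :
    fockTrace (Y * fockRep κ x) = fockTrace Y * wick (oscC z) x := by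
  have h := eq_mul_wick (oscC z) (traceFun hY hz) ?_ x
  · simpa [traceFun_apply] using h
  intro s w
  have hne : ∀ i, 1 - z i ≠ 0 := by
    intro i h0
    have := hz i
    rw [← sub_eq_zero.1 h0] at this
    simp at this
  rcases s with i | i
  · have hcm := mul_lift_word (Sum.elim an cr) (an i)
      (fun t => (Sum.elim (fun _ => 0) (fun j => if i = j then 1 else 0) t : ℂ)) (fun t => by
        rcases t with j | j
        · simp only [Sum.elim_inl, map_zero, add_zero]
          exact LinearMap.ext fun p => an_comm i j p
        · have := an_mul_cr_sub i j
          simp only [Sum.elim_inr]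
          rw [sub_eq_iff_eq_add'] at this
          rw [this]; split_ifs <;> simp) w
    have h1 := hY.trace_mul_an i (fockRep κ (word w))
    have h2 : fockRep κ (word w) * an i = an i * fockRep κ (word w) - fockRep κ (contr
        (fun t => (Sum.elim (fun _ => 0) (fun j => if i = j then 1 else 0) t : ℂ)) w) := by
      rw [eq_sub_iff_add_eq]; exact hcm.symm
    have h3 : (fun t => oscC z (Sum.inl i) t) = fun t => (1 - z i)⁻¹ *
        (Sum.elim (fun _ => 0) (fun j => if i = j then 1 else 0) t : ℂ) := by
      ext t; rcases t with j | j <;> simp [oscC]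
    change traceFun hY hz _ = traceFun hY hz (contr (fun t => oscC z (Sum.inl i) t) w)
    rw [h3, contr_smul, map_smul, smul_eq_mul, eq_inv_mul_iff_mul_eq₀ (hne i)]
    have h4 : traceFun hY hz (ι ℂ (Sum.inl i) * word w) = fockTrace (Y * (an i * fockRep κ (word w))) := by
      simp [traceFun_apply]
    have h5 : traceFun hY hz (ι ℂ (Sum.inl i) * word w - contr
        (fun t => (Sum.elim (fun _ => 0) (fun j => if i = j then 1 else 0) t : ℂ)) w) =
        fockTrace (Y * (fockRep κ (word w) * an i)) := by
      rw [h2, traceFun_apply]; simp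
    rw [map_sub, h1, ← h4] at h5
    linear_combination h5
  · have hcm := mul_lift_word (Sum.elim an cr) (cr i)
      (fun t => (Sum.elim (fun j => if i = j then -1 else 0) (fun _ => 0) t : ℂ)) (fun t => by
        rcases t with j | j
        · have := an_mul_cr_sub j i
          simp only [Sum.elim_inl]
          rw [sub_eq_iff_eq_add'] at this
          rw [this]; simp only [eq_comm (a := i)]; split_ifs <;> simp
        · simp only [Sum.elim_inr, map_zero, add_zero]
          refine LinearMap.ext fun p => ?_
          simp [cr, mul_left_comm]) w
    have h1 := hY.trace_cr_mul i (fockRep κ (word w))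
    have h2 : fockRep κ (word w) * cr i = cr i * fockRep κ (word w) - fockRep κ (contr
        (fun t => (Sum.elim (fun j => if i = j then -1 else 0) (fun _ => 0) t : ℂ)) w) := by
      rw [eq_sub_iff_add_eq]; exact hcm.symm
    have h3 : (fun t => oscC z (Sum.inr i) t) = fun t => (-(z i * (1 - z i)⁻¹)) *
        (Sum.elim (fun j => if i = j then -1 else 0) (fun _ => 0) t : ℂ) := by
      ext t; rcases t with j | j <;> simp [oscC]
    change traceFun hY hz _ = traceFun hY hz (contr (fun t => oscC z (Sum.inr i) t) w)
    rw [h3, contr_smul, map_smul, smul_eq_mul]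
    have h4 : traceFun hY hz (ι ℂ (Sum.inr i) * word w) = fockTrace (Y * (cr i * fockRep κ (word w))) := by
      simp [traceFun_apply]
    have h5 : traceFun hY hz (ι ℂ (Sum.inr i) * word w - contr
        (fun t => (Sum.elim (fun j => if i = j then -1 else 0) (fun _ => 0) t : ℂ)) w) =
        fockTrace (Y * (fockRep κ (word w) * cr i)) := by
      rw [h2, traceFun_apply]; simp
    rw [← h4, ← h5, map_sub] at h1
    have := hne i
    field_simp
    linear_combination h1

end FockTrace

/-! ## Monodromy matrices and quasi-free functionals -/

section Monodromy

variable {K R R' : Type}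

theorem monodromy_map [Ring R] [Ring R'] (φ : R →+* R') (L : Matrix K K R) (N : ℕ)
    (k l : Fin N → K) : monodromy (L.map φ) N k l = φ (monodromy L N k l) := by
  simp only [monodromy, Matrix.of_apply, Matrix.map_apply, map_list_prod, List.map_ofFn]
  rfl

theorem monodromy_map_algHom [Ring R] [Ring R'] [Algebra ℂ R] [Algebra ℂ R'] (φ : R →ₐ[ℂ] R')
    (L : Matrix K K R) (N : ℕ) (k l : Fin N → K) :
    monodromy (L.map φ) N k l = φ (monodromy L N k l) :=
  monodromy_map (φ : R →+* R') L N k l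

theorem monodromy_succ [Ring R] (L : Matrix K K R) (N : ℕ) (k l : Fin (N + 1) → K) :
    monodromy L (N + 1) k l = L (k 0) (l 0) * monodromy L N (Fin.tail k) (Fin.tail l) := by
  simp [monodromy, List.ofFn_succ, Fin.tail]

theorem monodromy_mul [Ring R] [Fintype K] (A B : Matrix K K R)
    (h : ∀ i j k l, Commute (B i j) (A k l)) (N : ℕ) (k l : Fin N → K) :
    monodromy (A * B) N k l = ∑ m, monodromy A N k m * monodromy B N m l := by
  induction N with
  | zero => simp [monodromy]
  | succ N ih =>
    rw [← (Fin.consEquiv fun _ => K).sum_comp, Fintype.sum_prod_type, monodromy_succ,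
      Matrix.mul_apply, Finset.sum_mul]
    refine Finset.sum_congr rfl fun a _ => ?_
    rw [ih, Finset.mul_sum]
    refine Finset.sum_congr rfl fun m _ => ?_
    rw [monodromy_succ, monodromy_succ]
    simp only [Fin.consEquiv, Equiv.coe_fn_mk, Fin.cons_zero, Fin.tail_cons]
    have hc : Commute (B a (l 0)) (monodromy A N (Fin.tail k) m) := by
      rw [monodromy, Matrix.of_apply]
      refine Commute.list_prod_right _ _ fun x hx => ?_
      obtain ⟨i, rfl⟩ := (List.mem_ofFn' _ _).1 hx
      exact h _ _ _ _
    rw [mul_assoc, ← mul_assoc (B a (l 0)), hc.eq]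
    simp only [mul_assoc]

theorem monodromy_eq_tensorPow (B : Matrix K K ℂ) (N : ℕ) : monodromy B N = tensorPow B N := by
  ext k l
  simp [monodromy, tensorPow, List.prod_ofFn]

theorem monodromy_algebraMap [Ring R] [Algebra ℂ R] (B : Matrix K K ℂ) (N : ℕ) (k l : Fin N → K) :
    monodromy (B.map (algebraMap ℂ R)) N k l = algebraMap ℂ R (tensorPow B N k l) := by
  rw [monodromy_map, monodromy_eq_tensorPow]

variable [Fintype K]

theorem tensorPow_mul (A B : Matrix K K ℂ) (N : ℕ) :
    tensorPow (A * B) N = tensorPow A N * tensorPow B N := by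
  rw [← monodromy_eq_tensorPow, ← monodromy_eq_tensorPow, ← monodromy_eq_tensorPow]
  ext k l
  rw [monodromy_mul _ _ fun _ _ _ _ => Commute.all _ _, Matrix.mul_apply]

theorem tensorPow_one {K : Type} [DecidableEq K] (N : ℕ) : tensorPow (1 : Matrix K K ℂ) N = 1 := by
  ext k l
  simp only [tensorPow, Matrix.of_apply, Matrix.one_apply, Finset.prod_ite_zero, Finset.mem_univ,
    true_imp_iff, Finset.prod_const_one, funext_iff]

variable [DecidableEq K]

theorem inv_tensorPow {B : Matrix K K ℂ} (hB : IsUnit B) (N : ℕ) :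
    (tensorPow B N)⁻¹ = tensorPow B⁻¹ N := by
  refine Matrix.inv_eq_right_inv ?_
  rw [← tensorPow_mul, Matrix.mul_nonsing_inv _ ((Matrix.isUnit_iff_isUnit_det _).1 hB),
    tensorPow_one]

theorem isUnit_tensorPow {B : Matrix K K ℂ} (hB : IsUnit B) (N : ℕ) : IsUnit (tensorPow B N) := by
  refine IsUnit.of_mul_eq_one (tensorPow B⁻¹ N) ?_
  rw [← tensorPow_mul, Matrix.mul_nonsing_inv _ ((Matrix.isUnit_iff_isUnit_det _).1 hB),
    tensorPow_one]

theorem conjQ_mul {B : Matrix K K ℂ} (hB : IsUnit B) (N : ℕ)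
    (X Y : Matrix (Fin N → K) (Fin N → K) ℂ) :
    conjQ B N (X * Y) = conjQ B N X * conjQ B N Y := by
  have h := Matrix.nonsing_inv_mul _ ((Matrix.isUnit_iff_isUnit_det _).1 (isUnit_tensorPow hB N))
  simp only [conjQ, Matrix.mul_assoc]
  rw [← Matrix.mul_assoc (tensorPow B N)⁻¹, h, Matrix.one_mul]

theorem conjQ_conjQ (B B' : Matrix K K ℂ) (N : ℕ) (X : Matrix (Fin N → K) (Fin N → K) ℂ) :
    conjQ B N (conjQ B' N X) = conjQ (B * B') N X := by
  simp only [conjQ, tensorPow_mul, Matrix.mul_inv_rev, Matrix.mul_assoc]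

theorem monodromy_conjLax [Ring R] [Algebra ℂ R] (B : Matrix K K ℂ) (L : Matrix K K R) (N : ℕ)
    (k l : Fin N → K) : monodromy (conjLax B L) N k l =
      ∑ m', (∑ m, algebraMap ℂ R (tensorPow B N k m) * monodromy L N m m') *
        algebraMap ℂ R (tensorPow B⁻¹ N m' l) := by
  rw [conjLax, monodromy_mul _ (B⁻¹.map (algebraMap ℂ R)) fun _ _ _ _ => Algebra.commutes _ _]
  refine Finset.sum_congr rfl fun m' _ => ?_
  rw [monodromy_mul (B.map (algebraMap ℂ R)) _ fun _ _ _ _ => (Algebra.commutes _ _).symm, monodromy_algebraMap]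
  simp only [monodromy_algebraMap]

theorem conjLax_map [Ring R] [Ring R'] [Algebra ℂ R] [Algebra ℂ R'] (φ : R →ₐ[ℂ] R')
    (B : Matrix K K ℂ) (L : Matrix K K R) :
    (conjLax B L).map φ = conjLax B (L.map φ) := by
  ext i j
  simp [conjLax, Matrix.mul_apply, map_sum]

end Monodromy

section WickMatrix

open FreeAlgebra (ι)

variable {K S S₀ S₁ S₂ : Type}

/-- The matrix of expectation values of the monodromy matrix in a quasi-free functional. -/
def wickMat (c : S → S → ℂ) (L : Matrix K K (FreeAlgebra ℂ S)) (N : ℕ) :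
    Matrix (Fin N → K) (Fin N → K) ℂ :=
  Matrix.of fun k l => wick c (monodromy L N k l)

theorem wickMat_apply (c : S → S → ℂ) (L : Matrix K K (FreeAlgebra ℂ S)) (N : ℕ)
    (k l : Fin N → K) : wickMat c L N k l = wick c (monodromy L N k l) := rfl

theorem wickMat_map_lift {c₀ : S₀ → S₀ → ℂ} {c₁ : S₁ → S₁ → ℂ} {f : S₁ → FreeAlgebra ℂ S₀}
    (hf : ∀ s, f s ∈ linSpan S₀) (hc : ∀ s t, wick c₀ (f s * f t) = c₁ s t)
    (L : Matrix K K (FreeAlgebra ℂ S₁)) (N : ℕ) :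
    wickMat c₀ (L.map (FreeAlgebra.lift ℂ f)) N = wickMat c₁ L N := by
  ext k l
  rw [wickMat_apply, wickMat_apply, monodromy_map_algHom, wick_lift hf hc]

theorem wickMat_conjLax [Fintype K] [DecidableEq K] (c : S → S → ℂ) {B : Matrix K K ℂ}
    (hB : IsUnit B) (L : Matrix K K (FreeAlgebra ℂ S)) (N : ℕ) :
    wickMat c (conjLax B L) N = conjQ B N (wickMat c L N) := by
  ext k l
  rw [wickMat_apply, monodromy_conjLax, conjQ, inv_tensorPow hB, Matrix.mul_apply, map_sum]
  refine Finset.sum_congr rfl fun m' _ => ?_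
  rw [Matrix.mul_apply, ← Algebra.commutes, ← Algebra.smul_def, map_smul, map_sum, smul_eq_mul,
    mul_comm]
  congr 1
  refine Finset.sum_congr rfl fun m _ => ?_
  rw [← Algebra.smul_def, map_smul, smul_eq_mul, wickMat_apply]

theorem commute_wickRep_lift {c : S₀ → S₀ → ℂ} {f₁ : S₁ → FreeAlgebra ℂ S₀}
    {f₂ : S₂ → FreeAlgebra ℂ S₀} (h : ∀ s t, Commute (wickRep c (f₁ s)) (wickRep c (f₂ t)))
    (x : FreeAlgebra ℂ S₁) (y : FreeAlgebra ℂ S₂) :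
    Commute (wickRep c (FreeAlgebra.lift ℂ f₁ x)) (wickRep c (FreeAlgebra.lift ℂ f₂ y)) := by
  induction x using FreeAlgebra.induction with
  | grade0 r => rw [AlgHom.commutes, AlgHom.commutes]; exact Algebra.commutes _ _
  | grade1 s =>
    rw [FreeAlgebra.lift_ι_apply]
    induction y using FreeAlgebra.induction with
    | grade0 r => rw [AlgHom.commutes, AlgHom.commutes]; exact (Algebra.commutes _ _).symm
    | grade1 t => rw [FreeAlgebra.lift_ι_apply]; exact h s t
    | mul a b ha hb => simpa using ha.mul_right hb
    | add a b ha hb => simpa using ha.add_right hb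
  | mul a b ha hb => simpa using ha.mul_left hb
  | add a b ha hb => simpa using ha.add_left hb

/-- A product of expectation values over two independent sets of generators. -/
theorem wickMat_mul [Fintype K] {c₀ : S₀ → S₀ → ℂ} {c₁ : S₁ → S₁ → ℂ} {c₂ : S₂ → S₂ → ℂ}
    {f₁ : S₁ → FreeAlgebra ℂ S₀} {f₂ : S₂ → FreeAlgebra ℂ S₀} (h₁ : ∀ s, f₁ s ∈ linSpan S₀)
    (h₂ : ∀ s, f₂ s ∈ linSpan S₀) (hc₁ : ∀ s t, wick c₀ (f₁ s * f₁ t) = c₁ s t)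
    (hc₂ : ∀ s t, wick c₀ (f₂ s * f₂ t) = c₂ s t) (h₁₂ : ∀ s t, wick c₀ (f₁ s * f₂ t) = 0)
    (h₂₁ : ∀ s t, wick c₀ (f₂ s * f₁ t) = 0) (L₁ : Matrix K K (FreeAlgebra ℂ S₁))
    (L₂ : Matrix K K (FreeAlgebra ℂ S₂)) (N : ℕ) :
    wickMat c₁ L₁ N * wickMat c₂ L₂ N = Matrix.of fun k l =>
      vev (monodromy (L₁.map ((wickRep c₀).comp (FreeAlgebra.lift ℂ f₁)) *
        L₂.map ((wickRep c₀).comp (FreeAlgebra.lift ℂ f₂))) N k l) := by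
  ext k l
  rw [Matrix.of_apply, monodromy_mul, Matrix.mul_apply, map_sum]
  · refine Finset.sum_congr rfl fun m _ => ?_
    rw [monodromy_map_algHom, monodromy_map_algHom, AlgHom.comp_apply, AlgHom.comp_apply,
      ← map_mul, ← wick_apply, wick_lift_mul_lift h₁ h₂ hc₁ h₁₂, wick_lift h₂ hc₂]
    rfl
  · intro i j i' j'
    exact (commute_wickRep_lift (fun s t => commute_wickRep c₀ (h₁ s) (h₂ t)
      ((h₁₂ s t).trans (h₂₁ t s).symm)) _ _).symm

theorem wickMat_zero [DecidableEq K] [Fintype K] (U : Matrix K K (FreeAlgebra ℂ S))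
    (hU : U.map (FreeAlgebra.lift ℂ fun _ : S => (0 : FreeAlgebra ℂ S)) = 1) (N : ℕ) :
    wickMat (0 : S → S → ℂ) U N = 1 := by
  rw [← wickMat_map_lift (c₀ := (0 : S → S → ℂ)) (f := fun _ => 0)
    (fun _ => Submodule.zero_mem _) (by simp), hU]
  ext k l
  have h : (1 : Matrix K K (FreeAlgebra ℂ S)) = (1 : Matrix K K ℂ).map (algebraMap ℂ _) := by
    simp
  rw [wickMat_apply, h, monodromy_algebraMap, tensorPow_one, Algebra.algebraMap_eq_smul_one,
    map_smul, wick_one, smul_eq_mul, mul_one]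

/-- Two independent copies of a two-point function. -/
def doubleC (c : S → S → ℂ) : S ⊕ S → S ⊕ S → ℂ
  | Sum.inl s, Sum.inl t => c s t
  | Sum.inr s, Sum.inr t => c s t
  | _, _ => 0

/-- Factorization of expectation values: a product of Lax matrices with independent oscillators
`(a₁, ā₁)`, `(a₂, ā₂)` is rewritten in terms of the independent oscillators `(a₁ - a₂, ā₁)` and
`(a₂, ā₁ + ā₂)`, where the second set only enters through a matrix `U` which does not contribute. -/
theorem wickMat_factor [DecidableEq K] [Fintype K] {κ : Type} [Fintype κ] [DecidableEq κ]
    (z : κ → ℂ) (L₁ L₂ L₃ : Matrix K K (FreeAlgebra ℂ (κ ⊕ κ))) (U : Matrix K K (FreeAlgebra ℂ κ))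
    (hU : U.map (FreeAlgebra.lift ℂ fun _ : κ => (0 : FreeAlgebra ℂ κ)) = 1)
    (H : ∀ (R : Type) [Ring R] [Algebra ℂ R] (a₁ a₂ b₁ b₂ : κ → R),
      (∀ i j, Commute (a₁ i) (a₂ j)) → (∀ i j, Commute (b₁ i) (b₂ j)) →
      L₁.map (FreeAlgebra.lift ℂ (Sum.elim a₁ b₁)) * L₂.map (FreeAlgebra.lift ℂ (Sum.elim a₂ b₂)) =
      L₃.map (FreeAlgebra.lift ℂ (Sum.elim (a₁ - a₂) b₁)) * U.map (FreeAlgebra.lift ℂ (b₁ + b₂)))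
    (N : ℕ) :
    wickMat (oscC z) L₁ N * wickMat (oscC z) L₂ N = wickMat (oscC z) L₃ N := by
  set c₀ := doubleC (oscC z)
  have hι : ∀ s : (κ ⊕ κ) ⊕ (κ ⊕ κ), ι ℂ s ∈ linSpan _ := ι_mem_linSpan
  have h0 : ∀ i j : κ, Commute (wickRep c₀ (ι ℂ (Sum.inl (Sum.inl i))))
      (wickRep c₀ (ι ℂ (Sum.inr (Sum.inl j)))) := fun i j =>
    commute_wickRep _ (hι _) (hι _) (by simp [c₀, doubleC])
  have h0' : ∀ i j : κ, Commute (wickRep c₀ (ι ℂ (Sum.inl (Sum.inr i))))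
      (wickRep c₀ (ι ℂ (Sum.inr (Sum.inr j)))) := fun i j =>
    commute_wickRep _ (hι _) (hι _) (by simp [c₀, doubleC])
  have h := H _ _ _ _ _ h0 h0'
  have e : ∀ {S' : Type} (f : S' → FreeAlgebra ℂ ((κ ⊕ κ) ⊕ (κ ⊕ κ))),
      (wickRep c₀).comp (FreeAlgebra.lift ℂ f) = FreeAlgebra.lift ℂ fun s => wickRep c₀ (f s) := by
    intro S' f
    ext s
    simp
  have hl := wickMat_mul (c₀ := c₀) (c₁ := oscC z) (c₂ := oscC z) (f₁ := fun s => ι ℂ (Sum.inl s))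
    (f₂ := fun s => ι ℂ (Sum.inr s)) (fun _ => hι _) (fun _ => hι _) (by simp [c₀, doubleC])
    (by simp [c₀, doubleC]) (by simp [c₀, doubleC]) (by simp [c₀, doubleC]) L₁ L₂ N
  have hr := wickMat_mul (c₀ := c₀) (c₁ := oscC z) (c₂ := (0 : κ → κ → ℂ))
    (f₁ := Sum.elim (fun i => ι ℂ (Sum.inl (Sum.inl i)) - ι ℂ (Sum.inr (Sum.inl i)))
      fun i => ι ℂ (Sum.inl (Sum.inr i)))
    (f₂ := fun i => ι ℂ (Sum.inl (Sum.inr i)) + ι ℂ (Sum.inr (Sum.inr i)))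
    (by rintro (i | i)
        · exact Submodule.sub_mem _ (hι _) (hι _)
        · exact hι _)
    (fun i => Submodule.add_mem _ (hι _) (hι _))
    (by rintro (i | i) (j | j) <;> simp [c₀, doubleC, sub_mul, mul_sub, oscC])
    (by intro i j; simp [c₀, doubleC, add_mul, mul_add, oscC])
    (by rintro (i | i) j <;> simp [c₀, doubleC, sub_mul, mul_add, oscC])
    (by rintro i (j | j) <;> simp [c₀, doubleC, mul_sub, add_mul, oscC]) L₃ U N
  rw [wickMat_zero U hU, Matrix.mul_one] at hr
  rw [hl, hr, e, e, e, e]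
  have e1 : (fun s : κ ⊕ κ => wickRep c₀ (ι ℂ (Sum.inl s))) =
      Sum.elim (fun i => wickRep c₀ (ι ℂ (Sum.inl (Sum.inl i))))
        (fun i => wickRep c₀ (ι ℂ (Sum.inl (Sum.inr i)))) := by
    ext1 s; rcases s with i | i <;> rfl
  have e2 : (fun s : κ ⊕ κ => wickRep c₀ (ι ℂ (Sum.inr s))) =
      Sum.elim (fun i => wickRep c₀ (ι ℂ (Sum.inr (Sum.inl i))))
        (fun i => wickRep c₀ (ι ℂ (Sum.inr (Sum.inr i)))) := by
    ext1 s; rcases s with i | i <;> rfl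
  have e3 : (fun s : κ ⊕ κ => wickRep c₀ (Sum.elim
      (fun i => ι ℂ (Sum.inl (Sum.inl i)) - ι ℂ (Sum.inr (Sum.inl i)))
      (fun i => ι ℂ (Sum.inl (Sum.inr i))) s)) =
      Sum.elim ((fun i => wickRep c₀ (ι ℂ (Sum.inl (Sum.inl i)))) -
        fun i => wickRep c₀ (ι ℂ (Sum.inr (Sum.inl i))))
        (fun i => wickRep c₀ (ι ℂ (Sum.inl (Sum.inr i)))) := by
    ext1 s; rcases s with i | i <;> simp
  have e4 : (fun i : κ => wickRep c₀ (ι ℂ (Sum.inl (Sum.inr i)) + ι ℂ (Sum.inr (Sum.inr i)))) =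
      (fun i => wickRep c₀ (ι ℂ (Sum.inl (Sum.inr i)))) +
        fun i => wickRep c₀ (ι ℂ (Sum.inr (Sum.inr i))) := by
    ext1 i; simp
  rw [e1, e2, h, e3, e4]

/-- The particle-hole substitution `a_i ↦ α ā_i`, `ā_i ↦ -α a_i` of the oscillators in `s`. -/
def flipGen {κ : Type} (s : κ → Prop) [DecidablePred s] (α : ℂ) : κ ⊕ κ → FreeAlgebra ℂ (κ ⊕ κ) :=
  Sum.elim (fun i => if s i then α • ι ℂ (Sum.inr i) else ι ℂ (Sum.inl i))
    (fun i => if s i then -(α • ι ℂ (Sum.inl i)) else ι ℂ (Sum.inr i))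

theorem wickMat_flipGen {κ : Type} [Fintype κ] [DecidableEq κ] (s : κ → Prop) [DecidablePred s]
    {α : ℂ} (hα : α * α = 1) {z : κ → ℂ} (h0 : ∀ i, z i ≠ 0) (h1 : ∀ i, z i ≠ 1)
    (L : Matrix K K (FreeAlgebra ℂ (κ ⊕ κ))) (N : ℕ) :
    wickMat (oscC z) (L.map (FreeAlgebra.lift ℂ (flipGen s α))) N =
      wickMat (oscC fun i => if s i then (z i)⁻¹ else z i) L N := by
  have h2 : ∀ i, 1 - z i ≠ 0 := fun i => sub_ne_zero.2 (h1 i).symm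
  have h3 : ∀ i, 1 - (z i)⁻¹ ≠ 0 := fun i => sub_ne_zero.2 fun h => h1 i (inv_eq_one.1 h.symm)
  refine wickMat_map_lift ?_ ?_ L N
  · rintro (i | i) <;> simp only [flipGen, Sum.elim_inl, Sum.elim_inr] <;> split_ifs
    · exact Submodule.smul_mem _ _ (ι_mem_linSpan _)
    · exact ι_mem_linSpan _
    · exact Submodule.neg_mem _ (Submodule.smul_mem _ _ (ι_mem_linSpan _))
    · exact ι_mem_linSpan _
  · have k1 : ∀ i, z i * (1 - z i)⁻¹ = -(1 - (z i)⁻¹)⁻¹ := by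
      intro i
      have := h0 i; have := h2 i; have := h3 i
      rw [eq_neg_iff_add_eq_zero]
      have h4 : 1 - (z i)⁻¹ = -(1 - z i) / z i := by field_simp; ring
      rw [h4]; field_simp; ring
    have k2 : ∀ i, (1 - z i)⁻¹ = -((z i)⁻¹ * (1 - (z i)⁻¹)⁻¹) := by
      intro i
      have := h0 i
      rw [← mul_neg, ← k1]; field_simp
    rintro (i | i) (j | j) <;> simp only [flipGen, Sum.elim_inl, Sum.elim_inr, oscC] <;>
      by_cases hi : s i <;> by_cases hj : s j <;>
      simp only [hi, hj, if_true, if_false, smul_mul_assoc, mul_smul_comm, neg_mul, mul_neg,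
        map_neg, map_smul, wick_ι_mul_ι, oscC, smul_eq_mul, mul_zero, neg_zero] <;>
      rcases eq_or_ne i j with rfl | hij <;>
      simp_all [← mul_assoc]

end WickMatrix

section TraceMatrix

open FreeAlgebra (ι)

variable {K κ : Type} {Y : FockOp κ} {d : ℂ} {z : κ → ℂ}

theorem fockRep_comp_flipGen_one (s : κ → Prop) [DecidablePred s] :
    (fockRep κ).comp (FreeAlgebra.lift ℂ (flipGen s 1)) =
      FreeAlgebra.lift ℂ (Sum.elim (anPH s) (crPH s)) := by
  ext t
  rcases t with i | i <;> by_cases hi : s i <;> simp [flipGen, anPH, crPH, hi]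

theorem fockRep_comp_flipGen_neg_one (s : κ → Prop) [DecidablePred s] :
    (fockRep κ).comp (FreeAlgebra.lift ℂ (flipGen s (-1))) =
      FreeAlgebra.lift ℂ (Sum.elim (anPH' s) (crPH' s)) := by
  ext t
  rcases t with i | i <;> by_cases hi : s i <;> simp [flipGen, anPH', crPH', hi]

theorem crPH_mul_anPH (s : κ → Prop) [DecidablePred s] (o : κ) :
    crPH s o * anPH s o = if s o then -(1 + cr o * an o) else cr o * an o := by
  classical
  have := an_mul_cr_sub o o
  rw [if_pos rfl, sub_eq_iff_eq_add] at this
  by_cases h : s o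
  · simp only [crPH, anPH, if_pos h]
    rw [show -an o * cr o = -(an o * cr o) from
      LinearMap.ext fun _ => rfl, this]
  · simp only [crPH, anPH, if_neg h]

theorem anPH_mul_crPH (s : κ → Prop) [DecidablePred s] (o : κ) :
    anPH s o * crPH s o = 1 + crPH s o * anPH s o := by
  classical
  have := an_mul_cr_sub o o
  rw [if_pos rfl, sub_eq_iff_eq_add] at this
  by_cases h : s o
  · simp only [crPH, anPH, if_pos h]
    rw [show -an o * cr o = -(an o * cr o) from
      LinearMap.ext fun _ => rfl, this,
      show cr o * -an o = -(cr o * an o) from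
        LinearMap.ext fun _ => map_neg (cr o) _]
    abel
  · simp only [crPH, anPH, if_neg h, this]

theorem cr_mul_an_monomial (i : κ) (m : κ →₀ ℕ) :
    (cr i * an i) (MvPolynomial.monomial m (1 : ℂ)) =
      (m i : ℂ) • MvPolynomial.monomial m (1 : ℂ) := by
  simp only [cr, an, Module.End.mul_apply, LinearMap.mulLeft_apply, Derivation.coeFn_coe,
    MvPolynomial.pderiv_monomial, MvPolynomial.X, MvPolynomial.monomial_mul,
    MvPolynomial.smul_monomial, one_mul, smul_eq_mul, mul_one]
  rcases Nat.eq_zero_or_pos (m i) with h | h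
  · simp [h]
  · rw [add_tsub_cancel_of_le]
    rw [Finsupp.single_le_iff]
    exact h

variable [Fintype κ]

theorem isGeomDiag_expDiag {X : FockOp κ} {a : ℂ} {w : κ → ℂ}
    (hX : X = a • 1 + ∑ i, w i • (cr i * an i)) :
    IsGeomDiag (expDiag X) (Complex.exp a) fun i => Complex.exp (w i) := by
  classical
  intro p m
  induction p using MvPolynomial.induction_on' with
  | monomial u c =>
    have h1 : X (MvPolynomial.monomial u 1) =
        (a + ∑ i, w i * u i) • MvPolynomial.monomial u 1 := by
      rw [hX]
      simp only [LinearMap.add_apply, LinearMap.smul_apply, LinearMap.sum_apply,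
        cr_mul_an_monomial, Module.End.one_apply, smul_smul, add_smul, Finset.sum_smul]
    have h2 : (MvPolynomial.monomial u c : Fock κ) = c • MvPolynomial.monomial u 1 := by
      simp [MvPolynomial.smul_monomial]
    rw [h2, map_smul, expDiag_apply X u _ h1]
    simp only [MvPolynomial.coeff_smul, MvPolynomial.coeff_monomial, smul_eq_mul]
    split_ifs with h
    · subst h
      rw [Complex.exp_add, Complex.exp_sum]
      simp only [← Complex.exp_nat_mul, mul_comm (w _)]
      ring
    · simp
  | add p q hp hq => simp only [map_add, MvPolynomial.coeff_add, hp, hq, mul_add]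

theorem IsGeomDiag.traceConverges (hY : IsGeomDiag Y d z) (hz : ∀ i, ‖z i‖ < 1)
    (L : Matrix K K (FreeAlgebra ℂ (κ ⊕ κ))) (N : ℕ) :
    TraceConverges Y (L.map (fockRep κ)) N := by
  refine ⟨by simpa using hY.summable hz 1, fun k l => ?_⟩
  rw [monodromy_map_algHom]
  exact hY.summable hz _

theorem IsGeomDiag.trace_ne_zero (hY : IsGeomDiag Y d z) (hz : ∀ i, ‖z i‖ < 1) (hd : d ≠ 0) :
    fockTrace Y ≠ 0 := by
  rw [hY.trace hz]
  refine mul_ne_zero hd (Finset.prod_ne_zero_iff.2 fun i _ => inv_ne_zero fun h => ?_)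
  have := hz i
  rw [← sub_eq_zero.1 h] at this
  simp at this

theorem IsGeomDiag.normTraceConverges (hY : IsGeomDiag Y d z) (hz : ∀ i, ‖z i‖ < 1) (hd : d ≠ 0)
    (L : Matrix K K (FreeAlgebra ℂ (κ ⊕ κ))) (N : ℕ) :
    NormTraceConverges Y (L.map (fockRep κ)) N :=
  ⟨hY.traceConverges hz L N, hY.trace_ne_zero hz hd⟩

variable [DecidableEq κ]

theorem IsGeomDiag.twistedTrace (hY : IsGeomDiag Y d z) (hz : ∀ i, ‖z i‖ < 1)
    (L : Matrix K K (FreeAlgebra ℂ (κ ⊕ κ))) (N : ℕ) :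
    twistedTrace Y (L.map (fockRep κ)) N = fockTrace Y • wickMat (oscC z) L N := by
  ext k l
  rw [BaxterQ.twistedTrace, Matrix.of_apply, monodromy_map_algHom, hY.trace_mul hz]
  rfl

theorem IsGeomDiag.normTrace (hY : IsGeomDiag Y d z) (hz : ∀ i, ‖z i‖ < 1) (hd : d ≠ 0)
    (L : Matrix K K (FreeAlgebra ℂ (κ ⊕ κ))) (N : ℕ) :
    normTrace Y (L.map (fockRep κ)) N = wickMat (oscC z) L N := by
  rw [BaxterQ.normTrace, hY.twistedTrace hz, smul_smul, inv_mul_cancel₀ (hY.trace_ne_zero hz hd),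
    one_smul]

end TraceMatrix

/-! ## Regular functions of the twists -/

section Regular

open FreeAlgebra (ι)

variable {σ S : Type} {V : Set (σ → ℂ)} {f g : (σ → ℂ) → ℂ}

/-- On `V`, the function `f` is a regular rational function of the `τ_i = exp (h_i)`. -/
def IsRegular (V : Set (σ → ℂ)) (f : (σ → ℂ) → ℂ) : Prop :=
  ∃ P D : MvPolynomial σ ℂ, ∀ h ∈ V,
    MvPolynomial.eval (fun i => Complex.exp (h i)) D ≠ 0 ∧
    f h = MvPolynomial.eval (fun i => Complex.exp (h i)) P /
      MvPolynomial.eval (fun i => Complex.exp (h i)) D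

theorem isRegular_const (a : ℂ) : IsRegular V fun _ => a :=
  ⟨MvPolynomial.C a, 1, fun h _ => by simp⟩

theorem isRegular_exp (i : σ) : IsRegular V fun h => Complex.exp (h i) :=
  ⟨MvPolynomial.X i, 1, fun h _ => by simp⟩

theorem IsRegular.add (hf : IsRegular V f) (hg : IsRegular V g) :
    IsRegular V fun h => f h + g h := by
  obtain ⟨P, D, hf⟩ := hf
  obtain ⟨P', D', hg⟩ := hg
  refine ⟨P * D' + D * P', D * D', fun h hh => ⟨?_, ?_⟩⟩
  · simpa using ⟨(hf h hh).1, (hg h hh).1⟩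
  · beta_reduce
    rw [(hf h hh).2, (hg h hh).2, div_add_div _ _ (hf h hh).1 (hg h hh).1]
    simp

theorem IsRegular.mul (hf : IsRegular V f) (hg : IsRegular V g) :
    IsRegular V fun h => f h * g h := by
  obtain ⟨P, D, hf⟩ := hf
  obtain ⟨P', D', hg⟩ := hg
  refine ⟨P * P', D * D', fun h hh => ⟨?_, ?_⟩⟩
  · simpa using ⟨(hf h hh).1, (hg h hh).1⟩
  · beta_reduce
    rw [(hf h hh).2, (hg h hh).2, div_mul_div_comm]
    simp

theorem IsRegular.inv (hf : IsRegular V f) (h0 : ∀ h ∈ V, f h ≠ 0) :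
    IsRegular V fun h => (f h)⁻¹ := by
  obtain ⟨P, D, hf⟩ := hf
  refine ⟨D, P, fun h hh => ⟨fun h1 => h0 h hh ?_, ?_⟩⟩
  · rw [(hf h hh).2, h1, zero_div]
  · beta_reduce
    rw [(hf h hh).2, inv_div]

theorem isRegular_exp_neg (i : σ) : IsRegular V fun h => Complex.exp (-h i) := by
  simpa only [Complex.exp_neg] using (isRegular_exp i).inv fun h _ => Complex.exp_ne_zero _

theorem isRegular_wick_contr {c : (σ → ℂ) → S → S → ℂ}
    (hc : ∀ s t, IsRegular V fun h => c h s t) (s : S) (u w : List S)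
    (H : ∀ v : List S, v.length + 1 = u.length + w.length →
      IsRegular V fun h => wick (c h) (word v)) :
    IsRegular V fun h => wick (c h) (word u * contr (c h s) w) := by
  induction w generalizing u with
  | nil => simpa [contr] using isRegular_const (V := V) 0
  | cons t w ih =>
    have h1 := ih (u ++ [t]) fun v hv => H v (by simp at hv ⊢; omega)
    have h2 := (hc s t).mul (H (u ++ w) (by simp; omega))
    convert h2.add h1 using 2 with h
    rw [contr, mul_add, map_add, mul_smul_comm, map_smul, ← word_append, ← mul_assoc, word_append u [t]]
    simp

theorem isRegular_wick {c : (σ → ℂ) → S → S → ℂ} (hc : ∀ s t, IsRegular V fun h => c h s t)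
    (x : FreeAlgebra ℂ S) : IsRegular V fun h => wick (c h) x := by
  have hw : ∀ n, ∀ w : List S, w.length = n → IsRegular V fun h => wick (c h) (word w) := by
    intro n
    induction n using Nat.strong_induction_on with
    | _ n ih =>
      intro w hw
      cases w with
      | nil => simpa using isRegular_const (V := V) 1
      | cons s w =>
        simp only [word_cons, wick_ι_mul_word]
        simpa using isRegular_wick_contr hc s [] w fun v hv => ih v.length (by
          simp at hv hw; omega) v rfl
  have hx : x ∈ Submodule.span ℂ (Set.range (word (S := S))) := by rw [span_word]; trivial
  induction hx using Submodule.span_induction with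
  | mem x hx =>
    obtain ⟨w, rfl⟩ := hx
    exact hw _ w rfl
  | zero => simpa using isRegular_const (V := V) 0
  | add x y _ _ hx hy => simpa using hx.add hy
  | smul a x _ hx => simpa using (isRegular_const a).mul hx

theorem isRegular_oscC {κ : Type} [DecidableEq κ] {z : (σ → ℂ) → κ → ℂ}
    (hz : ∀ i, IsRegular V fun h => z h i) (h1 : ∀ h ∈ V, ∀ i, z h i ≠ 1) (s t : κ ⊕ κ) :
    IsRegular V fun h => oscC (z h) s t := by
  have h2 : ∀ i, IsRegular V fun h => (1 - z h i)⁻¹ := fun i => by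
    refine IsRegular.inv ?_ fun h hh => sub_ne_zero.2 (h1 h hh i).symm
    simpa [sub_eq_add_neg] using (isRegular_const 1).add ((isRegular_const (-1)).mul (hz i))
  rcases s with i | i <;> rcases t with j | j <;> simp only [oscC]
  · exact isRegular_const 0
  · split_ifs
    · exact h2 i
    · exact isRegular_const 0
  · split_ifs
    · exact (hz i).mul (h2 i)
    · exact isRegular_const 0
  · exact isRegular_const 0

/-- The rational continuation exists if it is given by a quasi-free functional. -/
theorem ratCont_eq_wickMat [Fintype σ] {K κ : Type} [DecidableEq κ] {U V : Set (σ → ℂ)}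
    (hU : IsOpen U) (hne : U.Nonempty) (hUV : U ⊆ V) {z : (σ → ℂ) → κ → ℂ}
    (hz : ∀ i, IsRegular V fun h => z h i) (h1 : ∀ h ∈ V, ∀ i, z h i ≠ 1) (N : ℕ)
    (L : Matrix K K (FreeAlgebra ℂ (κ ⊕ κ))) (F : (σ → ℂ) → Matrix (Fin N → K) (Fin N → K) ℂ)
    (hF : ∀ h ∈ U, F h = wickMat (oscC (z h)) L N) :
    IsRatCont U V F (ratCont U V F) ∧ ∀ h ∈ V, ratCont U V F h = wickMat (oscC (z h)) L N := by
  have h2 : IsRatCont U V F fun h => wickMat (oscC (z h)) L N :=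
    ⟨fun k l => isRegular_wick (isRegular_oscC hz h1) (monodromy L N k l),
      fun h hh => (hF h hh).symm⟩
  have h3 : IsRatCont U V F (ratCont U V F) := by
    have H : ∃ g, IsRatCont U V F g := ⟨_, h2⟩
    rw [ratCont, dif_pos H]
    exact H.choose_spec
  exact ⟨h3, h3.unique hU hne hUV h2⟩

end Regular

/-! ## Linear Lax matrices -/

section LinearLax

open FreeAlgebra (ι)

variable {p q R R' κ : Type} [Ring R] [Algebra ℂ R] [Ring R'] [Algebra ℂ R'] [Fintype κ]

/-- A matrix whose entries are linear combinations of the `f o`. -/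
def linBlock (α : q → p → κ → ℂ) (f : κ → R) : Matrix q p R :=
  Matrix.of fun j i => ∑ o, α j i o • f o

theorem linBlock_map (α : q → p → κ → ℂ) (f : κ → R) (φ : R →ₐ[ℂ] R') :
    (linBlock α f).map φ = linBlock α fun o => φ (f o) := by
  ext j i
  simp [linBlock]

theorem linBlock_add (α : q → p → κ → ℂ) (f g : κ → R) :
    linBlock α (f + g) = linBlock α f + linBlock α g := by
  ext j i
  simp [linBlock, Finset.sum_add_distrib]

theorem linBlock_sub (α : q → p → κ → ℂ) (f g : κ → R) :
    linBlock α (f - g) = linBlock α f - linBlock α g := by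
  ext j i
  simp [linBlock, smul_sub, Finset.sum_sub_distrib]

theorem linBlock_zero (α : q → p → κ → ℂ) : linBlock α (fun _ => (0 : R)) = 0 := by
  ext j i
  simp [linBlock]

variable [DecidableEq p] [DecidableEq q]

theorem laxPlus_map [Fintype q] (A : Matrix q p R) (B : Matrix p q R) (x : ℂ) (φ : R →ₐ[ℂ] R') :
    (laxPlus A B x).map φ = laxPlus (A.map φ) (B.map φ) x := by
  ext (i | i) (j | j) <;> simp [laxPlus, Matrix.mul_apply, Matrix.one_apply, apply_ite φ]

theorem laxMinus_map [Fintype p] (A : Matrix q p R) (B : Matrix p q R) (x : ℂ) (φ : R →ₐ[ℂ] R') :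
    (laxMinus A B x).map φ = laxMinus (A.map φ) (B.map φ) x := by
  ext (i | i) (j | j) <;> simp [laxMinus, Matrix.mul_apply, Matrix.one_apply, apply_ite φ]

variable [Fintype p] [Fintype q]

theorem laxLin_map (A : Matrix q p R) (B : Matrix p q R) (u v : ℂ) (φ : R →ₐ[ℂ] R') :
    (laxLin A B u v).map φ = laxLin (A.map φ) (B.map φ) u v := by
  ext (i | i) (j | j) <;>
    simp [laxLin, Matrix.mul_apply, Matrix.one_apply, apply_ite φ, Matrix.sub_apply]

theorem laxPlus_mul_laxMinus (A₁ A₂ : Matrix q p R) (B₁ B₂ : Matrix p q R) (u v : ℂ) :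
    laxPlus A₁ B₁ u * laxMinus A₂ B₂ v =
      laxLin (A₁ - A₂) B₁ u v * Matrix.fromBlocks 1 (B₁ + B₂) 0 1 := by
  simp only [laxPlus, laxMinus, laxLin, Matrix.fromBlocks_multiply, Matrix.mul_one, Matrix.mul_zero,
    add_zero, Matrix.one_mul, Matrix.mul_add, Matrix.sub_mul, Matrix.mul_sub,
    Matrix.mul_smul, Matrix.smul_mul, Matrix.neg_mul, Matrix.mul_assoc, sub_smul]
  congr 1 <;> abel

variable [DecidableEq κ]

theorem wickMat_laxPlus_mul_laxMinus (z : κ → ℂ) (α : q → p → κ → ℂ) (β : p → q → κ → ℂ) (u v : ℂ)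
    (N : ℕ) :
    wickMat (oscC z) (laxPlus (linBlock α fun o => ι ℂ (Sum.inl o))
        (linBlock β fun o => ι ℂ (Sum.inr o)) u) N *
      wickMat (oscC z) (laxMinus (linBlock α fun o => ι ℂ (Sum.inl o))
        (linBlock β fun o => ι ℂ (Sum.inr o)) v) N =
      wickMat (oscC z) (laxLin (linBlock α fun o => ι ℂ (Sum.inl o))
        (linBlock β fun o => ι ℂ (Sum.inr o)) u v) N := by
  refine wickMat_factor z _ _ _ (Matrix.fromBlocks 1 (linBlock β fun o => ι ℂ o) 0 1) ?_ ?_ N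
  · rw [Matrix.fromBlocks_map, linBlock_map]
    simp [linBlock_zero]
  · intro R _ _ a₁ a₂ b₁ b₂ _ _
    rw [laxPlus_map, laxMinus_map, laxLin_map, Matrix.fromBlocks_map]
    simp only [linBlock_map, FreeAlgebra.lift_ι_apply, Sum.elim_inl, Sum.elim_inr]
    rw [laxPlus_mul_laxMinus, ← linBlock_sub, ← linBlock_add]
    simp [Pi.sub_def, Pi.add_def]

end LinearLax

/-! ## Spinorial Lax matrices in types C and D -/

section Spin

open FreeAlgebra (ι)

variable {r : ℕ} {R κ : Type} [Ring R] [Algebra ℂ R]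

theorem sgn_eq (μ : Fin r → ℤˣ) (i : Fin r) : sgn μ i = if μ i = -1 then -1 else 1 := by
  rcases Int.units_eq_one_or (μ i) with h | h <;> simp [sgn, h]

theorem sgn_mul_self (μ : Fin r → ℤˣ) (i : Fin r) : sgn μ i * sgn μ i = 1 := by
  rw [sgn_eq]; split_ifs <;> norm_num

theorem weylMat_mul_transpose {ε : ℂ} (hε : ε * ε = 1) (μ : Fin r → ℤˣ) :
    weylMat ε μ * (weylMat ε μ).transpose = 1 := by
  rw [weylMat, Matrix.fromBlocks_transpose, Matrix.fromBlocks_multiply]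
  simp only [Matrix.diagonal_transpose, Matrix.diagonal_mul_diagonal, Matrix.diagonal_add,
    ← Matrix.fromBlocks_one]
  congr 1 <;> ext i j <;> rcases eq_or_ne i j with rfl | h <;>
    simp_all
  all_goals split_ifs <;> simp

theorem weylMat_inv {ε : ℂ} (hε : ε * ε = 1) (μ : Fin r → ℤˣ) :
    (weylMat ε μ)⁻¹ = (weylMat ε μ).transpose :=
  Matrix.inv_eq_right_inv (weylMat_mul_transpose hε μ)

theorem isUnit_weylMat {ε : ℂ} (hε : ε * ε = 1) (μ : Fin r → ℤˣ) : IsUnit (weylMat ε μ) :=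
  IsUnit.of_mul_eq_one _ (weylMat_mul_transpose hε μ)

theorem conjLax_weylMat_diag {ε : ℂ} (hε : ε * ε = 1) (μ : Fin r → ℤˣ)
    (L : Matrix (Fin r ⊕ Fin r) (Fin r ⊕ Fin r) R) (i : Fin r) :
    conjLax (weylMat ε μ) L (Sum.inl i) (Sum.inl i) =
      if μ i = -1 then L (Sum.inr i) (Sum.inr i) else L (Sum.inl i) (Sum.inl i) := by
  rw [conjLax, weylMat_inv hε]
  rcases Int.units_eq_one_or (μ i) with h | h <;>
    simp [Matrix.mul_apply, weylMat, Matrix.diagonal_apply, h, apply_ite (algebraMap ℂ R)]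

/-- The matrix `B_μ⁻¹ B_{-μ}`. -/
def weylFlip (ε : ℂ) (s : Fin r → ℂ) : Matrix (Fin r ⊕ Fin r) (Fin r ⊕ Fin r) ℂ :=
  Matrix.fromBlocks 0 (Matrix.diagonal s) (Matrix.diagonal fun i => ε * s i) 0

theorem weylMat_neg {ε : ℂ} (hε : ε * ε = 1) (μ : Fin r → ℤˣ) :
    weylMat ε (-μ) = weylMat ε μ * weylFlip ε fun i => if μ i = 1 then 1 else ε := by
  rw [weylMat, weylMat, weylFlip, Matrix.fromBlocks_multiply]
  simp only [Matrix.diagonal_mul_diagonal, Matrix.mul_zero, zero_add, add_zero]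
  congr 1 <;> congr 1 <;> ext i <;>
    rcases Int.units_eq_one_or (μ i) with h | h <;> simp [h, hε]

theorem weylFlip_mul {ε : ℂ} (hε : ε * ε = 1) {s : Fin r → ℂ} (hs : ∀ i, s i * s i = 1) :
    weylFlip ε s *
      Matrix.fromBlocks 0 (Matrix.diagonal fun i => ε * s i) (Matrix.diagonal s) 0 = 1 := by
  rw [weylFlip, Matrix.fromBlocks_multiply, ← Matrix.fromBlocks_one]
  simp only [Matrix.diagonal_mul_diagonal, Matrix.mul_zero, Matrix.zero_mul, zero_add, add_zero, hs,
    mul_mul_mul_comm ε, hε, one_mul, Matrix.diagonal_one]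

theorem isUnit_weylFlip {ε : ℂ} (hε : ε * ε = 1) {s : Fin r → ℂ} (hs : ∀ i, s i * s i = 1) :
    IsUnit (weylFlip ε s) :=
  IsUnit.of_mul_eq_one _ (weylFlip_mul hε hs)

theorem conjLax_weylFlip_laxPlus {ε : ℂ} (hε : ε * ε = 1) {s : Fin r → ℂ}
    (hs : ∀ i, s i * s i = 1) (A B : Matrix (Fin r) (Fin r) R) (x : ℂ) :
    conjLax (weylFlip ε s) (laxPlus A B x) =
      laxMinus (Matrix.of fun i j => (ε * s i * s j) • B i j)
        (Matrix.of fun i j => (-(ε * s i * s j)) • A i j) x := by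
  rw [conjLax, Matrix.inv_eq_right_inv (weylFlip_mul hε hs), weylFlip, laxPlus, laxMinus,
    Matrix.fromBlocks_map, Matrix.fromBlocks_map, Matrix.fromBlocks_multiply,
    Matrix.fromBlocks_multiply]
  have hd : ∀ v : Fin r → ℂ, (Matrix.diagonal v).map (algebraMap ℂ R) =
      Matrix.diagonal fun i => algebraMap ℂ R (v i) := fun v => by
    rw [Matrix.diagonal_map (map_zero _)]
  have hl : ∀ (v : Fin r → ℂ) (M : Matrix (Fin r) (Fin r) R) (i j : Fin r),
      ((Matrix.diagonal v).map (algebraMap ℂ R) * M) i j = v i • M i j := fun v M i j => by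
    rw [hd, Matrix.diagonal_mul, Algebra.smul_def]
  have hr : ∀ (v : Fin r → ℂ) (M : Matrix (Fin r) (Fin r) R) (i j : Fin r),
      (M * (Matrix.diagonal v).map (algebraMap ℂ R)) i j = v j • M i j := fun v M i j => by
    rw [hd, Matrix.mul_diagonal, Algebra.smul_def, Algebra.commutes]
  have h0 : (0 : Matrix (Fin r) (Fin r) ℂ).map (algebraMap ℂ R) = 0 := by simp
  simp only [h0, Matrix.zero_mul, Matrix.mul_zero, zero_add, add_zero]
  congr 1
  · ext i j
    rw [hr, hl, Matrix.one_apply, smul_smul]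
    split_ifs with h
    · subst h; rw [hs, one_smul]
    · rw [smul_zero]
  · ext i j
    rw [hr, hl, Matrix.of_apply, Matrix.neg_apply, smul_neg, smul_neg, smul_smul, neg_smul]
    congr 2; ring
  · ext i j
    rw [hr, hl, Matrix.of_apply, smul_smul]
    congr 1; ring
  · ext i j
    rw [hr, hl, Matrix.sub_apply, Matrix.add_apply, Matrix.mul_apply, Matrix.mul_apply, smul_smul,
      smul_sub, sub_eq_add_neg, Finset.smul_sum, ← Finset.sum_neg_distrib]
    congr 1
    · rw [Matrix.smul_apply, Matrix.one_apply]
      split_ifs with h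
      · subst h
        rw [mul_mul_mul_comm, hε, hs, one_mul, one_smul]
      · simp
    · refine Finset.sum_congr rfl fun k _ => ?_
      rw [Matrix.of_apply, Matrix.of_apply, smul_mul_smul_comm, ← neg_smul]
      congr 1
      linear_combination (ε * ε * s i * s j) * hs k

/-- The data entering the linear Lax matrices of types C and D: the coefficients `α`, `β` and `α'`,
`β'` of the blocks of `L_{(+,…,+)}` and `L_{(-,…,-)}`. -/
structure SpinLax (r : ℕ) (κ : Type) [Fintype κ] [DecidableEq κ] where
  (ε k₀ : ℂ)
  (fst snd : κ → Fin r)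
  (α β α' β' : Fin r → Fin r → κ → ℂ)
  (scale : κ → ℂ)
  ε_mul : ε * ε = 1
  scale_ne : ∀ o, scale o ≠ 0
  α_scale : ∀ i j o, α i j o * scale o = α' i j o
  β_scale : ∀ i j o, β' i j o * scale o = β i j o
  sum_β_α : ∀ i o o', ∑ j, β i j o * α j i o' =
    if o = o' then (if fst o = i then 1 else 0) + (if snd o = i then 1 else 0) else 0
  sum_α_β : ∀ i o o', ∑ j, α i j o * β j i o' =
    if o = o' then (if fst o = i then 1 else 0) + (if snd o = i then 1 else 0) else 0
  sum_k₀ : ∀ i, ∑ o, ((if fst o = i then 1 else 0) + (if snd o = i then 1 else 0)) = k₀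
  dual_α : ∀ (s : Fin r → ℂ), (∀ i, s i = 1 ∨ s i = ε) → ∀ i j o,
    α' i j o * (s (fst o) * s (snd o)) = -(ε * s i * s j) * β i j o
  dual_β : ∀ (s : Fin r → ℂ), (∀ i, s i = 1 ∨ s i = ε) → ∀ i j o,
    β' i j o * (s (fst o) * s (snd o)) = -(ε * s i * s j) * α i j o

namespace SpinLax

variable [Fintype κ] [DecidableEq κ] (D : SpinLax r κ)

theorem linBlock_mul_diag {α β : Fin r → Fin r → κ → ℂ} {i : Fin r} {n : κ → ℂ}
    (h : ∀ o o', ∑ j, β i j o * α j i o' = if o = o' then n o else 0) (f g : κ → R) :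
    (linBlock β f * linBlock α g) i i = ∑ o, n o • (f o * g o) := by
  simp only [Matrix.mul_apply, linBlock, Matrix.of_apply, Finset.sum_mul, Finset.mul_sum,
    smul_mul_smul_comm]
  rw [Finset.sum_comm]
  refine Finset.sum_congr rfl fun o _ => ?_
  rw [Finset.sum_comm]
  simp only [← Finset.sum_smul, h, ite_smul, zero_smul, Finset.sum_ite_eq', Finset.mem_univ, if_true]

/-- The oscillators subject to the particle-hole transformation. -/
abbrev flip (μ : Fin r → ℤˣ) (o : κ) : Prop := μ (D.fst o) = -1

/-- The weight of the oscillator `o`. -/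
def weight (μ : Fin r → ℤˣ) (h : Fin r → ℂ) (o : κ) : ℂ :=
  -(h (D.fst o) + sgn μ (D.fst o) * sgn μ (D.snd o) * h (D.snd o))

/-- The eigenvalue of the twist on the vacuum is the exponential of this number. -/
def vacuum (μ : Fin r → ℤˣ) (t : ℂ) (h : Fin r → ℂ) : ℂ :=
  t * ∑ i, flipTwist μ h i +
    ∑ o, if D.flip μ o then flipTwist μ h (D.fst o) + flipTwist μ h (D.snd o) else 0

theorem cartan_eq (μ : Fin r → ℤˣ) (t : ℂ) (i : Fin r) :
    conjLax (weylMat D.ε μ) (laxLin (linBlock D.α (anPH (D.flip μ)))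
        (linBlock D.β (crPH (D.flip μ))) t (-t - D.k₀)) (Sum.inl i) (Sum.inl i) =
      sgn μ i • (t • 1 - ∑ o, ((if D.fst o = i then 1 else 0) + (if D.snd o = i then 1 else 0) : ℂ) •
        (crPH (D.flip μ) o * anPH (D.flip μ) o)) := by
  rw [conjLax_weylMat_diag D.ε_mul, sgn_eq]
  split_ifs
  · rw [laxLin, Matrix.fromBlocks_apply₂₂, Matrix.add_apply, Matrix.smul_apply, Matrix.one_apply_eq,
      linBlock_mul_diag (D.sum_α_β i)]
    simp only [anPH_mul_crPH, smul_add, Finset.sum_add_distrib, ← Finset.sum_smul, D.sum_k₀]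
    module
  · rw [laxLin, Matrix.fromBlocks_apply₁₁, Matrix.sub_apply, Matrix.smul_apply, Matrix.one_apply_eq,
      linBlock_mul_diag (D.sum_β_α i), one_smul]

theorem twist_eq (μ : Fin r → ℤˣ) (t : ℂ) (h : Fin r → ℂ) :
    ∑ i, h i • conjLax (weylMat D.ε μ) (laxLin (linBlock D.α (anPH (D.flip μ)))
        (linBlock D.β (crPH (D.flip μ))) t (-t - D.k₀)) (Sum.inl i) (Sum.inl i) =
      D.vacuum μ t h • 1 + ∑ o, D.weight μ h o • (cr o * an o) := by
  have h1 : ∀ o, ∑ i, flipTwist μ h i *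
      ((if D.fst o = i then 1 else 0) + (if D.snd o = i then 1 else 0)) =
      flipTwist μ h (D.fst o) + flipTwist μ h (D.snd o) := by
    intro o
    simp [mul_add, Finset.sum_add_distrib]
  have h2 : ∀ i x, h i * (sgn μ i * x) = flipTwist μ h i * x := fun i x => by
    rw [flipTwist]; ring
  simp only [cartan_eq, smul_smul, smul_sub, h2, Finset.sum_sub_distrib, Finset.smul_sum]
  rw [Finset.sum_comm]
  simp only [← Finset.sum_smul, h1, crPH_mul_anPH]
  rw [sub_eq_add_neg, ← Finset.sum_neg_distrib, vacuum, add_smul, add_assoc,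
    ← Finset.sum_mul, mul_comm, Finset.sum_smul (s := (Finset.univ : Finset κ)),
    ← Finset.sum_add_distrib]
  congr 1
  refine Finset.sum_congr rfl fun o _ => ?_
  have h3 : D.weight μ h o = -sgn μ (D.fst o) *
      (flipTwist μ h (D.fst o) + flipTwist μ h (D.snd o)) := by
    rw [weight, flipTwist, flipTwist]
    linear_combination h (D.fst o) * sgn_mul_self μ (D.fst o)
  rw [h3, sgn_eq]
  split_ifs
  · module
  · module

end SpinLax

end Spin

section Gen

open FreeAlgebra (ι)

variable {κ R : Type} [Ring R] [Algebra ℂ R]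

/-- The generators `a_i` of the free algebra. -/
def genA (i : κ) : FreeAlgebra ℂ (κ ⊕ κ) := ι ℂ (Sum.inl i)

/-- The generators `ā_i` of the free algebra. -/
def genC (i : κ) : FreeAlgebra ℂ (κ ⊕ κ) := ι ℂ (Sum.inr i)

@[simp] theorem lift_genA (f : κ ⊕ κ → R) (i : κ) :
    FreeAlgebra.lift ℂ f (genA i) = f (Sum.inl i) := by simp [genA]

@[simp] theorem lift_genC (f : κ ⊕ κ → R) (i : κ) :
    FreeAlgebra.lift ℂ f (genC i) = f (Sum.inr i) := by simp [genC]

@[simp] theorem fockRep_genA (i : κ) : fockRep κ (genA i) = an i := fockRep_inl i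

@[simp] theorem fockRep_genC (i : κ) : fockRep κ (genC i) = cr i := fockRep_inr i

theorem genA_mem (i : κ) : genA i ∈ linSpan (κ ⊕ κ) := ι_mem_linSpan _

theorem genC_mem (i : κ) : genC i ∈ linSpan (κ ⊕ κ) := ι_mem_linSpan _

variable [DecidableEq κ]

@[simp] theorem wick_genA_genA (z : κ → ℂ) (i j : κ) : wick (oscC z) (genA i * genA j) = 0 := by
  simp [genA, oscC]

@[simp] theorem wick_genC_genC (z : κ → ℂ) (i j : κ) : wick (oscC z) (genC i * genC j) = 0 := by
  simp [genC, oscC]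

@[simp] theorem wick_genA_genC (z : κ → ℂ) (i j : κ) :
    wick (oscC z) (genA i * genC j) = if i = j then (1 - z i)⁻¹ else 0 := by
  simp [genA, genC, oscC]

@[simp] theorem wick_genC_genA (z : κ → ℂ) (i j : κ) :
    wick (oscC z) (genC i * genA j) = if i = j then z i * (1 - z i)⁻¹ else 0 := by
  simp [genA, genC, oscC]

theorem wick_oscC_inv {z : κ → ℂ} (hz : ∀ o, z o ≠ 0) (hz1 : ∀ o, z o ≠ 1)
    {σ : κ → ℂ} (hσ : ∀ o, σ o * σ o = 1) (s t : κ ⊕ κ) :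
    wick (oscC fun o => (z o)⁻¹)
      (Sum.elim (fun o => (-σ o) • genC o) (fun o => σ o • genA o) s *
        Sum.elim (fun o => (-σ o) • genC o) (fun o => σ o • genA o) t) = oscC z s t := by
  have h3 : ∀ o, 1 - z o ≠ 0 := fun o => sub_ne_zero.2 (hz1 o).symm
  have h4 : ∀ o, 1 - (z o)⁻¹ ≠ 0 := fun o => sub_ne_zero.2 fun h => hz1 o (inv_eq_one.1 h.symm)
  have k1 : ∀ o, (1 - (z o)⁻¹)⁻¹ = -(z o * (1 - z o)⁻¹) := fun o => by
    have := hz o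
    have h6 : 1 - (z o)⁻¹ = -(1 - z o) / z o := by field_simp; ring
    rw [h6, inv_div, div_neg, div_eq_mul_inv]
  have k2 : ∀ o, (z o)⁻¹ * (1 - (z o)⁻¹)⁻¹ = -(1 - z o)⁻¹ := fun o => by
    rw [k1, mul_neg, inv_mul_cancel_left₀ (hz o)]
  rcases s with i | i <;> rcases t with j | j <;>
    simp only [Sum.elim_inl, Sum.elim_inr, smul_mul_smul_comm, map_smul, wick_genA_genA,
      wick_genC_genC, wick_genA_genC, wick_genC_genA, oscC, mul_zero, smul_eq_mul] <;>
    rcases eq_or_ne i j with rfl | hij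
  · rw [if_pos rfl, if_pos rfl, k2]
    linear_combination (1 - z i)⁻¹ * hσ i
  · simp [hij]
  · rw [if_pos rfl, if_pos rfl, k1]
    linear_combination (z i * (1 - z i)⁻¹) * hσ i
  · simp [hij]

end Gen

namespace SpinLax

variable {r : ℕ} {κ : Type} [Fintype κ] [DecidableEq κ] (D : SpinLax r κ)

/-- The Lax matrix `L_{(+,…,+)}` over the free algebra. -/
def plusLax (x : ℂ) : Matrix (Fin r ⊕ Fin r) (Fin r ⊕ Fin r) (FreeAlgebra ℂ (κ ⊕ κ)) :=
  laxPlus (linBlock D.α genA) (linBlock D.β genC) x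

/-- The Lax matrix `L_{(-,…,-)}` over the free algebra. -/
def minusLax (x : ℂ) : Matrix (Fin r ⊕ Fin r) (Fin r ⊕ Fin r) (FreeAlgebra ℂ (κ ⊕ κ)) :=
  laxMinus (linBlock D.α' genA) (linBlock D.β' genC) x

/-- The Lax matrix `𝓛_{u,v}` over the free algebra. -/
def linLax (u v : ℂ) : Matrix (Fin r ⊕ Fin r) (Fin r ⊕ Fin r) (FreeAlgebra ℂ (κ ⊕ κ)) :=
  laxLin (linBlock D.α genA) (linBlock D.β genC) u v

theorem wickMat_minusLax (z : κ → ℂ) (x : ℂ) (N : ℕ) :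
    wickMat (oscC z) (D.minusLax x) N =
      wickMat (oscC z) (laxMinus (linBlock D.α genA) (linBlock D.β genC) x) N := by
  have hs := D.scale_ne
  rw [← wickMat_map_lift (c₀ := oscC z) (c₁ := oscC z) (f := Sum.elim
    (fun o => D.scale o • genA o) fun o => (D.scale o)⁻¹ • genC o) ?_ ?_
    (laxMinus (linBlock D.α genA) (linBlock D.β genC) x), laxMinus_map, linBlock_map, linBlock_map,
    minusLax]
  · congr 2
    · ext i j
      simp [linBlock, smul_smul, D.α_scale]
    · ext i j
      have : ∀ o, D.β i j o * (D.scale o)⁻¹ = D.β' i j o := fun o => by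
        rw [← D.β_scale, mul_inv_cancel_right₀ (hs o)]
      simp [linBlock, smul_smul, this]
  · rintro (o | o)
    · exact Submodule.smul_mem _ _ (genA_mem o)
    · exact Submodule.smul_mem _ _ (genC_mem o)
  · rintro (i | i) (j | j) <;> simp [oscC] <;> rcases eq_or_ne i j with rfl | hij <;>
      simp_all

theorem wickMat_plusLax_mul_minusLax (z : κ → ℂ) (u v : ℂ) (N : ℕ) :
    wickMat (oscC z) (D.plusLax u) N * wickMat (oscC z) (D.minusLax v) N =
      wickMat (oscC z) (D.linLax u v) N := by
  rw [wickMat_minusLax]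
  exact wickMat_laxPlus_mul_laxMinus z D.α D.β u v N

theorem minusLax_map_eq {s : Fin r → ℂ} (hs : ∀ i, s i = 1 ∨ s i = D.ε) (x : ℂ) :
    (D.minusLax x).map (FreeAlgebra.lift ℂ (Sum.elim
        (fun o => (-(s (D.fst o) * s (D.snd o))) • genC o)
        fun o => (s (D.fst o) * s (D.snd o)) • genA o)) =
      conjLax (weylFlip D.ε s) (D.plusLax x) := by
  have hs2 : ∀ i, s i * s i = 1 := fun i => by
    rcases hs i with h | h <;> rw [h]
    · norm_num
    · exact D.ε_mul
  rw [plusLax, conjLax_weylFlip_laxPlus D.ε_mul hs2, minusLax, laxMinus_map, linBlock_map,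
    linBlock_map]
  congr 1
  · ext i j
    have : ∀ o, D.α' i j o * (-(s (D.fst o) * s (D.snd o))) = D.ε * s i * s j * D.β i j o :=
      fun o => by rw [mul_neg, D.dual_α s hs]; ring
    simp only [linBlock, Matrix.of_apply, lift_genA, Sum.elim_inl, smul_smul, this,
      Finset.smul_sum]
  · ext i j
    simp only [linBlock, Matrix.of_apply, lift_genC, Sum.elim_inr, smul_smul, D.dual_β s hs,
      Finset.smul_sum]

theorem conjQ_neg_plusLax {z : κ → ℂ} (hz : ∀ o, z o ≠ 0) (hz1 : ∀ o, z o ≠ 1) (μ : Fin r → ℤˣ)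
    (x : ℂ) (N : ℕ) :
    conjQ (weylMat D.ε (-μ)) N (wickMat (oscC fun o => (z o)⁻¹) (D.plusLax x) N) =
      conjQ (weylMat D.ε μ) N (wickMat (oscC z) (D.minusLax x) N) := by
  have key : ∀ s : Fin r → ℂ, (∀ i, s i = 1 ∨ s i = D.ε) →
      conjQ (weylFlip D.ε s) N (wickMat (oscC fun o => (z o)⁻¹) (D.plusLax x) N) =
        wickMat (oscC z) (D.minusLax x) N := by
    intro s hs
    have hs2 : ∀ i, s i * s i = 1 := fun i => by
      rcases hs i with h | h <;> rw [h]
      · norm_num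
      · exact D.ε_mul
    rw [← wickMat_conjLax _ (isUnit_weylFlip D.ε_mul hs2), ← D.minusLax_map_eq hs]
    refine wickMat_map_lift ?_ ?_ _ N
    · rintro (o | o)
      · exact Submodule.smul_mem _ _ (genC_mem o)
      · exact Submodule.smul_mem _ _ (genA_mem o)
    · exact wick_oscC_inv hz hz1 (σ := fun o => s (D.fst o) * s (D.snd o)) fun o => by
        rw [mul_mul_mul_comm, hs2, hs2, one_mul]
  rw [weylMat_neg D.ε_mul, ← conjQ_conjQ, key]
  intro i
  by_cases h : μ i = 1 <;> simp [h]

/-- The parameters `(τ_i τ_j)⁻¹` of the quasi-free functionals. -/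
def param (h : Fin r → ℂ) (o : κ) : ℂ := Complex.exp (-(h (D.fst o) + h (D.snd o)))

theorem param_ne_zero (h : Fin r → ℂ) (o : κ) : D.param h o ≠ 0 := Complex.exp_ne_zero _

theorem param_neg (h : Fin r → ℂ) (o : κ) : D.param (-h) o = (D.param h o)⁻¹ := by
  rw [param, param, ← Complex.exp_neg]
  congr 1
  simp only [Pi.neg_apply]
  ring

theorem map_plusLax (x : ℂ) :
    (D.plusLax x).map (fockRep κ) = laxPlus (linBlock D.α an) (linBlock D.β cr) x := by
  rw [plusLax, laxPlus_map, linBlock_map, linBlock_map]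
  simp only [fockRep_genA, fockRep_genC]

theorem map_minusLax (x : ℂ) :
    (D.minusLax x).map (fockRep κ) = laxMinus (linBlock D.α' an) (linBlock D.β' cr) x := by
  rw [minusLax, laxMinus_map, linBlock_map, linBlock_map]
  simp only [fockRep_genA, fockRep_genC]

/-- The twist of the `Q`-operators. -/
def twistQ (h : Fin r → ℂ) : FockOp κ :=
  expDiag (∑ o, (-(h (D.fst o) + h (D.snd o))) • (cr o * an o))

theorem isGeomDiag_twistQ (h : Fin r → ℂ) :
    IsGeomDiag (D.twistQ h) (Complex.exp 0) (D.param h) :=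
  isGeomDiag_expDiag (by rw [zero_smul, zero_add])

/-- The domain of convergence of the `Q`-operators. -/
def domQ : Set (Fin r → ℂ) := {h | ∀ o, 0 < (h (D.fst o) + h (D.snd o)).re}

/-- The domain of regularity of the `Q`-operators. -/
def regQ : Set (Fin r → ℂ) := {h | ∀ o, Complex.exp (h (D.fst o) + h (D.snd o)) ≠ 1}

theorem norm_param_lt {h : Fin r → ℂ} (hh : h ∈ D.domQ) (o : κ) : ‖D.param h o‖ < 1 := by
  rw [param, Complex.norm_exp, Real.exp_lt_one_iff, Complex.neg_re, neg_lt_zero]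
  exact hh o

theorem param_ne_one {h : Fin r → ℂ} (hh : h ∈ D.regQ) (o : κ) : D.param h o ≠ 1 := by
  rw [param, Complex.exp_neg, Ne, inv_eq_one]
  exact hh o

theorem isOpen_domQ : IsOpen D.domQ := by
  simp only [domQ, Set.ofPred_forall]
  refine isOpen_iInter_of_finite fun o => ?_
  exact isOpen_lt continuous_const (by fun_prop)

theorem nonempty_domQ : D.domQ.Nonempty := ⟨fun _ => 1, fun o => by norm_num⟩

theorem domQ_subset_regQ : D.domQ ⊆ D.regQ := by
  intro h hh o h1
  have h2 := hh o
  have h3 : ‖Complex.exp (h (D.fst o) + h (D.snd o))‖ = 1 := by rw [h1]; simp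
  rw [Complex.norm_exp, Real.exp_eq_one_iff] at h3
  exact h2.ne' h3

theorem isRegular_param (o : κ) : IsRegular D.regQ fun h => D.param h o := by
  have := (isRegular_exp_neg (V := D.regQ) (D.fst o)).mul (isRegular_exp_neg (D.snd o))
  simpa only [param, neg_add, Complex.exp_add] using this

theorem normTraceConverges_of_mem {h : Fin r → ℂ} (hh : h ∈ D.domQ) (x : ℂ) (N : ℕ) :
    NormTraceConverges (D.twistQ h) (laxPlus (linBlock D.α an) (linBlock D.β cr) x) N ∧
      NormTraceConverges (D.twistQ h) (laxMinus (linBlock D.α' an) (linBlock D.β' cr) x) N := by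
  rw [← map_plusLax, ← map_minusLax]
  exact ⟨(D.isGeomDiag_twistQ h).normTraceConverges (D.norm_param_lt hh) (Complex.exp_ne_zero _) _ _,
    (D.isGeomDiag_twistQ h).normTraceConverges (D.norm_param_lt hh) (Complex.exp_ne_zero _) _ _⟩

theorem ratCont_plus (x : ℂ) (N : ℕ) :
    let F := fun h => normTrace (D.twistQ h) (laxPlus (linBlock D.α an) (linBlock D.β cr) x) N
    IsRatCont D.domQ D.regQ F (ratCont D.domQ D.regQ F) ∧
      ∀ h ∈ D.regQ, ratCont D.domQ D.regQ F h = wickMat (oscC (D.param h)) (D.plusLax x) N := by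
  intro F
  refine ratCont_eq_wickMat D.isOpen_domQ D.nonempty_domQ D.domQ_subset_regQ D.isRegular_param
    (fun h hh => D.param_ne_one hh) N _ F fun h hh => ?_
  rw [← (D.isGeomDiag_twistQ h).normTrace (D.norm_param_lt hh) (Complex.exp_ne_zero _), map_plusLax]

theorem ratCont_minus (x : ℂ) (N : ℕ) :
    let F := fun h => normTrace (D.twistQ h) (laxMinus (linBlock D.α' an) (linBlock D.β' cr) x) N
    IsRatCont D.domQ D.regQ F (ratCont D.domQ D.regQ F) ∧
      ∀ h ∈ D.regQ, ratCont D.domQ D.regQ F h = wickMat (oscC (D.param h)) (D.minusLax x) N := by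
  intro F
  refine ratCont_eq_wickMat D.isOpen_domQ D.nonempty_domQ D.domQ_subset_regQ D.isRegular_param
    (fun h hh => D.param_ne_one hh) N _ F fun h hh => ?_
  rw [← (D.isGeomDiag_twistQ h).normTrace (D.norm_param_lt hh) (Complex.exp_ne_zero _),
    map_minusLax]

/-- The twist of the transfer matrices. -/
def twist (μ : Fin r → ℤˣ) (t : ℂ) (h : Fin r → ℂ) : FockOp κ :=
  expDiag (∑ i, h i • conjLax (weylMat D.ε μ) (laxLin (linBlock D.α (anPH (D.flip μ)))
    (linBlock D.β (crPH (D.flip μ))) t (-t - D.k₀)) (Sum.inl i) (Sum.inl i))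

/-- The domain of convergence of the transfer matrices. -/
def dom (μ : Fin r → ℤˣ) : Set (Fin r → ℂ) := {h | ∀ o, (D.weight μ h o).re < 0}

theorem isGeomDiag_twist (μ : Fin r → ℤˣ) (t : ℂ) (h : Fin r → ℂ) :
    IsGeomDiag (D.twist μ t h) (Complex.exp (D.vacuum μ t h))
      fun o => Complex.exp (D.weight μ h o) :=
  isGeomDiag_expDiag (D.twist_eq μ t h)

theorem norm_exp_weight_lt {μ : Fin r → ℤˣ} {h : Fin r → ℂ} (hh : h ∈ D.dom μ) (o : κ) :
    ‖Complex.exp (D.weight μ h o)‖ < 1 := by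
  rw [Complex.norm_exp, Real.exp_lt_one_iff]
  exact hh o

theorem weight_eq (μ : Fin r → ℤˣ) (h : Fin r → ℂ) (o : κ) :
    -(flipTwist μ h (D.fst o) + flipTwist μ h (D.snd o)) =
      if D.flip μ o then -D.weight μ h o else D.weight μ h o := by
  have h3 : -(flipTwist μ h (D.fst o) + flipTwist μ h (D.snd o)) =
      sgn μ (D.fst o) * D.weight μ h o := by
    rw [weight, flipTwist, flipTwist]
    linear_combination sgn μ (D.snd o) * h (D.snd o) * sgn_mul_self μ (D.fst o)
  rw [h3, sgn_eq]
  split_ifs <;> ring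

theorem param_flipTwist (μ : Fin r → ℤˣ) (h : Fin r → ℂ) (o : κ) :
    D.param (flipTwist μ h) o = if D.flip μ o then (Complex.exp (D.weight μ h o))⁻¹
      else Complex.exp (D.weight μ h o) := by
  rw [param, weight_eq]
  split_ifs
  · rw [Complex.exp_neg]
  · rfl

theorem exp_weight_ne_one {μ : Fin r → ℤˣ} {h : Fin r → ℂ} (hh : h ∈ D.dom μ) (o : κ) :
    Complex.exp (D.weight μ h o) ≠ 1 := by
  intro h1
  have := D.norm_exp_weight_lt hh o
  rw [h1] at this
  simp at this

theorem flipTwist_mem {μ : Fin r → ℤˣ} {h : Fin r → ℂ} (hh : h ∈ D.dom μ) :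
    flipTwist μ h ∈ D.regQ := by
  intro o h1
  have h2 : D.param (flipTwist μ h) o = 1 := by rw [param, Complex.exp_neg, h1, inv_one]
  rw [param_flipTwist] at h2
  have := D.exp_weight_ne_one hh o
  split_ifs at h2
  · exact this (inv_eq_one.1 h2)
  · exact this h2

theorem neg_mem_regQ {h : Fin r → ℂ} (hh : h ∈ D.regQ) : -h ∈ D.regQ := by
  intro o h1
  refine hh o ?_
  rw [Pi.neg_apply, Pi.neg_apply, ← neg_add, Complex.exp_neg, inv_eq_one] at h1
  exact h1

theorem map_linLax (s : κ → Prop) [DecidablePred s] (B : Matrix (Fin r ⊕ Fin r) (Fin r ⊕ Fin r) ℂ)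
    (u v : ℂ) :
    (conjLax B ((D.linLax u v).map (FreeAlgebra.lift ℂ (flipGen s 1)))).map (fockRep κ) =
      conjLax B (laxLin (linBlock D.α (anPH s)) (linBlock D.β (crPH s)) u v) := by
  rw [conjLax_map, Matrix.map_map, ← AlgHom.coe_comp, fockRep_comp_flipGen_one, linLax, laxLin_map,
    linBlock_map, linBlock_map]
  simp only [lift_genA, lift_genC, Sum.elim_inl, Sum.elim_inr]

theorem traceConverges_of_mem {μ : Fin r → ℤˣ} {h : Fin r → ℂ} (hh : h ∈ D.dom μ) (t u v : ℂ)
    (N : ℕ) :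
    TraceConverges (D.twist μ t h) (conjLax (weylMat D.ε μ)
      (laxLin (linBlock D.α (anPH (D.flip μ))) (linBlock D.β (crPH (D.flip μ))) u v)) N := by
  rw [← map_linLax]
  exact (D.isGeomDiag_twist μ t h).traceConverges (D.norm_exp_weight_lt hh) _ _

theorem trace_twist {μ : Fin r → ℤˣ} {h : Fin r → ℂ} (hh : h ∈ D.dom μ) (t : ℂ) :
    fockTrace (D.twist μ t h) =
      Complex.exp (D.vacuum μ t h) / ∏ o, (1 - Complex.exp (D.weight μ h o)) := by
  rw [(D.isGeomDiag_twist μ t h).trace (D.norm_exp_weight_lt hh), Finset.prod_inv_distrib,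
    div_eq_mul_inv]

theorem twistedTrace_twist {μ : Fin r → ℤˣ} {h : Fin r → ℂ} (hh : h ∈ D.dom μ) (t u v : ℂ) (N : ℕ) :
    twistedTrace (D.twist μ t h) (conjLax (weylMat D.ε μ)
      (laxLin (linBlock D.α (anPH (D.flip μ))) (linBlock D.β (crPH (D.flip μ))) u v)) N =
    fockTrace (D.twist μ t h) •
      (conjQ (weylMat D.ε μ) N (wickMat (oscC (D.param (flipTwist μ h))) (D.plusLax u) N) *
        conjQ (weylMat D.ε μ) N (wickMat (oscC (D.param (flipTwist μ h))) (D.minusLax v) N)) := by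
  have hB := isUnit_weylMat D.ε_mul μ
  rw [← map_linLax, (D.isGeomDiag_twist μ t h).twistedTrace (D.norm_exp_weight_lt hh),
    wickMat_conjLax _ hB, wickMat_flipGen _ (by norm_num) (fun _ => Complex.exp_ne_zero _)
      (D.exp_weight_ne_one hh), ← conjQ_mul hB, wickMat_plusLax_mul_minusLax]
  simp only [← param_flipTwist]

theorem conjQ_neg_ratCont {μ : Fin r → ℤˣ} {h : Fin r → ℂ} (hh : h ∈ D.dom μ) (x : ℂ) (N : ℕ) :
    conjQ (weylMat D.ε (-μ)) N
        (wickMat (oscC (D.param (flipTwist (-μ) h))) (D.plusLax x) N) =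
      conjQ (weylMat D.ε μ) N (wickMat (oscC (D.param (flipTwist μ h))) (D.minusLax x) N) := by
  have h1 : flipTwist (-μ) h = -flipTwist μ h := by
    ext i
    simp [flipTwist, sgn]
  have h2 : D.param (flipTwist (-μ) h) = fun o => (D.param (flipTwist μ h) o)⁻¹ := by
    ext o
    rw [h1, param_neg]
  rw [h2, D.conjQ_neg_plusLax (D.param_ne_zero _) (D.param_ne_one (D.flipTwist_mem hh))]

end SpinLax

/-! ## Type C -/

section TypeC

variable {r : ℕ}

theorem sum_oscC {M : Type} [AddCommMonoid M] (F : Fin r → Fin r → M) :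
    ∑ o : OscC r, F o.1.1 o.1.2 = ∑ a, ∑ b, if a ≤ b then F a b else 0 := by
  rw [← Fintype.sum_prod_type' (f := fun a b => if a ≤ b then F a b else 0),
    ← Finset.sum_filter, ← Finset.sum_subtype_eq_sum_filter, Finset.subtype_univ]

theorem sum_oscD {M : Type} [AddCommMonoid M] (F : Fin r → Fin r → M) :
    ∑ o : OscD r, F o.1.1 o.1.2 = ∑ a, ∑ b, if a < b then F a b else 0 := by
  rw [← Fintype.sum_prod_type' (f := fun a b => if a < b then F a b else 0),
    ← Finset.sum_filter, ← Finset.sum_subtype_eq_sum_filter, Finset.subtype_univ]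

theorem sum_ite_le (i : Fin r) : ∑ b, (if i ≤ b then 1 else 0 : ℂ) = r - (i : ℕ) := by
  rw [← Finset.sum_filter, Finset.sum_const, nsmul_eq_mul, mul_one, Finset.filter_le_eq_Ici,
    Fin.card_Ici, Nat.cast_sub i.2.le]

theorem sum_ite_ge (i : Fin r) : ∑ b, (if b ≤ i then 1 else 0 : ℂ) = (i : ℕ) + 1 := by
  rw [← Finset.sum_filter, Finset.sum_const, nsmul_eq_mul, mul_one, Finset.filter_ge_eq_Iic,
    Fin.card_Iic, Nat.cast_succ]

theorem sum_ite_lt (i : Fin r) : ∑ b, (if i < b then 1 else 0 : ℂ) = r - (i : ℕ) - 1 := by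
  rw [← Finset.sum_filter, Finset.sum_const, nsmul_eq_mul, mul_one, Finset.filter_lt_eq_Ioi,
    Fin.card_Ioi, Nat.sub_right_comm, Nat.cast_sub (by omega), Nat.cast_sub i.2.le, Nat.cast_one]

theorem sum_ite_gt (i : Fin r) : ∑ b, (if b < i then 1 else 0 : ℂ) = (i : ℕ) := by
  rw [← Finset.sum_filter, Finset.sum_const, nsmul_eq_mul, mul_one, Finset.filter_gt_eq_Iio,
    Fin.card_Iio]

theorem sum_ite_le_neg (μ : Fin r → ℤˣ) (i : Fin r) :
    ∑ a, (if a ≤ i then neg μ a else 0) = ∑ k ∈ Finset.Iic i, neg μ k := by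
  rw [← Finset.sum_filter, Finset.filter_ge_eq_Iic]

theorem sum_ite_lt_neg (μ : Fin r → ℤˣ) (i : Fin r) :
    ∑ a, (if a < i then neg μ a else 0) = ∑ k ∈ Finset.Iic i, neg μ k - neg μ i := by
  have h : ∀ a, (if a < i then neg μ a else 0) =
      (if a ≤ i then neg μ a else 0) - if a = i then neg μ i else 0 := by
    intro a
    rcases lt_trichotomy a i with h | rfl | h
    · rw [if_pos h, if_pos h.le, if_neg h.ne, sub_zero]
    · simp
    · rw [if_neg h.not_gt, if_neg h.not_ge, if_neg h.ne', sub_zero]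
  simp [h, ← sum_ite_le_neg]

/-- The coefficients of the block `symMat c f`. -/
def symCoef (c : ℂ) (i j : Fin r) (o : OscC r) : ℂ :=
  if o.1 = (min i j, max i j) then (if i = j then c else 1) else 0

theorem symMat_eq {R : Type} [Ring R] [Algebra ℂ R] (c : ℂ) (f : OscC r → R) :
    symMat c f = linBlock (symCoef c) f := by
  ext i j
  rw [symMat, linBlock, Matrix.of_apply, Matrix.of_apply,
    Finset.sum_eq_single ⟨(min i j, max i j), min_le_max⟩]
  · simp [symCoef]
  · intro o _ ho
    rw [symCoef, if_neg fun h => ho (Subtype.ext h), zero_smul]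
  · simp

theorem sum_symCoef {c d : ℂ} (hcd : c * d = 2) (i : Fin r) (o o' : OscC r) :
    ∑ j, symCoef c i j o * symCoef d j i o' =
      if o = o' then (if o.1.1 = i then 1 else 0) + (if o.1.2 = i then 1 else 0) else 0 := by
  rcases eq_or_ne o o' with rfl | ho
  · rw [if_pos rfl]
    have key : ∀ j, symCoef c i j o * symCoef d j i o =
        (if o.1.2 = j then (if o.1.1 = i then 1 else 0) else 0) +
          (if o.1.1 = j then (if o.1.2 = i then 1 else 0) else 0) := by
      obtain ⟨⟨a, b⟩, hab⟩ := o
      intro j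
      change a ≤ b at hab
      simp only [symCoef, Prod.mk.injEq, min_def, max_def]
      rcases eq_or_ne i j with rfl | hij
      · simp only [le_refl, if_true]
        by_cases h1 : a = i <;> by_cases h2 : b = i <;> simp [h1, h2, hcd]
        norm_num
      · simp only [hij, hij.symm, if_false]
        split_ifs <;> first | norm_num; done | (exfalso; omega)
    simp [key, Finset.sum_add_distrib]
  · rw [if_neg ho]
    refine Finset.sum_eq_zero fun j _ => ?_
    simp only [symCoef, min_comm j i, max_comm j i]
    by_cases h1 : o.1 = (min i j, max i j)
    · rw [if_neg (c := o'.1 = _) fun h2 => ho (Subtype.ext (h1.trans h2.symm)), mul_zero]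
    · rw [if_neg h1, zero_mul]

/-- The data of type C. -/
def spinC (r : ℕ) : SpinLax r (OscC r) where
  ε := -1
  k₀ := r + 1
  fst o := o.1.1
  snd o := o.1.2
  α := symCoef 1
  β := symCoef 2
  α' := symCoef 2
  β' := symCoef 1
  scale o := if o.1.1 = o.1.2 then 2 else 1
  ε_mul := by norm_num
  scale_ne o := by split_ifs <;> norm_num
  α_scale i j o := by
    rcases eq_or_ne i j with rfl | h
    · by_cases h1 : o.1 = (i, i) <;> simp [symCoef, h1]
    · by_cases h1 : o.1 = (min i j, max i j) <;> simp [symCoef, h1, h]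
  β_scale i j o := by
    rcases eq_or_ne i j with rfl | h
    · by_cases h1 : o.1 = (i, i) <;> simp [symCoef, h1]
    · by_cases h1 : o.1 = (min i j, max i j) <;> simp [symCoef, h1, h]
  sum_β_α := sum_symCoef (by norm_num)
  sum_α_β := sum_symCoef (by norm_num)
  sum_k₀ i := by
    rw [sum_oscC fun a b => ((if a = i then 1 else 0) + (if b = i then 1 else 0) : ℂ)]
    have h : ∀ a b : Fin r, (if a ≤ b then (if a = i then 1 else 0) + (if b = i then 1 else 0)
        else 0 : ℂ) = (if a = i then (if i ≤ b then 1 else 0) else 0) +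
          (if b = i then (if a ≤ i then 1 else 0) else 0) := by
      intro a b
      by_cases h1 : a = i <;> by_cases h2 : b = i <;> simp [h1, h2]
    simp only [h, Finset.sum_add_distrib, Finset.sum_ite_eq', Finset.mem_univ, if_true]
    rw [Finset.sum_comm]
    simp only [Finset.sum_ite_eq', Finset.mem_univ, if_true, sum_ite_le, sum_ite_ge]
    ring
  dual_α s _ i j o := by
    by_cases h1 : o.1 = (min i j, max i j)
    · rcases le_total i j with h | h <;>
        simp only [symCoef, h1, h, min_eq_left, min_eq_right, max_eq_left, max_eq_right, if_true] <;>
        split_ifs <;> ring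
    · simp [symCoef, h1]
  dual_β s _ i j o := by
    by_cases h1 : o.1 = (min i j, max i j)
    · rcases le_total i j with h | h <;>
        simp only [symCoef, h1, h, min_eq_left, min_eq_right, max_eq_left, max_eq_right, if_true] <;>
        split_ifs <;> ring
    · simp [symCoef, h1]

theorem vacuum_spinC (μ : Fin r → ℤˣ) (t : ℂ) (h : Fin r → ℂ) :
    (spinC r).vacuum μ t h = ∑ i : Fin r, sgn μ i * (t + ((r : ℂ) - (i : ℕ)) * neg μ i
            + ∑ k ∈ Finset.Iic i, neg μ k) * h i := by
  have h1 : ∀ o : OscC r, (if (spinC r).flip μ o then flipTwist μ h ((spinC r).fst o) +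
      flipTwist μ h ((spinC r).snd o) else 0) =
      neg μ o.1.1 * flipTwist μ h o.1.1 + neg μ o.1.1 * flipTwist μ h o.1.2 := by
    intro o
    rw [neg]
    by_cases h2 : μ o.1.1 = -1
    · rw [if_pos (show (spinC r).flip μ o from h2), if_pos h2, one_mul, one_mul]; rfl
    · rw [if_neg (show ¬(spinC r).flip μ o from h2), if_neg h2]; ring
  rw [SpinLax.vacuum, Finset.sum_congr rfl fun o _ => h1 o, Finset.sum_add_distrib,
    sum_oscC fun a b => neg μ a * flipTwist μ h a, sum_oscC fun a b => neg μ a * flipTwist μ h b]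
  have h2 : ∀ a b : Fin r, (if a ≤ b then neg μ a * flipTwist μ h a else 0) =
      (if a ≤ b then 1 else 0) * (neg μ a * flipTwist μ h a) := by
    intro a b; split_ifs <;> ring
  have h3 : ∀ a b : Fin r, (if a ≤ b then neg μ a * flipTwist μ h b else 0) =
      (if a ≤ b then neg μ a else 0) * flipTwist μ h b := by
    intro a b; split_ifs <;> ring
  simp only [h2, ← Finset.sum_mul, sum_ite_le]
  rw [Finset.sum_comm]
  simp only [h3, ← Finset.sum_mul, sum_ite_le_neg]
  rw [Finset.mul_sum, ← Finset.sum_add_distrib, ← Finset.sum_add_distrib]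
  refine Finset.sum_congr rfl fun i _ => ?_
  rw [flipTwist]
  ring

theorem laxC_eq (μ : Fin r → ℤˣ) (t x : ℂ) :
    laxC μ t x = conjLax (weylMat (spinC r).ε μ)
      (laxLin (linBlock (spinC r).α (anPH ((spinC r).flip μ)))
        (linBlock (spinC r).β (crPH ((spinC r).flip μ))) (x + t) (x - t - r - 1)) := by
  rw [laxC, symMat_eq, symMat_eq]
  rfl

theorem twistC_eq (μ : Fin r → ℤˣ) (t : ℂ) (h : Fin r → ℂ) :
    twistC μ t h = (spinC r).twist μ t h := by
  have h1 : (0 : ℂ) - t - r - 1 = -t - (spinC r).k₀ := by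
    change _ = -t - ((r : ℂ) + 1)
    ring
  rw [twistC, SpinLax.twist]
  simp only [laxC_eq, zero_add, h1]

theorem laxPlusC_eq (x : ℂ) :
    laxPlusC r x = laxPlus (linBlock (spinC r).α an) (linBlock (spinC r).β cr) x := by
  rw [laxPlusC, symMat_eq, symMat_eq]
  rfl

theorem laxMinusC_eq (x : ℂ) :
    laxMinusC r x = laxMinus (linBlock (spinC r).α' an) (linBlock (spinC r).β' cr) x := by
  rw [laxMinusC, symMat_eq, symMat_eq]
  rfl

theorem domQC_eq : domQC r = (spinC r).domQ :=
  Set.ext fun _ => ⟨fun H o => H _ _ o.2, fun H i j hij => H ⟨(i, j), hij⟩⟩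

theorem regQC_eq : regQC r = (spinC r).regQ :=
  Set.ext fun _ => ⟨fun H o => H _ _ o.2, fun H i j hij => H ⟨(i, j), hij⟩⟩

theorem mem_dom_of_mem_domC {μ : Fin r → ℤˣ} {h : Fin r → ℂ} (hh : h ∈ domC μ) :
    h ∈ (spinC r).dom μ := fun o => by
  rw [SpinLax.weight, Complex.neg_re, neg_lt_zero]
  exact hh _ _ o.2

theorem QplusC_eq (N : ℕ) (x : ℂ) : QplusC r N x = ratCont (spinC r).domQ (spinC r).regQ fun h =>
    normTrace ((spinC r).twistQ h)
      (laxPlus (linBlock (spinC r).α an) (linBlock (spinC r).β cr) x) N := by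
  rw [QplusC, domQC_eq, regQC_eq, laxPlusC_eq]
  rfl

theorem QminusC_eq (N : ℕ) (x : ℂ) : QminusC r N x = ratCont (spinC r).domQ (spinC r).regQ fun h =>
    normTrace ((spinC r).twistQ h)
      (laxMinus (linBlock (spinC r).α' an) (linBlock (spinC r).β' cr) x) N := by
  rw [QminusC, domQC_eq, regQC_eq, laxMinusC_eq]
  rfl

theorem typeC (r N : ℕ) :
      (∀ (x : ℂ),
        (∀ h ∈ domQC r, NormTraceConverges (twistQC h) (laxPlusC r x) N ∧
          NormTraceConverges (twistQC h) (laxMinusC r x) N) ∧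
        IsRatCont (domQC r) (regQC r) (fun h => normTrace (twistQC h) (laxPlusC r x) N)
          (QplusC r N x) ∧
        IsRatCont (domQC r) (regQC r) (fun h => normTrace (twistQC h) (laxMinusC r x) N)
          (QminusC r N x)) ∧
      ∀ (μ : Fin r → ℤˣ) (t x : ℂ), ∀ h ∈ domC μ,
        TraceConverges (twistC μ t h) (laxC μ t x) N ∧
        chC μ t h =
          Complex.exp (∑ i : Fin r, sgn μ i * (t + ((r : ℂ) - (i : ℕ)) * neg μ i
            + ∑ k ∈ Finset.Iic i, neg μ k) * h i) /
          ∏ p : OscC r, (1 - Complex.exp (-(h p.1.1 + sgn μ p.1.1 * sgn μ p.1.2 * h p.1.2))) ∧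
        QC (-μ) N x h = conjQ (weylMat (-1) μ) N (QminusC r N x (flipTwist μ h)) ∧
        TC μ N t x h = chC μ t h • (QC μ N (x + t) h * QC (-μ) N (x - t - r - 1) h) := by
  have hplus := fun x => (spinC r).ratCont_plus x N
  have hminus := fun x => (spinC r).ratCont_minus x N
  refine ⟨fun x => ⟨fun h hh => ?_, ?_, ?_⟩, fun μ t x h hh => ?_⟩
  · rw [laxPlusC_eq, laxMinusC_eq]
    exact (spinC r).normTraceConverges_of_mem (domQC_eq ▸ hh) x N
  · rw [QplusC_eq, domQC_eq, regQC_eq, laxPlusC_eq]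
    exact (hplus x).1
  · rw [QminusC_eq, domQC_eq, regQC_eq, laxMinusC_eq]
    exact (hminus x).1
  · have hd := mem_dom_of_mem_domC hh
    have hr := (spinC r).flipTwist_mem hd
    have hr' : flipTwist (-μ) h ∈ (spinC r).regQ := by
      have h1 : flipTwist (-μ) h = -flipTwist μ h := by
        ext i
        simp [flipTwist, sgn]
      rw [h1]
      exact (spinC r).neg_mem_regQ hr
    have hQ : ∀ x, QC (-μ) N x h = conjQ (weylMat (-1) μ) N (QminusC r N x (flipTwist μ h)) := by
      intro x
      rw [QC, QplusC_eq, QminusC_eq, (hplus x).2 _ hr', (hminus x).2 _ hr]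
      exact (spinC r).conjQ_neg_ratCont hd x N
    refine ⟨?_, ?_, hQ x, ?_⟩
    · rw [twistC_eq, laxC_eq]
      exact (spinC r).traceConverges_of_mem hd _ _ _ N
    · rw [chC, twistC_eq, (spinC r).trace_twist hd, vacuum_spinC]
      rfl
    · rw [hQ, TC, chC, twistC_eq, laxC_eq, (spinC r).twistedTrace_twist hd, QC, QplusC_eq,
        QminusC_eq, (hplus _).2 _ hr, (hminus _).2 _ hr]
      rfl

end TypeC

/-! ## Type D, spinorial nodes -/

section TypeD

variable {r : ℕ}

/-- The coefficients of the block `altMat f`. -/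
def altCoef (i j : Fin r) (o : OscD r) : ℂ :=
  (if o.1.1 = i ∧ o.1.2 = j then 1 else 0) - (if o.1.2 = i ∧ o.1.1 = j then 1 else 0)

theorem altCoef_swap (i j : Fin r) (o : OscD r) : altCoef j i o = -altCoef i j o := by
  simp only [altCoef, and_comm (b := _ = i), neg_sub]

theorem altMat_eq {R : Type} [Ring R] [Algebra ℂ R] (f : OscD r → R) :
    altMat f = linBlock altCoef f := by
  ext i j
  rw [altMat, linBlock, Matrix.of_apply, Matrix.of_apply]
  rcases lt_trichotomy i j with h | rfl | h
  · rw [dif_pos h, Finset.sum_eq_single ⟨(i, j), h⟩]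
    · simp [altCoef, h.ne']
    · rintro ⟨⟨a, b⟩, hab⟩ _ ho
      rw [altCoef, if_neg, if_neg, sub_zero, zero_smul]
      · rintro ⟨rfl, rfl⟩; exact lt_asymm h hab
      · rintro ⟨rfl, rfl⟩; exact ho rfl
    · simp
  · rw [dif_neg (lt_irrefl _), dif_neg (lt_irrefl _)]
    refine (Finset.sum_eq_zero fun o _ => ?_).symm
    rw [altCoef]
    simp only [and_comm, sub_self, zero_smul]
  · rw [dif_neg h.not_gt, dif_pos h, Finset.sum_eq_single ⟨(j, i), h⟩]
    · simp [altCoef, h.ne']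
    · rintro ⟨⟨a, b⟩, hab⟩ _ ho
      rw [altCoef, if_neg, if_neg, sub_zero, zero_smul]
      · rintro ⟨rfl, rfl⟩; exact ho rfl
      · rintro ⟨rfl, rfl⟩; exact lt_asymm h hab
    · simp

theorem altMat_transpose {R : Type} [Ring R] [Algebra ℂ R] (f : OscD r → R) :
    (altMat f).transpose = linBlock (fun j i => altCoef i j) f := by
  rw [altMat_eq]
  rfl

theorem sum_altCoef (i : Fin r) (o o' : OscD r) :
    ∑ j, altCoef i j o * altCoef i j o' =
      if o = o' then (if o.1.1 = i then 1 else 0) + (if o.1.2 = i then 1 else 0) else 0 := by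
  have key : ∀ j, altCoef i j o * altCoef i j o' = if o = o' then
      (if o.1.2 = j then (if o.1.1 = i then 1 else 0) else 0) +
        (if o.1.1 = j then (if o.1.2 = i then 1 else 0) else 0) else 0 := by
    obtain ⟨⟨a, b⟩, hab⟩ := o
    obtain ⟨⟨c, d⟩, hcd⟩ := o'
    intro j
    change a < b at hab
    change c < d at hcd
    simp only [altCoef, Subtype.mk.injEq, Prod.mk.injEq]
    split_ifs <;> first | norm_num; done | (exfalso; omega)
  simp only [key]
  split_ifs <;> simp [Finset.sum_add_distrib, *]

/-- The data of type D. -/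
def spinD (r : ℕ) : SpinLax r (OscD r) where
  ε := 1
  k₀ := r - 1
  fst o := o.1.1
  snd o := o.1.2
  α j i := altCoef i j
  β := altCoef
  α' j i := altCoef i j
  β' := altCoef
  scale _ := 1
  ε_mul := one_mul 1
  scale_ne _ := one_ne_zero
  α_scale _ _ _ := mul_one _
  β_scale _ _ _ := mul_one _
  sum_β_α := sum_altCoef
  sum_α_β i o o' := by
    simp only [altCoef_swap i _, neg_mul_neg]
    exact sum_altCoef i o o'
  sum_k₀ i := by
    rw [sum_oscD fun a b => ((if a = i then 1 else 0) + (if b = i then 1 else 0) : ℂ)]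
    have h : ∀ a b : Fin r, (if a < b then (if a = i then 1 else 0) + (if b = i then 1 else 0)
        else 0 : ℂ) = (if a = i then (if i < b then 1 else 0) else 0) +
          (if b = i then (if a < i then 1 else 0) else 0) := by
      intro a b
      by_cases h1 : a = i <;> by_cases h2 : b = i <;> simp [h1, h2]
    simp only [h, Finset.sum_add_distrib, Finset.sum_ite_eq', Finset.mem_univ, if_true]
    rw [Finset.sum_comm]
    simp only [Finset.sum_ite_eq', Finset.mem_univ, if_true, sum_ite_lt, sum_ite_gt]
    ring
  dual_α s hs i j o := by
    have h : ∀ i, s i = 1 := fun i => (hs i).elim id id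
    rw [h, h, h, h, altCoef_swap i j]
    ring
  dual_β s hs i j o := by
    have h : ∀ i, s i = 1 := fun i => (hs i).elim id id
    rw [h, h, h, h, altCoef_swap i j]
    ring

theorem vacuum_spinD (μ : Fin r → ℤˣ) (t : ℂ) (h : Fin r → ℂ) :
    (spinD r).vacuum μ t h = ∑ i : Fin r, sgn μ i * (t + ((r : ℂ) - (i : ℕ) - 2) * neg μ i
            + ∑ k ∈ Finset.Iic i, neg μ k) * h i := by
  have h1 : ∀ o : OscD r, (if (spinD r).flip μ o then flipTwist μ h ((spinD r).fst o) +
      flipTwist μ h ((spinD r).snd o) else 0) =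
      neg μ o.1.1 * flipTwist μ h o.1.1 + neg μ o.1.1 * flipTwist μ h o.1.2 := by
    intro o
    rw [neg]
    by_cases h2 : μ o.1.1 = -1
    · rw [if_pos (show (spinD r).flip μ o from h2), if_pos h2, one_mul, one_mul]; rfl
    · rw [if_neg (show ¬(spinD r).flip μ o from h2), if_neg h2]; ring
  rw [SpinLax.vacuum, Finset.sum_congr rfl fun o _ => h1 o, Finset.sum_add_distrib,
    sum_oscD fun a b => neg μ a * flipTwist μ h a, sum_oscD fun a b => neg μ a * flipTwist μ h b]
  have h2 : ∀ a b : Fin r, (if a < b then neg μ a * flipTwist μ h a else 0) =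
      (if a < b then 1 else 0) * (neg μ a * flipTwist μ h a) := by
    intro a b; split_ifs <;> ring
  have h3 : ∀ a b : Fin r, (if a < b then neg μ a * flipTwist μ h b else 0) =
      (if a < b then neg μ a else 0) * flipTwist μ h b := by
    intro a b; split_ifs <;> ring
  simp only [h2, ← Finset.sum_mul, sum_ite_lt]
  rw [Finset.sum_comm]
  simp only [h3, ← Finset.sum_mul, sum_ite_lt_neg]
  rw [Finset.mul_sum, ← Finset.sum_add_distrib, ← Finset.sum_add_distrib]
  refine Finset.sum_congr rfl fun i _ => ?_
  rw [flipTwist]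
  ring

theorem laxD_eq (μ : Fin r → ℤˣ) (t x : ℂ) :
    laxD μ t x = conjLax (weylMat (spinD r).ε μ)
      (laxLin (linBlock (spinD r).α (anPH ((spinD r).flip μ)))
        (linBlock (spinD r).β (crPH ((spinD r).flip μ))) (x + t) (x - t - r + 1)) := by
  rw [laxD, altMat_transpose, altMat_eq]
  rfl

theorem twistD_eq (μ : Fin r → ℤˣ) (t : ℂ) (h : Fin r → ℂ) :
    twistD μ t h = (spinD r).twist μ t h := by
  have h1 : (0 : ℂ) - t - r + 1 = -t - (spinD r).k₀ := by
    change _ = -t - ((r : ℂ) - 1)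
    ring
  rw [twistD, SpinLax.twist]
  simp only [laxD_eq, zero_add, h1]

theorem laxPlusD_eq (x : ℂ) :
    laxPlusD r x = laxPlus (linBlock (spinD r).α an) (linBlock (spinD r).β cr) x := by
  rw [laxPlusD, altMat_transpose, altMat_eq]
  rfl

theorem laxMinusD_eq (x : ℂ) :
    laxMinusD r x = laxMinus (linBlock (spinD r).α' an) (linBlock (spinD r).β' cr) x := by
  rw [laxMinusD, altMat_transpose, altMat_eq]
  rfl

theorem domQD_eq : domQD r = (spinD r).domQ :=
  Set.ext fun _ => ⟨fun H o => H _ _ o.2, fun H i j hij => H ⟨(i, j), hij⟩⟩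

theorem regQD_eq : regQD r = (spinD r).regQ :=
  Set.ext fun _ => ⟨fun H o => H _ _ o.2, fun H i j hij => H ⟨(i, j), hij⟩⟩

theorem mem_dom_of_mem_domD {μ : Fin r → ℤˣ} {h : Fin r → ℂ} (hh : h ∈ domD μ) :
    h ∈ (spinD r).dom μ := fun o => by
  rw [SpinLax.weight, Complex.neg_re, neg_lt_zero]
  exact hh _ _ o.2

theorem QplusD_eq (N : ℕ) (x : ℂ) : QplusD r N x = ratCont (spinD r).domQ (spinD r).regQ fun h =>
    normTrace ((spinD r).twistQ h)
      (laxPlus (linBlock (spinD r).α an) (linBlock (spinD r).β cr) x) N := by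
  rw [QplusD, domQD_eq, regQD_eq, laxPlusD_eq]
  rfl

theorem QminusD_eq (N : ℕ) (x : ℂ) : QminusD r N x = ratCont (spinD r).domQ (spinD r).regQ fun h =>
    normTrace ((spinD r).twistQ h)
      (laxMinus (linBlock (spinD r).α' an) (linBlock (spinD r).β' cr) x) N := by
  rw [QminusD, domQD_eq, regQD_eq, laxMinusD_eq]
  rfl

theorem typeD (r N : ℕ) :
      (∀ (x : ℂ),
        (∀ h ∈ domQD r, NormTraceConverges (twistQD h) (laxPlusD r x) N ∧
          NormTraceConverges (twistQD h) (laxMinusD r x) N) ∧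
        IsRatCont (domQD r) (regQD r) (fun h => normTrace (twistQD h) (laxPlusD r x) N)
          (QplusD r N x) ∧
        IsRatCont (domQD r) (regQD r) (fun h => normTrace (twistQD h) (laxMinusD r x) N)
          (QminusD r N x)) ∧
      ∀ (μ : Fin r → ℤˣ) (t x : ℂ), ∀ h ∈ domD μ,
        TraceConverges (twistD μ t h) (laxD μ t x) N ∧
        chD μ t h =
          Complex.exp (∑ i : Fin r, sgn μ i * (t + ((r : ℂ) - (i : ℕ) - 2) * neg μ i
            + ∑ k ∈ Finset.Iic i, neg μ k) * h i) /
          ∏ p : OscD r, (1 - Complex.exp (-(h p.1.1 + sgn μ p.1.1 * sgn μ p.1.2 * h p.1.2))) ∧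
        QD (-μ) N x h = conjQ (weylMat 1 μ) N (QminusD r N x (flipTwist μ h)) ∧
        TD μ N t x h = chD μ t h • (QD μ N (x + t) h * QD (-μ) N (x - t - r + 1) h) := by
  have hplus := fun x => (spinD r).ratCont_plus x N
  have hminus := fun x => (spinD r).ratCont_minus x N
  refine ⟨fun x => ⟨fun h hh => ?_, ?_, ?_⟩, fun μ t x h hh => ?_⟩
  · rw [laxPlusD_eq, laxMinusD_eq]
    exact (spinD r).normTraceConverges_of_mem (domQD_eq ▸ hh) x N
  · rw [QplusD_eq, domQD_eq, regQD_eq, laxPlusD_eq]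
    exact (hplus x).1
  · rw [QminusD_eq, domQD_eq, regQD_eq, laxMinusD_eq]
    exact (hminus x).1
  · have hd := mem_dom_of_mem_domD hh
    have hr := (spinD r).flipTwist_mem hd
    have hr' : flipTwist (-μ) h ∈ (spinD r).regQ := by
      have h1 : flipTwist (-μ) h = -flipTwist μ h := by
        ext i
        simp [flipTwist, sgn]
      rw [h1]
      exact (spinD r).neg_mem_regQ hr
    have hQ : ∀ x, QD (-μ) N x h = conjQ (weylMat 1 μ) N (QminusD r N x (flipTwist μ h)) := by
      intro x
      rw [QD, QplusD_eq, QminusD_eq, (hplus x).2 _ hr', (hminus x).2 _ hr]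
      exact (spinD r).conjQ_neg_ratCont hd x N
    refine ⟨?_, ?_, hQ x, ?_⟩
    · rw [twistD_eq, laxD_eq]
      exact (spinD r).traceConverges_of_mem hd _ _ _ N
    · rw [chD, twistD_eq, (spinD r).trace_twist hd, vacuum_spinD]
      rfl
    · rw [hQ, TD, chD, twistD_eq, laxD_eq, (spinD r).twistedTrace_twist hd, QD, QplusD_eq,
        QminusD_eq, (hplus _).2 _ hr, (hminus _).2 _ hr]
      rfl

end TypeD

/-! ## Type A -/

section Reindex

variable {K K' S : Type}

theorem wickMat_reindex (c : S → S → ℂ) (e : K ≃ K') (L : Matrix K K (FreeAlgebra ℂ S)) (N : ℕ) :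
    wickMat c (Matrix.reindex e e L) N =
      (wickMat c L N).submatrix (Equiv.arrowCongr (Equiv.refl (Fin N)) e).symm
        (Equiv.arrowCongr (Equiv.refl (Fin N)) e).symm := rfl

theorem wickMat_relabel {κ κ' : Type} [DecidableEq κ] [DecidableEq κ'] (e : κ ≃ κ') (z : κ' → ℂ)
    (L : Matrix K K (FreeAlgebra ℂ (κ ⊕ κ))) (N : ℕ) :
    wickMat (oscC z) (L.map (FreeAlgebra.lift ℂ (Sum.elim (fun o => genA (e o))
      fun o => genC (e o)))) N = wickMat (oscC (z ∘ e)) L N := by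
  refine wickMat_map_lift ?_ ?_ L N
  · rintro (o | o)
    · exact genA_mem _
    · exact genC_mem _
  · rintro (i | i) (j | j) <;> simp [oscC]

theorem wickMat_dual {κ : Type} [DecidableEq κ] {z : κ → ℂ} (hz : ∀ o, z o ≠ 0)
    (hz1 : ∀ o, z o ≠ 1) {σ : κ → ℂ} (hσ : ∀ o, σ o * σ o = 1)
    (L : Matrix K K (FreeAlgebra ℂ (κ ⊕ κ))) (N : ℕ) :
    wickMat (oscC fun o => (z o)⁻¹) (L.map (FreeAlgebra.lift ℂ
      (Sum.elim (fun o => (-σ o) • genC o) fun o => σ o • genA o))) N = wickMat (oscC z) L N := by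
  refine wickMat_map_lift ?_ (wick_oscC_inv hz hz1 hσ) L N
  rintro (o | o)
  · exact Submodule.smul_mem _ _ (genC_mem o)
  · exact Submodule.smul_mem _ _ (genA_mem o)

end Reindex

section LinearLax

variable {p q R : Type} [Ring R] [Algebra ℂ R] [Fintype p] [Fintype q] [DecidableEq p]
  [DecidableEq q]

theorem laxLin_weighted_trace (g : p → ℂ) (k : q → ℂ) {A : Matrix q p R} {B : Matrix p q R}
    (hAB : ∀ i j, A j i * B i j = 1 + B i j * A j i) (u v : ℂ) (hv : v = -Fintype.card p) :
    ∑ i, g i • laxLin A B u v (Sum.inl i) (Sum.inl i) +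
        ∑ j, k j • laxLin A B u v (Sum.inr j) (Sum.inr j) =
      (∑ i, u * g i) • (1 : R) + ∑ o : p × q, (k o.2 - g o.1) • (B o.1 o.2 * A o.2 o.1) := by
  have h1 : ∀ j, laxLin A B u v (Sum.inr j) (Sum.inr j) = ∑ i, B i j * A j i := fun j => by
    simp only [laxLin, Matrix.fromBlocks_apply₂₂, Matrix.add_apply, Matrix.smul_apply,
      Matrix.one_apply_eq, Matrix.mul_apply, hAB, Finset.sum_add_distrib, Finset.sum_const,
      Finset.card_univ, hv, ← Nat.cast_smul_eq_nsmul ℂ]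
    module
  have h2 : ∀ i, laxLin A B u v (Sum.inl i) (Sum.inl i) = u • 1 - ∑ j, B i j * A j i := fun i => by
    simp only [laxLin, Matrix.fromBlocks_apply₁₁, Matrix.sub_apply, Matrix.smul_apply,
      Matrix.one_apply_eq, Matrix.mul_apply]
  simp only [h1, h2, Fintype.sum_prod_type, sub_smul, Finset.sum_sub_distrib, smul_sub,
    Finset.sum_smul, Finset.smul_sum, smul_smul, mul_comm u]
  rw [Finset.sum_comm (s := (Finset.univ : Finset q))]
  abel

end LinearLax

section TypeA

variable {n : ℕ} (I : Finset (Fin n))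

theorem inA_mem (p : OscA I) : inA I p ∈ I := by
  rw [inA, sigmaA, finSumEquivOfFinset_inl]
  exact Finset.orderEmbOfFin_mem _ _ _

theorem outA_notMem (p : OscA I) : outA I p ∉ I := by
  rw [outA, sigmaA, finSumEquivOfFinset_inr]
  exact Finset.mem_compl.1 (Finset.orderEmbOfFin_mem _ _ _)

theorem prod_inA (f : Fin n → ℂ) : ∏ i : Fin I.card, f (sigmaA I (Sum.inl i)) = ∏ i ∈ I, f i := by
  rw [← Finset.prod_coe_sort I]
  refine Eq.trans ?_ ((I.orderIsoOfFin rfl).toEquiv.prod_comp fun i => f i)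
  simp [sigmaA]

theorem prod_outA (f : Fin n → ℂ) :
    ∏ j : Fin Iᶜ.card, f (sigmaA I (Sum.inr j)) = ∏ j ∈ Iᶜ, f j := by
  rw [← Finset.prod_coe_sort Iᶜ]
  refine Eq.trans ?_ ((Iᶜ.orderIsoOfFin rfl).toEquiv.prod_comp fun i => f i)
  simp [sigmaA]

theorem orderEmbOfFin_cast {s s' : Finset (Fin n)} (h : s' = s) (i : Fin s'.card) :
    s'.orderEmbOfFin rfl i = s.orderEmbOfFin rfl (i.cast (by rw [h])) := by
  subst h
  rfl

/-- The identification of the index sets of the blocks for `I` and its complement. -/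
def complSum : Fin Iᶜ.card ⊕ Fin Iᶜᶜ.card ≃ Fin I.card ⊕ Fin Iᶜ.card :=
  (Equiv.sumComm _ _).trans
    (Equiv.sumCongr (finCongr (by rw [compl_compl])) (Equiv.refl _))

theorem sigmaA_compl : sigmaA Iᶜ = (complSum I).trans (sigmaA I) := by
  ext (j | i)
  · rfl
  · simp only [complSum, sigmaA, finSumEquivOfFinset_inr, Equiv.trans_apply, Equiv.sumComm_apply,
      Sum.swap_inr, Equiv.sumCongr_apply, Sum.map_inl, finSumEquivOfFinset_inl]
    rw [orderEmbOfFin_cast (compl_compl I)]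
    rfl

/-- The identification of the oscillators for `I` and its complement. -/
def complOsc : OscA I ≃ OscA Iᶜ :=
  (Equiv.prodComm _ _).trans
    (Equiv.prodCongr (Equiv.refl _) (finCongr (by rw [compl_compl])))

theorem inA_complOsc (p : OscA I) : inA Iᶜ (complOsc I p) = outA I p := rfl

theorem outA_complOsc (p : OscA I) : outA Iᶜ (complOsc I p) = inA I p := by
  rw [outA, sigmaA_compl]
  rfl

/-- The parameters `τ_q / τ_p` of the quasi-free functionals. -/
def paramA (h : Fin n → ℂ) (p : OscA I) : ℂ := Complex.exp (h (outA I p) - h (inA I p))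

/-- The weight of an oscillator in the twists. -/
def weightA (h : Fin n → ℂ) (p : OscA I) : ℂ :=
  if flipA I p then h (inA I p) - h (outA I p) else h (outA I p) - h (inA I p)

/-- The contribution of the particle-hole transformation to the vacuum eigenvalue. -/
def shiftA (h : Fin n → ℂ) : ℂ := ∑ p, if flipA I p then h (inA I p) - h (outA I p) else 0

variable {I} in
theorem weightA_re_lt {h : Fin n → ℂ} (hh : h ∈ domA I) (p : OscA I) : (weightA I h p).re < 0 := by
  have h1 := hh _ (inA_mem I p) _ (outA_notMem I p)
  rw [weightA]
  split_ifs with h2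
  · rw [Complex.sub_re, sub_neg]
    exact h1.2 h2
  · rw [Complex.sub_re, sub_neg]
    exact h1.1 (lt_of_le_of_ne (not_lt.1 h2) fun h3 => outA_notMem I p (h3 ▸ inA_mem I p))

variable {I} in
theorem norm_exp_weightA_lt {h : Fin n → ℂ} (hh : h ∈ domA I) (p : OscA I) :
    ‖Complex.exp (weightA I h p)‖ < 1 := by
  rw [Complex.norm_exp, Real.exp_lt_one_iff]
  exact weightA_re_lt hh p

theorem paramA_eq (h : Fin n → ℂ) : paramA I h = fun p => if flipA I p then
    (Complex.exp (weightA I h p))⁻¹ else Complex.exp (weightA I h p) := by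
  ext p
  rw [paramA, weightA]
  split_ifs
  · rw [← Complex.exp_neg, neg_sub]
  · rfl

variable {I} in
theorem exp_weightA_ne_one {h : Fin n → ℂ} (hh : h ∈ domA I) (p : OscA I) :
    Complex.exp (weightA I h p) ≠ 1 := by
  intro h1
  have := norm_exp_weightA_lt hh p
  rw [h1] at this
  simp at this

variable {I} in
theorem paramA_ne_one {h : Fin n → ℂ} (hh : h ∈ domA I) (p : OscA I) : paramA I h p ≠ 1 := by
  have := exp_weightA_ne_one hh p
  rw [paramA_eq]
  beta_reduce
  split_ifs
  · rwa [Ne, inv_eq_one]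
  · exact this

variable {I} in
theorem compl_mem_domA {h : Fin n → ℂ} (hh : h ∈ domA I) : h ∈ domA Iᶜ := fun i hi j hj =>
  (hh j (by simpa using hj) i (by simpa using hi)).symm

theorem isGeomDiag_twistQA (h : Fin n → ℂ) :
    IsGeomDiag (twistQA I h) (Complex.exp (shiftA I h)) fun p => Complex.exp (weightA I h p) := by
  refine isGeomDiag_expDiag ?_
  rw [shiftA, Finset.sum_smul, ← Finset.sum_add_distrib]
  refine Finset.sum_congr rfl fun p _ => ?_
  have := an_mul_cr_sub p p
  rw [if_pos rfl, sub_eq_iff_eq_add] at this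
  rw [weightA, this]
  split_ifs <;> module

theorem isGeomDiag_twistA (t : ℂ) (h : Fin n → ℂ) :
    IsGeomDiag (twistA I t h)
      (Complex.exp (∑ i : Fin I.card, t * h (sigmaA I (Sum.inl i)) + shiftA I h))
      fun p => Complex.exp (weightA I h p) := by
  refine isGeomDiag_expDiag ?_
  have h1 : ∀ i j, anPH (flipA I) (i, j) * crPH (flipA I) (i, j) =
      1 + crPH (flipA I) (i, j) * anPH (flipA I) (i, j) := fun i j => anPH_mul_crPH (flipA I) (i, j)
  have h2 : ∑ i, h i • laxA I t 0 i i =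
      (∑ i : Fin I.card, t * h (sigmaA I (Sum.inl i))) • (1 : FockOp (OscA I)) +
        ∑ p : OscA I, (h (outA I p) - h (inA I p)) •
          (crPH (flipA I) p * anPH (flipA I) p) := by
    rw [← (sigmaA I).sum_comp, Fintype.sum_sum_type]
    simp only [laxA, Matrix.reindex_apply, Matrix.submatrix_apply, Equiv.symm_apply_apply,
      zero_add, zero_sub]
    refine (laxLin_weighted_trace (fun i => h (sigmaA I (Sum.inl i)))
      (fun i => h (sigmaA I (Sum.inr i))) (A := Matrix.of fun j i => anPH (flipA I) (i, j))
      (B := Matrix.of fun i j => crPH (flipA I) (i, j)) h1 t _ ?_).trans rfl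
    rw [Fintype.card_fin]
  rw [h2, add_smul, add_assoc, shiftA, Finset.sum_smul (s := (Finset.univ : Finset (OscA I))),
    ← Finset.sum_add_distrib]
  congr 1
  refine Finset.sum_congr rfl fun p _ => ?_
  rw [crPH_mul_anPH, weightA]
  split_ifs <;> module

/-- The blocks of `L_I` over the free algebra. -/
def blockA : Matrix (Fin Iᶜ.card) (Fin I.card) (FreeAlgebra ℂ (OscA I ⊕ OscA I)) :=
  Matrix.of fun j i => genA (i, j)

/-- The blocks of `L_I` over the free algebra. -/
def blockC : Matrix (Fin I.card) (Fin Iᶜ.card) (FreeAlgebra ℂ (OscA I ⊕ OscA I)) :=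
  Matrix.of fun i j => genC (i, j)

theorem wickMat_blockA_blockC (z : OscA I → ℂ) (u v : ℂ) (N : ℕ) :
    wickMat (oscC z) (laxPlus (blockA I) (blockC I) u) N *
      wickMat (oscC z) (laxMinus (blockA I) (blockC I) v) N =
      wickMat (oscC z) (laxLin (blockA I) (blockC I) u v) N := by
  have h1 : blockA I = linBlock (fun j i o => if o = (i, j) then 1 else 0) genA := by
    ext j i
    simp [linBlock, blockA]
  have h2 : blockC I = linBlock (fun i j o => if o = (i, j) then 1 else 0) genC := by
    ext j i
    simp [linBlock, blockC]
  rw [h1, h2]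
  exact wickMat_laxPlus_mul_laxMinus z _ _ u v N

theorem map_laxPlus_block (x : ℂ) :
    (Matrix.reindex (sigmaA I) (sigmaA I) ((laxPlus (blockA I) (blockC I) x).map
      (FreeAlgebra.lift ℂ (flipGen (flipA I) (-1))))).map (fockRep (OscA I)) = laxQA I x := by
  rw [Matrix.reindex_apply, ← Matrix.submatrix_map, Matrix.map_map, ← AlgHom.coe_comp,
    fockRep_comp_flipGen_neg_one, laxPlus_map, laxQA, Matrix.reindex_apply]
  congr 2 <;> ext i j <;> simp [blockA, blockC]

theorem map_laxLin_block (t x : ℂ) :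
    (Matrix.reindex (sigmaA I) (sigmaA I) ((laxLin (blockA I) (blockC I) (x + t) (x - I.card)).map
      (FreeAlgebra.lift ℂ (flipGen (flipA I) 1)))).map (fockRep (OscA I)) = laxA I t x := by
  rw [Matrix.reindex_apply, ← Matrix.submatrix_map, Matrix.map_map, ← AlgHom.coe_comp,
    fockRep_comp_flipGen_one, laxLin_map, laxA, Matrix.reindex_apply]
  congr 2 <;> ext i j <;> simp [blockA, blockC]

variable {I}

theorem normTraceConverges_twistQA {h : Fin n → ℂ} (hh : h ∈ domA I) (x : ℂ) (N : ℕ) :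
    NormTraceConverges (twistQA I h) (laxQA I x) N := by
  rw [← map_laxPlus_block]
  exact (isGeomDiag_twistQA I h).normTraceConverges (norm_exp_weightA_lt hh) (Complex.exp_ne_zero _)
    _ _

theorem QA_eq {h : Fin n → ℂ} (hh : h ∈ domA I) (x : ℂ) (N : ℕ) :
    QA I N x h = wickMat (oscC (paramA I h))
      (Matrix.reindex (sigmaA I) (sigmaA I) (laxPlus (blockA I) (blockC I) x)) N := by
  rw [QA, ← map_laxPlus_block, (isGeomDiag_twistQA I h).normTrace (norm_exp_weightA_lt hh)
    (Complex.exp_ne_zero _), paramA_eq, wickMat_reindex, wickMat_reindex,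
    wickMat_flipGen _ (by norm_num) (fun _ => Complex.exp_ne_zero _) (exp_weightA_ne_one hh)]

theorem QA_compl_eq {h : Fin n → ℂ} (hh : h ∈ domA I) (x : ℂ) (N : ℕ) :
    QA Iᶜ N x h = wickMat (oscC (paramA I h))
      (Matrix.reindex (sigmaA I) (sigmaA I) (laxMinus (blockA I) (blockC I) x)) N := by
  have h1 : paramA Iᶜ h ∘ complOsc I = fun p => (paramA I h p)⁻¹ := by
    ext p
    rw [Function.comp_apply, paramA, inA_complOsc, outA_complOsc, paramA, ← Complex.exp_neg, neg_sub]
  rw [QA_eq (compl_mem_domA hh), ← wickMat_dual (z := paramA I h) (σ := fun _ => -1) (fun _ => Complex.exp_ne_zero _)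
    (paramA_ne_one hh) (fun _ => by norm_num), ← h1, ← wickMat_relabel]
  congr 1
  rw [sigmaA_compl]
  ext k l
  obtain ⟨k, rfl⟩ := ((complSum I).trans (sigmaA I)).surjective k
  obtain ⟨l, rfl⟩ := ((complSum I).trans (sigmaA I)).surjective l
  simp only [Matrix.reindex_apply, Matrix.map_apply, Matrix.submatrix_apply,
    Equiv.symm_apply_apply]
  simp only [Equiv.trans_apply, Equiv.symm_apply_apply]
  rcases k with k | k <;> rcases l with l | l <;>
    simp [complSum, laxPlus, laxMinus, blockA, blockC, complOsc, Matrix.mul_apply, Matrix.one_apply]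
  have h2 := (finCongr (show I.card = Iᶜᶜ.card by rw [compl_compl])).sum_comp fun j =>
    genC (k, j) * genA (l, j)
  rw [← h2, sub_eq_add_neg]
  congr 1
  split_ifs <;> simp

theorem chA_eq {h : Fin n → ℂ} (hh : h ∈ domA I) (t : ℂ) :
    chA I t h = (∏ i ∈ I, Complex.exp (t * h i)) *
      ∏ i ∈ I, ∏ j ∈ Iᶜ, (if j < i then -1 else 1) * Complex.exp (h i) /
        (Complex.exp (h i) - Complex.exp (h j)) := by
  rw [chA, (isGeomDiag_twistA I t h).trace (norm_exp_weightA_lt hh), Complex.exp_add,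
    Complex.exp_sum, ← prod_inA I fun i => Complex.exp (t * h i),
    ← prod_inA I fun i => ∏ j ∈ Iᶜ, (if j < i then -1 else 1) * Complex.exp (h i) /
      (Complex.exp (h i) - Complex.exp (h j)), mul_assoc, shiftA,
    Complex.exp_sum (f := fun p => if flipA I p then h (inA I p) - h (outA I p) else 0),
    ← Finset.prod_mul_distrib, Fintype.prod_prod_type]
  congr 1
  refine Finset.prod_congr rfl fun i _ => ?_
  refine Eq.trans ?_ (prod_outA I _)
  refine Finset.prod_congr rfl fun j _ => ?_
  have h1 := exp_weightA_ne_one hh (i, j)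
  rw [weightA] at h1 ⊢
  have e1 := Complex.exp_ne_zero (h (inA I (i, j)))
  have e2 := Complex.exp_ne_zero (h (outA I (i, j)))
  change _ = (if outA I (i, j) < inA I (i, j) then -1 else 1) * Complex.exp (h (inA I (i, j))) /
    (Complex.exp (h (inA I (i, j))) - Complex.exp (h (outA I (i, j))))
  split_ifs at h1 ⊢ with h2
  · rw [Complex.exp_sub] at h1 ⊢
    have h3 : Complex.exp (h (outA I (i, j))) - Complex.exp (h (inA I (i, j))) ≠ 0 := fun h4 =>
      h1 (by rw [← sub_eq_zero.1 h4, div_self e2])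
    have h4 : Complex.exp (h (inA I (i, j))) - Complex.exp (h (outA I (i, j))) ≠ 0 := by
      rw [← neg_sub]; exact neg_ne_zero.2 h3
    have h5 : 1 - Complex.exp (h (inA I (i, j))) / Complex.exp (h (outA I (i, j))) ≠ 0 :=
      sub_ne_zero.2 h1.symm
    field_simp
    ring
  · rw [Complex.exp_sub] at h1 ⊢
    have h4 : Complex.exp (h (inA I (i, j))) - Complex.exp (h (outA I (i, j))) ≠ 0 := fun h4 =>
      h1 (by rw [← sub_eq_zero.1 h4, div_self e1])
    have h5 : 1 - Complex.exp (h (outA I (i, j))) / Complex.exp (h (inA I (i, j))) ≠ 0 :=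
      sub_ne_zero.2 h1.symm
    rw [Complex.exp_zero]
    field_simp

theorem typeA (I : Finset (Fin n)) (N : ℕ) (t x : ℂ) {h : Fin n → ℂ} (hh : h ∈ domA I) :
    TraceConverges (twistA I t h) (laxA I t x) N ∧
    NormTraceConverges (twistQA I h) (laxQA I (x + t)) N ∧
    NormTraceConverges (twistQA Iᶜ h) (laxQA Iᶜ (x - (I.card : ℂ))) N ∧
    chA I t h = (∏ i ∈ I, Complex.exp (t * h i)) *
      ∏ i ∈ I, ∏ j ∈ Iᶜ, (if j < i then -1 else 1) * Complex.exp (h i) /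
        (Complex.exp (h i) - Complex.exp (h j)) ∧
    TA I N t x h = chA I t h • (QA I N (x + t) h * QA Iᶜ N (x - (I.card : ℂ)) h) := by
  refine ⟨?_, normTraceConverges_twistQA hh _ N,
    normTraceConverges_twistQA (compl_mem_domA hh) _ N, chA_eq hh t, ?_⟩
  · rw [← map_laxLin_block]
    exact (isGeomDiag_twistA I t h).traceConverges (norm_exp_weightA_lt hh) _ _
  · rw [TA, ← map_laxLin_block, (isGeomDiag_twistA I t h).twistedTrace (norm_exp_weightA_lt hh),
      QA_eq hh, QA_compl_eq hh, wickMat_reindex, wickMat_reindex, wickMat_reindex,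
      wickMat_flipGen _ (by norm_num) (fun _ => Complex.exp_ne_zero _) (exp_weightA_ne_one hh),
      ← paramA_eq, Matrix.submatrix_mul_equiv, wickMat_blockA_blockC]
    rfl

end TypeA

/-! ## Quadratic Lax matrices in block form -/

section Block

variable {m : ℕ}

@[simp] theorem vec3_zero {α : Type} (a : α) (b : Fin m → α) (c : α) : vec3 a b c 0 = a := rfl

@[simp] theorem vec3_mid {α : Type} (a : α) (b : Fin m → α) (c : α) (j : Fin m) :
    vec3 a b c (mid j) = b j := by
  rw [vec3, mid, Fin.cons_succ, Fin.snoc_castSucc]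

@[simp] theorem vec3_last {α : Type} (a : α) (b : Fin m → α) (c : α) :
    vec3 a b c (Fin.last (m + 1)) = c := by
  rw [vec3, ← Fin.succ_last, Fin.cons_succ, Fin.snoc_last]

theorem forall_mid {P : Fin (m + 2) → Prop} :
    (∀ i, P i) ↔ P 0 ∧ (∀ j, P (mid j)) ∧ P (Fin.last (m + 1)) :=
  ⟨fun h => ⟨h _, fun _ => h _, h _⟩, fun h i => Fin.cases h.1 (Fin.lastCases h.2.2 h.2.1) i⟩

@[to_additive]
theorem prod_mid {M : Type} [CommMonoid M] (f : Fin (m + 2) → M) :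
    ∏ i, f i = f 0 * (∏ j, f (mid j)) * f (Fin.last (m + 1)) := by
  rw [Fin.prod_univ_succ, Fin.prod_univ_castSucc, mul_assoc]
  rfl

theorem rev_mid (j : Fin m) : (mid j).rev = mid j.rev := by
  ext
  simp [mid]
  omega

variable {R R' : Type}

theorem blk3_ext {A B : Matrix (Fin (m + 2)) (Fin (m + 2)) R} (h00 : A 0 0 = B 0 0)
    (h01 : ∀ j, A 0 (mid j) = B 0 (mid j)) (h02 : A 0 (Fin.last _) = B 0 (Fin.last _))
    (h10 : ∀ i, A (mid i) 0 = B (mid i) 0) (h11 : ∀ i j, A (mid i) (mid j) = B (mid i) (mid j))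
    (h12 : ∀ i, A (mid i) (Fin.last _) = B (mid i) (Fin.last _))
    (h20 : A (Fin.last _) 0 = B (Fin.last _) 0)
    (h21 : ∀ j, A (Fin.last _) (mid j) = B (Fin.last _) (mid j))
    (h22 : A (Fin.last _) (Fin.last _) = B (Fin.last _) (Fin.last _)) : A = B := by
  ext i j
  revert j
  revert i
  simp only [forall_mid (m := m)]
  exact ⟨⟨h00, h01, h02⟩, fun i => ⟨h10 i, h11 i, h12 i⟩, h20, h21, h22⟩

theorem blk3_map (φ : R → R') (a : R) (b : Fin m → R) (c : R) (d : Fin m → R)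
    (E : Matrix (Fin m) (Fin m) R) (f : Fin m → R) (g : R) (k : Fin m → R) (l : R) :
    (blk3 a b c d E f g k l).map φ = blk3 (φ a) (fun j => φ (b j)) (φ c) (fun j => φ (d j)) (E.map φ)
      (fun j => φ (f j)) (φ g) (fun j => φ (k j)) (φ l) := by
  apply blk3_ext <;> intros <;> simp [blk3]

variable [Ring R]

theorem pairJ_add (u v : Fin m → R) :
    pairJ (u + v) (u + v) = pairJ u u + pairJ u v + pairJ v u + pairJ v v := by
  simp only [pairJ, Pi.add_apply, mul_add, add_mul, Finset.sum_add_distrib]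
  abel

theorem pairJ_sub (u v : Fin m → R) :
    pairJ (u - v) (u - v) = pairJ u u - pairJ u v - pairJ v u + pairJ v v := by
  simp only [pairJ, Pi.sub_apply, mul_sub, sub_mul, Finset.sum_sub_distrib]
  abel

theorem blk3_mul (a : R) (b : Fin m → R) (c : R) (d : Fin m → R) (E : Matrix (Fin m) (Fin m) R)
    (f : Fin m → R) (g : R) (k : Fin m → R) (l : R) (a' : R) (b' : Fin m → R) (c' : R)
    (d' : Fin m → R) (E' : Matrix (Fin m) (Fin m) R) (f' : Fin m → R) (g' : R) (k' : Fin m → R)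
    (l' : R) :
    blk3 a b c d E f g k l * blk3 a' b' c' d' E' f' g' k' l' =
      blk3 (a * a' + ∑ j, b j * d' j + c * g')
        (fun j => a * b' j + ∑ i, b i * E' i j + c * k' j)
        (a * c' + ∑ j, b j * f' j + c * l')
        (fun i => d i * a' + ∑ j, E i j * d' j + f i * g')
        (Matrix.of fun i j => d i * b' j + ∑ n, E i n * E' n j + f i * k' j)
        (fun i => d i * c' + ∑ j, E i j * f' j + f i * l')
        (g * a' + ∑ j, k j * d' j + l * g')
        (fun j => g * b' j + ∑ i, k i * E' i j + l * k' j)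
        (g * c' + ∑ j, k j * f' j + l * l') := by
  apply blk3_ext <;> intros <;> simp [Matrix.mul_apply, sum_mid, blk3]

theorem one_eq_blk3 : (1 : Matrix (Fin (m + 2)) (Fin (m + 2)) R) = blk3 1 0 0 0 1 0 0 0 1 := by
  have h1 : ∀ j : Fin m, mid j ≠ 0 := fun j => Fin.succ_ne_zero _
  have h2 : ∀ j : Fin m, mid j ≠ Fin.last (m + 1) := fun j h => by
    have := congrArg Fin.val h
    simp [mid] at this
    omega
  have h3 : ∀ i j : Fin m, mid i = mid j ↔ i = j := fun i j => by simp [mid]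
  have h4 : (0 : Fin (m + 2)) ≠ Fin.last (m + 1) := (Fin.last_pos).ne
  apply blk3_ext <;> intros <;>
    simp [blk3, Matrix.one_apply, h1, h2, h3, h4, (h1 _).symm, (h2 _).symm, h4.symm]

theorem pairJ_comm {u v : Fin m → R} (h : ∀ i j, Commute (u i) (v j)) : pairJ u v = pairJ v u := by
  rw [pairJ, pairJ, ← Equiv.sum_comp Fin.revPerm]
  simp [(h _ _).eq]

variable [Algebra ℂ R] [Ring R'] [Algebra ℂ R']

theorem pairJ_map (φ : R →ₐ[ℂ] R') (u v : Fin m → R) :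
    φ (pairJ u v) = pairJ (fun j => φ (u j)) fun j => φ (v j) := by
  simp [pairJ]

theorem unipBD_map (φ : R →ₐ[ℂ] R') (p : Fin m → R) :
    (unipBD p).map φ = unipBD fun j => φ (p j) := by
  rw [unipBD, blk3_map, unipBD]
  simp only [map_one, map_neg, map_smul, pairJ_map, map_zero, Pi.zero_apply]
  rw [Matrix.map_one φ (map_zero φ) (map_one φ)]
  rfl

theorem laxFirst_map (φ : R →ₐ[ℂ] R') (p w : Fin m → R) (x : ℂ) :
    (laxFirst p w x).map φ = laxFirst (fun j => φ (p j)) (fun j => φ (w j)) x := by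
  rw [laxFirst, blk3_map, laxFirst]
  congr 1 <;> try ext
  all_goals simp [pairJ_map, Matrix.one_apply, apply_ite φ]

theorem laxLast_map (φ : R →ₐ[ℂ] R') (p w : Fin m → R) (x : ℂ) :
    (laxLast p w x).map φ = laxLast (fun j => φ (p j)) (fun j => φ (w j)) x := by
  rw [laxLast, blk3_map, laxLast]
  congr 1 <;> try ext
  all_goals simp [pairJ_map, Matrix.one_apply, apply_ite φ]

theorem laxFrak_map (φ : R →ₐ[ℂ] R') (p w : Fin m → R) (x₁ x₂ x : ℂ) :
    (laxFrak p w x₁ x₂ x).map φ = laxFrak (fun j => φ (p j)) (fun j => φ (w j)) x₁ x₂ x := by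
  have h : ∀ A B : Matrix (Fin (m + 2)) (Fin (m + 2)) R, (A * B).map φ = A.map φ * B.map φ :=
    fun A B => Matrix.map_mul (f := (φ : R →+* R'))
  rw [laxFrak, h, h, unipBD_map, unipBD_map, blk3_map, laxFrak]
  congr 2
  · congr 1 <;> try ext
    all_goals simp [pairJ_map, Matrix.one_apply, apply_ite φ]
  · simp [Pi.neg_def]

theorem laxDiff_map (φ : R →ₐ[ℂ] R') (p w : Fin m → R) (x₁₂ x : ℂ) :
    (laxDiff p w x₁₂ x).map φ = laxDiff (fun j => φ (p j)) (fun j => φ (w j)) x₁₂ x :=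
  laxFrak_map φ p w _ _ _

/-- The lower triangular factor of `L_1(x)`. -/
def lowFirst (w : Fin m → R) (x : ℂ) : Matrix (Fin (m + 2)) (Fin (m + 2)) R :=
  blk3 (algebraMap ℂ R (x * (x - ((m : ℂ) + 2) / 2 + 2))) 0 0 (fun i => -(x • w i))
    (x • (1 : Matrix (Fin m) (Fin m) R)) 0 (-((1 / 2 : ℂ) • pairJ w w)) (fun j => w j.rev) 1

/-- The lower triangular factor of `L_K(y)`. -/
def lowLast (w : Fin m → R) (y : ℂ) : Matrix (Fin (m + 2)) (Fin (m + 2)) R :=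
  blk3 1 0 0 w (y • (1 : Matrix (Fin m) (Fin m) R)) 0 (-((1 / 2 : ℂ) • pairJ w w))
    (fun j => -(y • w j.rev)) (algebraMap ℂ R (y * (y - ((m : ℂ) + 2) / 2 + 2)))

theorem laxFirst_eq (p w : Fin m → R) (x : ℂ) : laxFirst p w x = unipBD p * lowFirst w x := by
  rw [unipBD, lowFirst, blk3_mul, laxFirst]
  congr 1
  · rw [neg_mul_neg, smul_mul_smul_comm]
    simp only [one_mul, mul_neg, Finset.sum_neg_distrib, mul_smul_comm, ← Finset.smul_sum,
      Algebra.algebraMap_eq_smul_one]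
    module
  · ext j
    simp [Matrix.one_apply, sub_eq_add_neg]
  · simp
  · ext j
    simp [Matrix.one_apply]
  · ext i j
    simp [Matrix.one_apply, sub_eq_add_neg]
  · simp
  · simp
  · simp
  · simp

theorem laxLast_eq (p w : Fin m → R) (y : ℂ) : laxLast p w y = lowLast w y * unipBD p := by
  rw [unipBD, lowLast, blk3_mul, laxLast]
  congr 1
  · simp
  · simp
  · simp
  · ext; simp
  · ext i j
    simp [Matrix.one_apply, add_comm]
  · ext j
    simp [Matrix.one_apply]
    abel
  · simp
  · ext j
    simp [Matrix.one_apply]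
    abel
  · have h : ∑ j : Fin m, w j.rev * p j.rev = ∑ j, w j * p j :=
      Equiv.sum_comp Fin.revPerm fun j => w j * p j
    rw [neg_mul_neg, smul_mul_smul_comm]
    simp only [neg_mul_neg, ← Finset.smul_sum, smul_mul_assoc,
      Algebra.algebraMap_eq_smul_one, mul_one, h]
    module

theorem unipBD_mul {u v : Fin m → R} (h : pairJ u v = pairJ v u) :
    unipBD u * unipBD v = unipBD (u + v) := by
  rw [unipBD, unipBD, blk3_mul, unipBD]
  congr 1
  · simp
  · ext j
    simp [Matrix.one_apply, add_comm]
  · rw [pairJ_add, ← h]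
    simp only [one_mul, mul_one, mul_neg, Finset.sum_neg_distrib]
    rw [← pairJ]
    module
  · ext; simp
  · ext i j
    simp [Matrix.one_apply]
  · ext j
    simp [Matrix.one_apply, add_comm]
  · simp
  · ext; simp
  · simp

theorem unipBD_zero : unipBD (0 : Fin m → R) = 1 := by
  rw [one_eq_blk3, unipBD]
  simp [pairJ]
  rfl

theorem lowFirst_mul_lowLast {w₁ w₂ : Fin m → R} (h : ∀ i j, Commute (w₁ i) (w₂ j)) (x y : ℂ) :
    lowFirst w₁ x * lowLast w₂ y =
      blk3 (algebraMap ℂ R (x * (x - ((m : ℂ) + 2) / 2 + 2))) 0 0 (fun i => -(x • (w₁ - w₂) i))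
        ((x * y) • (1 : Matrix (Fin m) (Fin m) R)) 0 (-((1 / 2 : ℂ) • pairJ (w₁ - w₂) (w₁ - w₂)))
        (fun j => y • (w₁ - w₂) j.rev) (algebraMap ℂ R (y * (y - ((m : ℂ) + 2) / 2 + 2))) := by
  rw [lowFirst, lowLast, blk3_mul]
  congr 1
  · simp
  · ext j; simp
  · simp
  · ext j
    simp [Matrix.one_apply, smul_sub]
    abel
  · ext i j
    simp [Matrix.one_apply, smul_smul, mul_comm]
  · ext j; simp
  · rw [pairJ_sub, ← pairJ_comm h, one_mul, mul_one]
    have h1 : ∑ j, w₁ j.rev * w₂ j = pairJ w₁ w₂ := by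
      rw [pairJ, ← Equiv.sum_comp Fin.revPerm]
      simp
    rw [h1]
    module
  · ext j
    simp [Matrix.one_apply, smul_sub]
    abel
  · simp

theorem laxFrak_eq (p w : Fin m → R) (x₁ x₂ x : ℂ) :
    laxFrak p w x₁ x₂ x = laxFirst p w (x - x₁) * laxLast (-p) 0 (x - x₂) := by
  rw [laxFirst_eq, laxLast_eq, Matrix.mul_assoc, ← Matrix.mul_assoc (lowFirst _ _),
    lowFirst_mul_lowLast fun i j => Commute.zero_right _, sub_zero, laxFrak, Matrix.mul_assoc]

theorem laxFirst_mul_laxLast {p₁ p₂ w₁ w₂ : Fin m → R} (hp : ∀ i j, Commute (p₁ i) (p₂ j))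
    (hw : ∀ i j, Commute (w₁ i) (w₂ j)) (x₁ x₂ x : ℂ) :
    laxFirst p₁ w₁ (x - x₁) * laxLast p₂ w₂ (x - x₂) =
      laxFrak p₁ (w₁ - w₂) x₁ x₂ x * unipBD (p₁ + p₂) := by
  have h1 : unipBD (-p₁) * unipBD (p₁ + p₂) = unipBD p₂ := by
    rw [unipBD_mul, neg_add_cancel_left]
    have := pairJ_comm hp
    simp only [pairJ, Pi.neg_apply, Pi.add_apply, mul_add, add_mul, mul_neg, neg_mul,
      Finset.sum_add_distrib, Finset.sum_neg_distrib] at this ⊢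
    rw [this]
    abel
  rw [laxFirst_eq, laxLast_eq, Matrix.mul_assoc, ← Matrix.mul_assoc (lowFirst _ _),
    lowFirst_mul_lowLast hw, laxFrak, Matrix.mul_assoc, Matrix.mul_assoc, h1]

theorem wickMat_laxFirst_mul_laxLast (z : Fin m → ℂ) (x₁₂ x : ℂ) (N : ℕ) :
    wickMat (oscC z) (laxFirst genC genA (x - (x₁₂ + 1) / 2)) N *
      wickMat (oscC z) (laxLast genC genA (x + (x₁₂ - 1) / 2)) N =
      wickMat (oscC z) (laxDiff genC genA x₁₂ x) N := by
  refine wickMat_factor z _ _ _ (unipBD fun o => FreeAlgebra.ι ℂ o) ?_ ?_ N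
  · rw [unipBD_map]
    simp only [FreeAlgebra.lift_ι_apply]
    exact unipBD_zero
  · intro R _ _ a₁ a₂ b₁ b₂ ha hb
    rw [laxFirst_map, laxLast_map, laxDiff_map, unipBD_map]
    simp only [lift_genA, lift_genC, Sum.elim_inl, Sum.elim_inr, FreeAlgebra.lift_ι_apply]
    have h := laxFirst_mul_laxLast hb ha x₁₂ 0 (x + (x₁₂ - 1) / 2)
    rw [sub_zero, show x + (x₁₂ - 1) / 2 - x₁₂ = x - (x₁₂ + 1) / 2 by ring] at h
    exact h

theorem laxFirst_submatrix_rev (p w : Fin m → R) (x : ℂ) :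
    (laxFirst p w x).submatrix Fin.rev Fin.rev = laxLast w (-p) x := by
  apply blk3_ext <;> intros <;>
    simp [laxFirst, laxLast, blk3, rev_mid, pairJ, Matrix.one_apply, Finset.sum_neg_distrib,
      sub_eq_add_neg]

end Block

/-! ## Permutation matrices and index sets in types B and D -/

section Perm

variable {K R : Type} [DecidableEq K] [Ring R] [Algebra ℂ R]

/-- The matrix of a permutation. -/
def permMat (π : Equiv.Perm K) : Matrix K K ℂ := (1 : Matrix K K ℂ).submatrix π id

theorem permMat_apply (π : Equiv.Perm K) (i j : K) : permMat π i j = if π i = j then 1 else 0 := by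
  rw [permMat, Matrix.submatrix_apply, Matrix.one_apply, id]

theorem permMat_one : permMat (1 : Equiv.Perm K) = 1 := by
  ext i j
  rw [permMat_apply, Matrix.one_apply]
  rfl

variable [Fintype K]

theorem permMat_mul (π ρ : Equiv.Perm K) : permMat (ρ * π) = permMat π * permMat ρ := by
  ext i j
  simp only [Matrix.mul_apply, permMat_apply, Equiv.Perm.mul_apply, ite_mul, one_mul, zero_mul,
    Finset.sum_ite_eq, Finset.mem_univ, if_true]
  rfl

theorem permMat_mul_inv (π : Equiv.Perm K) : permMat π * permMat π⁻¹ = 1 := by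
  rw [← permMat_mul, inv_mul_cancel, permMat_one]

theorem isUnit_permMat (π : Equiv.Perm K) : IsUnit (permMat π) :=
  IsUnit.of_mul_eq_one _ (permMat_mul_inv π)

theorem conjLax_permMat (π : Equiv.Perm K) (L : Matrix K K R) :
    conjLax (permMat π) L = L.submatrix π π := by
  rw [conjLax, Matrix.inv_eq_right_inv (permMat_mul_inv π)]
  ext i j
  simp [Matrix.mul_apply, permMat_apply, apply_ite (algebraMap ℂ R), Equiv.symm_apply_eq]

end Perm

section Index

variable {m : ℕ}

theorem rk_bounds : 2 * rk m ≤ m + 2 ∧ m + 1 ≤ 2 * rk m := by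
  rw [rk]
  omega

theorem rk_lt : rk m < m + 2 := by
  have := rk_bounds (m := m)
  omega

theorem idx_val (i : Fin (rk m)) : (idx i : ℕ) = i := rfl

theorem idx_injective : Function.Injective (idx (m := m)) := fun i j h => by
  ext
  have := congrArg Fin.val h
  exact this

theorem idx_zero : idx (0 : Fin (rk m)) = 0 := rfl

theorem idx_zero_rev : (idx (0 : Fin (rk m))).rev = Fin.last (m + 1) := by
  rw [idx_zero, Fin.rev_zero]

theorem idx_lt_rev (i j : Fin (rk m)) : idx i < (idx j).rev := by
  rw [Fin.lt_def, Fin.val_rev, idx_val, idx_val]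
  have h1 := i.2
  have h2 := j.2
  have h3 := rk_bounds (m := m)
  omega

theorem idx_ne_rev (i j : Fin (rk m)) : idx i ≠ (idx j).rev := (idx_lt_rev i j).ne

theorem idx_cases (l : Fin (m + 2)) : (∃ i, l = idx i) ∨ (∃ i, l = (idx i).rev) ∨
    (rk m ≤ l.1 ∧ rk m ≤ l.rev.1) := by
  by_cases h1 : l.1 < rk m
  · exact Or.inl ⟨⟨l.1, h1⟩, rfl⟩
  · by_cases h2 : l.rev.1 < rk m
    · exact Or.inr (Or.inl ⟨⟨l.rev.1, h2⟩, by rw [← Fin.rev_inj, Fin.rev_rev]; rfl⟩)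
    · exact Or.inr (Or.inr ⟨not_lt.1 h1, not_lt.1 h2⟩)

theorem odd_of_le {l : Fin (m + 2)} (h : rk m ≤ l.1 ∧ rk m ≤ l.rev.1) : Odd m := by
  have h3 := rk_bounds (m := m)
  rw [Fin.val_rev] at h
  rw [Nat.odd_iff]
  omega

theorem ne_idx_of_le {l : Fin (m + 2)} (h : rk m ≤ l.1 ∧ rk m ≤ l.rev.1) (i : Fin (rk m)) :
    l ≠ idx i := by
  rintro rfl
  exact absurd i.2 (not_lt.2 h.1)

theorem ne_rev_of_le {l : Fin (m + 2)} (h : rk m ≤ l.1 ∧ rk m ≤ l.rev.1) (i : Fin (rk m)) :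
    l ≠ (idx i).rev := by
  rintro rfl
  rw [Fin.rev_rev] at h
  exact absurd i.2 (not_lt.2 h.2)

@[to_additive]
theorem prod_idx {M : Type} [CommMonoid M] (f : Fin (m + 2) → M) :
    ∏ l, f l = (∏ i, f (idx i)) * (∏ i, f (idx i).rev) *
      if Odd m then f ⟨rk m, rk_lt⟩ else 1 := by
  classical
  have h1 : (Finset.univ : Finset (Fin (m + 2))) =
      (Finset.univ.map ⟨idx, idx_injective⟩ ∪
        Finset.univ.map ⟨fun i => (idx i).rev, Fin.rev_injective.comp idx_injective⟩) ∪
        Finset.univ.filter fun l => rk m ≤ l.1 ∧ rk m ≤ l.rev.1 := by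
    ext l
    rcases idx_cases l with ⟨i, rfl⟩ | ⟨i, rfl⟩ | h
    · simp
    · simp
    · simp only [Finset.mem_univ, Finset.mem_union, Finset.mem_filter, h, and_self, or_true]
  rw [h1, Finset.prod_union, Finset.prod_union, Finset.prod_map, Finset.prod_map]
  · congr 1
    have h0 := rk_bounds (m := m)
    split_ifs with h
    · rw [Nat.odd_iff] at h
      rw [Finset.prod_eq_single_of_mem (⟨rk m, rk_lt⟩ : Fin (m + 2))]
      · rw [Finset.mem_filter, Fin.val_rev]
        exact ⟨Finset.mem_univ _, le_rfl, by change _ ≤ m + 2 - (rk m + 1); omega⟩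
      · intro l hl hl'
        obtain ⟨h2, h3⟩ := (Finset.mem_filter.1 hl).2
        refine absurd (Fin.ext ?_) hl'
        change l.1 = rk m
        rw [Fin.val_rev] at h3
        omega
    · rw [Finset.filter_false_of_mem, Finset.prod_empty]
      exact fun l _ hl => h (odd_of_le hl)
  · rw [Finset.disjoint_left]
    intro l h2 h3
    simp only [Finset.mem_map, Finset.mem_univ, true_and, Function.Embedding.coeFn_mk] at h2 h3
    obtain ⟨i, rfl⟩ := h2
    obtain ⟨j, hj⟩ := h3
    exact idx_ne_rev _ _ hj.symm
  · rw [Finset.disjoint_left]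
    intro l h2 h3
    simp only [Finset.mem_union, Finset.mem_map, Finset.mem_univ, true_and,
      Function.Embedding.coeFn_mk] at h2
    have h3 := (Finset.mem_filter.1 h3).2
    rcases h2 with ⟨i, rfl⟩ | ⟨i, rfl⟩
    · exact ne_idx_of_le h3 i rfl
    · exact ne_rev_of_le h3 i rfl

/-- The permutation underlying `B̂_k`. -/
def idxPerm (k : Fin (rk m)) : Equiv.Perm (Fin (m + 2)) :=
  Equiv.swap 0 (idx k) * Equiv.swap (Fin.last (m + 1)) (idx k).rev

theorem idxPerm_idx (k i : Fin (rk m)) : idxPerm k (idx i) = idx (Equiv.swap 0 k i) := by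
  rw [idxPerm, Equiv.Perm.mul_apply, ← idx_zero_rev, Equiv.swap_apply_of_ne_of_ne (idx_ne_rev _ _)
    (idx_ne_rev _ _), ← idx_zero, idx_injective.map_swap]

theorem idxPerm_rev (k i : Fin (rk m)) :
    idxPerm k (idx i).rev = (idx (Equiv.swap 0 k i)).rev := by
  rw [idxPerm, Equiv.Perm.mul_apply, ← idx_zero_rev, ← Fin.rev_injective.map_swap,
    ← idx_injective.map_swap, ← idx_zero,
    Equiv.swap_apply_of_ne_of_ne (idx_ne_rev _ _).symm (idx_ne_rev _ _).symm]

theorem idxPerm_of_le (k : Fin (rk m)) {l : Fin (m + 2)} (h : rk m ≤ l.1 ∧ rk m ≤ l.rev.1) :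
    idxPerm k l = l := by
  rw [idxPerm, Equiv.Perm.mul_apply, ← idx_zero_rev,
    Equiv.swap_apply_of_ne_of_ne (ne_rev_of_le h _) (ne_rev_of_le h _), ← idx_zero,
    Equiv.swap_apply_of_ne_of_ne (ne_idx_of_le h _) (ne_idx_of_le h _)]

theorem idxPerm_apply_rev (k : Fin (rk m)) (l : Fin (m + 2)) :
    idxPerm k l.rev = (idxPerm k l).rev := by
  rcases idx_cases l with ⟨i, rfl⟩ | ⟨i, rfl⟩ | h
  · rw [idxPerm_rev, idxPerm_idx]
  · rw [Fin.rev_rev, idxPerm_rev, idxPerm_idx, Fin.rev_rev]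
  · rw [idxPerm_of_le k h, idxPerm_of_le]
    rw [Fin.rev_rev]
    exact h.symm

theorem idxPerm_zero_apply (k : Fin (rk m)) : idxPerm k 0 = idx k := by
  rw [← idx_zero, idxPerm_idx, Equiv.swap_apply_left]

theorem idxPerm_last_apply (k : Fin (rk m)) : idxPerm k (Fin.last (m + 1)) = (idx k).rev := by
  rw [← idx_zero_rev, idxPerm_rev, Equiv.swap_apply_left]

theorem idxPerm_idx_self (k : Fin (rk m)) : idxPerm k (idx k) = 0 := by
  rw [idxPerm_idx, Equiv.swap_apply_right, idx_zero]

theorem idxPerm_rev_self (k : Fin (rk m)) : idxPerm k (idx k).rev = Fin.last (m + 1) := by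
  rw [idxPerm_rev, Equiv.swap_apply_right, idx_zero_rev]

theorem idxPerm_zero : idxPerm (0 : Fin (rk m)) = 1 := by
  rw [idxPerm, idx_zero, Fin.rev_zero, Equiv.swap_self, Equiv.swap_self]
  rfl

theorem idxPerm_of_ne {k : Fin (rk m)} {l : Fin (m + 2)} (h0 : l ≠ 0) (h1 : l ≠ Fin.last (m + 1))
    (h2 : l ≠ idx k) (h3 : l ≠ (idx k).rev) : idxPerm k l = l := by
  rw [idxPerm, Equiv.Perm.mul_apply, Equiv.swap_apply_of_ne_of_ne h1 h3,
    Equiv.swap_apply_of_ne_of_ne h0 h2]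

theorem sum_single_apply {P : Fin (m + 2) → Prop} [DecidablePred P] (f : Fin (m + 2) → Fin (m + 2))
    (i j : Fin (m + 2)) :
    (∑ l, if P l then Matrix.single l (f l) (1 : ℂ) else 0 : Matrix _ _ ℂ) i j =
      if P i then (if f i = j then 1 else 0) else 0 := by
  rw [Matrix.sum_apply, Finset.sum_eq_single i]
  · split_ifs <;> simp_all
  · intro l _ hl
    split_ifs <;> simp [hl]
  · simp

theorem bhat_idx (k : Fin (rk m)) : bhat (idx k) = permMat (idxPerm k) := by
  rcases eq_or_ne k 0 with rfl | hk
  · rw [idxPerm_zero, permMat_one, bhat, if_pos idx_zero]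
  · have h1 : idx k ≠ 0 := fun h => hk (idx_injective h)
    have h2 : idx k ≠ Fin.last (m + 1) := idx_zero_rev (m := m) ▸ idx_ne_rev k 0
    have h3 : (idx k).rev ≠ 0 := (idx_ne_rev 0 k).symm
    have h4 : (idx k).rev ≠ Fin.last (m + 1) := fun h =>
      h1 (by rw [← Fin.rev_last, ← h, Fin.rev_rev])
    have h5 := idx_ne_rev k k
    have h6 : Fin.last (m + 1) ≠ 0 := (Fin.last_pos).ne'
    rw [bhat, if_neg h1, if_neg h2]
    simp only [if_pos (idx_lt_rev k k)]
    ext i j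
    simp only [Matrix.add_apply, sum_single_apply fun l => l, permMat_apply, Matrix.single_apply]
    by_cases e1 : i = 0
    · subst e1
      simp [idxPerm_zero_apply, h1, h3, h6]
    by_cases e2 : i = Fin.last (m + 1)
    · subst e2
      simp [idxPerm_last_apply, h2, h4, h6, h6.symm]
    by_cases e3 : i = idx k
    · subst e3
      simp [idxPerm_idx_self, h1.symm, h2.symm, h5.symm]
    by_cases e4 : i = (idx k).rev
    · subst e4
      simp [idxPerm_rev_self, h3.symm, h4.symm, h5]
    simp [idxPerm_of_ne e1 e2 e3 e4, e1, e2, e3, e4, Ne.symm e1, Ne.symm e2, Ne.symm e3, Ne.symm e4]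

theorem bhat_idx_rev (k : Fin (rk m)) :
    bhat (idx k).rev = permMat (Fin.revPerm * idxPerm k) := by
  rcases eq_or_ne k 0 with rfl | hk
  · rw [idxPerm_zero, mul_one, idx_zero_rev, bhat, if_neg (Fin.last_pos).ne', if_pos rfl]
    ext i j
    have := sum_single_apply (P := fun _ => True) Fin.rev i j
    simp only [if_true] at this
    rw [this, permMat_apply]
    rfl
  · have h1 : idx k ≠ 0 := fun h => hk (idx_injective h)
    have h2 : idx k ≠ Fin.last (m + 1) := idx_zero_rev (m := m) ▸ idx_ne_rev k 0
    have h3 : (idx k).rev ≠ 0 := (idx_ne_rev 0 k).symm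
    have h4 : (idx k).rev ≠ Fin.last (m + 1) := fun h =>
      h1 (by rw [← Fin.rev_last, ← h, Fin.rev_rev])
    have h5 := idx_ne_rev k k
    have h6 : Fin.last (m + 1) ≠ 0 := (Fin.last_pos).ne'
    rw [bhat, if_neg h3, if_neg h4, Fin.rev_rev]
    simp only [if_neg (idx_lt_rev k k).not_gt]
    ext i j
    simp only [Matrix.add_apply, sum_single_apply Fin.rev, permMat_apply, Matrix.single_apply,
      Equiv.Perm.mul_apply, Fin.revPerm_apply]
    by_cases e1 : i = 0
    · subst e1
      simp [idxPerm_zero_apply, h1, h3, h6]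
    by_cases e2 : i = Fin.last (m + 1)
    · subst e2
      simp [idxPerm_last_apply, h2, h4, h6, h6.symm]
    by_cases e3 : i = idx k
    · subst e3
      simp [idxPerm_idx_self, h1.symm, h2.symm, h5.symm]
    by_cases e4 : i = (idx k).rev
    · subst e4
      simp [idxPerm_rev_self, h3.symm, h4.symm, h5]
    simp [idxPerm_of_ne e1 e2 e3 e4, e1, e2, e3, e4, Ne.symm e1, Ne.symm e2, Ne.symm e3, Ne.symm e4]

theorem fullTwist_idx (h : Fin (rk m) → ℂ) (i : Fin (rk m)) : fullTwist h (idx i) = h i :=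
  dif_pos i.2

theorem fullTwist_idx_rev (h : Fin (rk m) → ℂ) (i : Fin (rk m)) :
    fullTwist h (idx i).rev = -h i := by
  have h1 : ¬ (idx i).rev.1 < rk m := fun h => idx_ne_rev ⟨_, h⟩ i rfl
  rw [fullTwist, dif_neg h1, dif_pos (by rw [Fin.rev_rev]; exact i.2)]
  congr 2
  ext
  simp only [Fin.rev_rev]
  rfl

theorem fullTwist_of_le (h : Fin (rk m) → ℂ) {l : Fin (m + 2)}
    (hl : rk m ≤ l.1 ∧ rk m ≤ l.rev.1) : fullTwist h l = 0 := by
  rw [fullTwist, dif_neg (not_lt.2 hl.1), dif_neg (not_lt.2 hl.2)]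

theorem fullTwist_rev (h : Fin (rk m) → ℂ) (l : Fin (m + 2)) :
    fullTwist h l.rev = -fullTwist h l := by
  rcases idx_cases l with ⟨i, rfl⟩ | ⟨i, rfl⟩ | hl
  · rw [fullTwist_idx, fullTwist_idx_rev]
  · rw [Fin.rev_rev, fullTwist_idx, fullTwist_idx_rev, neg_neg]
  · rw [fullTwist_of_le h hl, fullTwist_of_le, neg_zero]
    rw [Fin.rev_rev]
    exact hl.symm

theorem fullTwist_neg (h : Fin (rk m) → ℂ) (l : Fin (m + 2)) :
    fullTwist (-h) l = -fullTwist h l := by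
  rcases idx_cases l with ⟨i, rfl⟩ | ⟨i, rfl⟩ | hl
  · rw [fullTwist_idx, fullTwist_idx, Pi.neg_apply]
  · rw [fullTwist_idx_rev, fullTwist_idx_rev, Pi.neg_apply]
  · rw [fullTwist_of_le _ hl, fullTwist_of_le _ hl, neg_zero]

theorem fullTwist_idxPerm (k : Fin (rk m)) (h : Fin (rk m) → ℂ) (l : Fin (m + 2)) :
    fullTwist h (idxPerm k l) = fullTwist (swapTwist k h) l := by
  rcases idx_cases l with ⟨i, rfl⟩ | ⟨i, rfl⟩ | hl
  · rw [idxPerm_idx, fullTwist_idx, fullTwist_idx]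
    rfl
  · rw [idxPerm_rev, fullTwist_idx_rev, fullTwist_idx_rev]
    rfl
  · rw [idxPerm_of_le k hl, fullTwist_of_le _ hl, fullTwist_of_le _ hl]

theorem swapTwist_swapTwist (k : Fin (rk m)) (h : Fin (rk m) → ℂ) :
    swapTwist k (swapTwist k h) = h := by
  ext i
  simp [swapTwist]

theorem swapTwist_zero (k : Fin (rk m)) (h : Fin (rk m) → ℂ) : swapTwist k h 0 = h k := by
  rw [swapTwist, Equiv.swap_apply_left]

@[to_additive]
theorem prod_idxPerm_mid {M : Type} [CommMonoid M] (k : Fin (rk m)) {f : Fin (m + 2) → M}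
    (h1 : f (idx k) = 1) (h2 : f (idx k).rev = 1) :
    ∏ j, f (idxPerm k (mid j)) = (∏ i, f (idx i)) * (∏ i, f (idx i).rev) *
      if Odd m then f ⟨rk m, rk_lt⟩ else 1 := by
  rw [← prod_idx, ← Equiv.prod_comp (idxPerm k), prod_mid, idxPerm_zero_apply, idxPerm_last_apply, h1, h2,
    one_mul, mul_one]

theorem mid_ne_zero (j : Fin m) : mid j ≠ 0 := Fin.succ_ne_zero _

theorem mid_ne_last (j : Fin m) : mid j ≠ Fin.last (m + 1) := fun h => by
  have := congrArg Fin.val h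
  simp [mid] at this
  omega

theorem idxPerm_mid_ne (k : Fin (rk m)) (j : Fin m) :
    idxPerm k (mid j) ≠ idx k ∧ idxPerm k (mid j) ≠ (idx k).rev := by
  rw [← idxPerm_last_apply, ← idxPerm_zero_apply]
  exact ⟨(idxPerm k).injective.ne (mid_ne_zero j), (idxPerm k).injective.ne (mid_ne_last j)⟩

theorem mid_le_iff (k : Fin (rk m)) (j : Fin m) :
    mid j ≤ idx k ↔ idxPerm k (mid j) < idx k := by
  have h0 := mid_ne_zero j
  generalize mid j = l at h0
  rcases idx_cases l with ⟨i, rfl⟩ | ⟨i, rfl⟩ | hl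
  · rw [idxPerm_idx]
    rcases eq_or_ne i k with rfl | hik
    · rw [Equiv.swap_apply_right]
      simp only [le_refl, true_iff, idx_zero]
      exact Fin.pos_iff_ne_zero.2 h0
    · rw [Equiv.swap_apply_of_ne_of_ne (fun h => h0 (by rw [h, idx_zero])) hik]
      exact ⟨fun h => lt_of_le_of_ne h (idx_injective.ne hik), le_of_lt⟩
  · rw [idxPerm_rev]
    exact iff_of_false (idx_lt_rev _ _).not_ge (idx_lt_rev _ _).not_gt
  · rw [idxPerm_of_le k hl]
    have h1 : ¬ l ≤ idx k := fun h => by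
      have := k.2
      have : l.1 ≤ k.1 := h
      omega
    exact iff_of_false h1 fun h => h1 h.le

end Index

/-! ## Types B and D, first node -/

section Cartan

variable {m : ℕ} {R : Type} [Ring R] [Algebra ℂ R]

/-- The Cartan generators in the Lax matrix `L_{x₁₂}`. -/
def cartanDiff (p w : Fin m → R) (t : ℂ) : Fin (m + 2) → R :=
  vec3 (t • 1 - ∑ j, p j * w j) (fun j => p j * w j - p j.rev * w j.rev)
    (∑ j, p j * w j - t • 1)

theorem cartanDiff_rev (p w : Fin m → R) (t : ℂ) (l : Fin (m + 2)) :
    cartanDiff p w t l.rev = -cartanDiff p w t l := by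
  revert l
  rw [forall_mid]
  refine ⟨?_, fun j => ?_, ?_⟩
  · simp [cartanDiff]
  · simp [cartanDiff, rev_mid]
  · simp [cartanDiff]

theorem laxFrak_zero_zero (p w : Fin m → R) (x₁ x₂ x : ℂ) :
    laxFrak p w x₁ x₂ x 0 0 = algebraMap ℂ R ((x - x₁) ^ 2)
      + (x - x₁) • (algebraMap ℂ R (2 - ((m : ℂ) + 2) / 2) - ∑ j, p j * w j)
      + (1 / 4 : ℂ) • (pairJ p p * pairJ w w) := by
  rw [laxFrak_eq, laxFirst, laxLast, blk3_mul]
  simp [blk3, pairJ]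

theorem laxFrak_mid_mid (p w : Fin m → R) (x₁ x₂ x : ℂ) (j : Fin m) :
    laxFrak p w x₁ x₂ x (mid j) (mid j) = (x - x₁) • (w j * p j)
      - (1 / 2 : ℂ) • (p j.rev * pairJ w w * p j) + ((x - x₂) * (x - x₁)) • 1
      - (x - x₂) • (p j.rev * w j.rev) := by
  rw [laxFrak_eq, laxFirst, laxLast, blk3_mul]
  simp [blk3, pairJ, Matrix.one_apply, sub_mul, add_mul, mul_assoc]
  module

theorem laxFrak_last_last (p w : Fin m → R) (x₁ x₂ x : ℂ) :
    laxFrak p w x₁ x₂ x (Fin.last (m + 1)) (Fin.last (m + 1)) =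
      (1 / 4 : ℂ) • (pairJ w w * pairJ p p) + (x - x₂) • ∑ j, w j * p j +
        (algebraMap ℂ R ((x - x₂) ^ 2) + (x - x₂) • algebraMap ℂ R (2 - ((m : ℂ) + 2) / 2)) := by
  rw [laxFrak_eq, laxFirst, laxLast, blk3_mul]
  have h : ∑ j : Fin m, w j.rev * p j.rev = ∑ j, w j * p j :=
      Equiv.sum_comp Fin.revPerm fun j => w j * p j
  simp [blk3, pairJ, ← h, ← Finset.smul_sum]
  module

theorem laxDiff_coeff {p w : Fin m → R} (h : ∀ j, w j * p j = 1 + p j * w j) (t : ℂ)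
    (l : Fin (m + 2)) :
    (1 / 2 : ℂ) • (laxDiff p w (1 - t - ((m : ℂ) + 2) / 2) 1 l l -
      laxDiff p w (1 - t - ((m : ℂ) + 2) / 2) (-1) l l) = cartanDiff p w t l := by
  revert l
  rw [forall_mid]
  refine ⟨?_, fun j => ?_, ?_⟩
  · simp only [laxDiff, laxFrak_zero_zero, cartanDiff, vec3_zero, Algebra.algebraMap_eq_smul_one]
    module
  · simp only [laxDiff, laxFrak_mid_mid, cartanDiff, vec3_mid, h]
    module
  · simp only [laxDiff, laxFrak_last_last, cartanDiff, vec3_last, h, Finset.sum_add_distrib,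
      Finset.sum_const, Finset.card_univ, Fintype.card_fin, ← Nat.cast_smul_eq_nsmul ℂ,
      Algebra.algebraMap_eq_smul_one]
    module

/-- The differences `log τ_j - log τ_1` of the exponents of the twist. -/
def weightBD (g : Fin (rk m) → ℂ) (j : Fin m) : ℂ := fullTwist g (mid j) - g 0

theorem sum_cartanDiff (p w : Fin m → R) (t : ℂ) {π : Equiv.Perm (Fin (m + 2))}
    (hπ : ∀ l, π l.rev = (π l).rev) {g h : Fin (rk m) → ℂ}
    (hg : ∀ l, fullTwist g (π l) = fullTwist h l) :
    ∑ i, h i • cartanDiff p w t (π (idx i)) =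
      (g 0 * t) • 1 + ∑ j, weightBD g j • (p j * w j) := by
  have h1 : ∑ l, fullTwist g l • cartanDiff p w t l =
      (2 : ℂ) • ∑ i, h i • cartanDiff p w t (π (idx i)) := by
    rw [← Equiv.sum_comp π, sum_idx]
    simp only [hπ, cartanDiff_rev, fullTwist_rev, hg, fullTwist_idx, neg_smul_neg]
    rw [two_smul, add_eq_left]
    split_ifs with hm
    · rw [fullTwist_of_le, zero_smul]
      have := rk_bounds (m := m)
      rw [Nat.odd_iff] at hm
      exact ⟨le_rfl, by change _ ≤ m + 2 - (rk m + 1); omega⟩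
    · rfl
  have h2 : ∑ j, fullTwist g (mid j) • (p j.rev * w j.rev) =
      -∑ j, fullTwist g (mid j) • (p j * w j) := by
    rw [← Equiv.sum_comp Fin.revPerm, ← Finset.sum_neg_distrib]
    refine Finset.sum_congr rfl fun j _ => ?_
    rw [Fin.revPerm_apply, Fin.rev_rev, ← rev_mid, fullTwist_rev, neg_smul]
  have h3 : fullTwist g (Fin.last (m + 1)) = -g 0 := by
    rw [← idx_zero_rev, fullTwist_idx_rev]
  have h4 : fullTwist g 0 = g 0 := by rw [← idx_zero, fullTwist_idx]
  rw [sum_mid] at h1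
  simp only [cartanDiff, vec3_zero, vec3_mid, vec3_last, h3, h4, smul_sub, Finset.sum_sub_distrib,
    h2] at h1
  have h5 : ∑ i, h i • cartanDiff p w t (π (idx i)) =
      (1 / 2 : ℂ) • (2 : ℂ) • ∑ i, h i • cartanDiff p w t (π (idx i)) := by
    rw [smul_smul]; norm_num
  simp only [cartanDiff] at h5
  simp only [cartanDiff]
  rw [h5, ← h1]
  simp only [weightBD, sub_smul, Finset.sum_sub_distrib, ← Finset.smul_sum]
  module

end Cartan

section TypeBD

variable {m : ℕ}

theorem wickMat_laxLast_dual {z : Fin m → ℂ} (hz : ∀ j, z j ≠ 0) (hz1 : ∀ j, z j ≠ 1)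
    (π : Equiv.Perm (Fin (m + 2))) (x : ℂ) (N : ℕ) :
    conjQ (permMat (Fin.revPerm * π)) N
        (wickMat (oscC fun j => (z j)⁻¹) (laxFirst genC genA x) N) =
      conjQ (permMat π) N (wickMat (oscC z) (laxLast genC genA x) N) := by
  rw [permMat_mul, ← conjQ_conjQ, ← wickMat_conjLax _ (isUnit_permMat _), conjLax_permMat]
  change conjQ _ N (wickMat _ ((laxFirst genC genA x).submatrix Fin.rev Fin.rev) N) = _
  rw [laxFirst_submatrix_rev, ← wickMat_dual (σ := fun _ => 1) hz hz1 (fun _ => one_mul 1),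
    laxLast_map]
  simp only [lift_genA, lift_genC, Sum.elim_inl, Sum.elim_inr, one_smul, neg_smul]
  rfl

/-- The parameters `τ_j / τ_1` of the quasi-free functionals. -/
def paramBD (g : Fin (rk m) → ℂ) (j : Fin m) : ℂ := Complex.exp (weightBD g j)

theorem weightBD_neg (g : Fin (rk m) → ℂ) (j : Fin m) : weightBD (-g) j = -weightBD g j := by
  rw [weightBD, weightBD, fullTwist_neg, Pi.neg_apply]
  ring

theorem paramBD_neg (g : Fin (rk m) → ℂ) : paramBD (-g) = fun j => (paramBD g j)⁻¹ := by
  ext j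
  rw [paramBD, weightBD_neg, Complex.exp_neg, paramBD]

theorem isGeomDiag_twistQBD (h : Fin (rk m) → ℂ) :
    IsGeomDiag (twistQBD h) (Complex.exp 0) (paramBD h) :=
  isGeomDiag_expDiag (by rw [zero_smul, zero_add]; rfl)

theorem map_laxFirst (x : ℂ) :
    (laxFirst genC genA x).map (fockRep (Fin m)) = laxFirst cr an x := by
  rw [laxFirst_map]
  simp only [fockRep_genA, fockRep_genC]

theorem map_laxLast (x : ℂ) :
    (laxLast genC genA x).map (fockRep (Fin m)) = laxLast cr an x := by
  rw [laxLast_map]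
  simp only [fockRep_genA, fockRep_genC]

theorem norm_paramBD_lt {h : Fin (rk m) → ℂ} (hh : h ∈ domQBD m) (j : Fin m) :
    ‖paramBD h j‖ < 1 := by
  rw [paramBD, Complex.norm_exp, Real.exp_lt_one_iff, weightBD, Complex.sub_re, sub_neg]
  exact hh j

theorem fullTwist_continuous (l : Fin (m + 2)) :
    Continuous fun h : Fin (rk m) → ℂ => fullTwist h l := by
  rcases idx_cases l with ⟨i, rfl⟩ | ⟨i, rfl⟩ | hl
  · simp only [fullTwist_idx]
    fun_prop
  · simp only [fullTwist_idx_rev]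
    fun_prop
  · simp only [fullTwist_of_le _ hl]
    fun_prop

theorem isOpen_domQBD : IsOpen (domQBD m) := by
  simp only [domQBD, Set.ofPred_forall]
  refine isOpen_iInter_of_finite fun j => ?_
  have := fullTwist_continuous (mid j)
  exact isOpen_lt (by fun_prop) (by fun_prop)

theorem nonempty_domQBD : (domQBD m).Nonempty := by
  refine ⟨Pi.single 0 1, fun j => ?_⟩
  have h0 := mid_ne_zero j
  have h1 := mid_ne_last j
  rcases idx_cases (mid j) with ⟨i, hi⟩ | ⟨i, hi⟩ | hl
  · have h2 : i ≠ 0 := fun h => h0 (by rw [hi, h, idx_zero])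
    rw [hi, fullTwist_idx]
    simp [h2]
  · have h2 : i ≠ 0 := fun h => h1 (by rw [hi, h, idx_zero_rev])
    rw [hi, fullTwist_idx_rev]
    simp [h2]
  · rw [fullTwist_of_le _ hl]
    simp

theorem mem_regQBD_iff {h : Fin (rk m) → ℂ} : h ∈ regQBD m ↔ ∀ j, paramBD h j ≠ 1 := Iff.rfl

theorem domQBD_subset : domQBD m ⊆ regQBD m := by
  intro h hh j h1
  have := norm_paramBD_lt hh j
  rw [paramBD, weightBD, h1] at this
  simp at this

theorem neg_mem_regQBD {h : Fin (rk m) → ℂ} (hh : h ∈ regQBD m) : -h ∈ regQBD m := by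
  rw [mem_regQBD_iff, paramBD_neg] at *
  exact fun j h1 => hh j (inv_eq_one.1 h1)

theorem isRegular_paramBD (j : Fin m) : IsRegular (regQBD m) fun h => paramBD h j := by
  have h0 := isRegular_exp_neg (V := regQBD m) 0
  simp only [paramBD, weightBD, sub_eq_add_neg, Complex.exp_add]
  refine IsRegular.mul ?_ h0
  rcases idx_cases (mid j) with ⟨i, hi⟩ | ⟨i, hi⟩ | hl
  · simp only [hi, fullTwist_idx]
    exact isRegular_exp i
  · simp only [hi, fullTwist_idx_rev]
    exact isRegular_exp_neg i
  · simp only [fullTwist_of_le _ hl]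
    exact isRegular_const _

theorem QfirstBD_spec (x : ℂ) (N : ℕ) :
    IsRatCont (domQBD m) (regQBD m) (fun h => normTrace (twistQBD h) (laxFirst cr an x) N)
        (QfirstBD m N x) ∧
      ∀ h ∈ regQBD m, QfirstBD m N x h = wickMat (oscC (paramBD h)) (laxFirst genC genA x) N := by
  refine ratCont_eq_wickMat isOpen_domQBD nonempty_domQBD domQBD_subset isRegular_paramBD
    (fun h hh => hh) N _ _ fun h hh => ?_
  rw [← (isGeomDiag_twistQBD h).normTrace (norm_paramBD_lt hh) (Complex.exp_ne_zero _),
    map_laxFirst]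

theorem QlastBD_spec (x : ℂ) (N : ℕ) :
    IsRatCont (domQBD m) (regQBD m) (fun h => normTrace (twistQBD h) (laxLast cr an x) N)
        (QlastBD m N x) ∧
      ∀ h ∈ regQBD m, QlastBD m N x h = wickMat (oscC (paramBD h)) (laxLast genC genA x) N := by
  refine ratCont_eq_wickMat isOpen_domQBD nonempty_domQBD domQBD_subset isRegular_paramBD
    (fun h hh => hh) N _ _ fun h hh => ?_
  rw [← (isGeomDiag_twistQBD h).normTrace (norm_paramBD_lt hh) (Complex.exp_ne_zero _),
    map_laxLast]

theorem normTraceConverges_twistQBD {h : Fin (rk m) → ℂ} (hh : h ∈ domQBD m) (x : ℂ) (N : ℕ) :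
    NormTraceConverges (twistQBD h) (laxFirst cr an x : Matrix _ _ (FockOp (Fin m))) N ∧
      NormTraceConverges (twistQBD h) (laxLast cr an x : Matrix _ _ (FockOp (Fin m))) N := by
  rw [← map_laxFirst, ← map_laxLast]
  exact ⟨(isGeomDiag_twistQBD h).normTraceConverges (norm_paramBD_lt hh) (Complex.exp_ne_zero _) _ _,
    (isGeomDiag_twistQBD h).normTraceConverges (norm_paramBD_lt hh) (Complex.exp_ne_zero _) _ _⟩

/-- The weight of an oscillator in the twists of the transfer matrices. -/
def twistWeight (K : Fin (m + 2)) (g : Fin (rk m) → ℂ) (j : Fin m) : ℂ :=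
  if flipBD K j then -weightBD g j else weightBD g j

/-- The exponent of the vacuum eigenvalue of the twists of the transfer matrices. -/
def twistVacuum (K : Fin (m + 2)) (g : Fin (rk m) → ℂ) (t : ℂ) : ℂ :=
  g 0 * t - ∑ j, if flipBD K j then weightBD g j else 0

section Transfer

variable {K : Fin (m + 2)} {π : Equiv.Perm (Fin (m + 2))} {g h : Fin (rk m) → ℂ}

theorem map_laxDiff (t x : ℂ) :
    (conjLax (bhat K) ((laxDiff genC genA (1 - t - ((m : ℂ) + 2) / 2) x).map
      (FreeAlgebra.lift ℂ (flipGen (flipBD K) 1)))).map (fockRep (Fin m)) = laxBD K t x := by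
  rw [conjLax_map, Matrix.map_map, ← AlgHom.coe_comp, fockRep_comp_flipGen_one, laxDiff_map]
  simp only [lift_genA, lift_genC, Sum.elim_inl, Sum.elim_inr]
  rfl

theorem isGeomDiag_twistBD (hB : bhat K = permMat π) (hπ : ∀ l, π l.rev = (π l).rev)
    (hg : ∀ l, fullTwist g (π l) = fullTwist h l) (t : ℂ) :
    IsGeomDiag (twistBD K t h) (Complex.exp (twistVacuum K g t))
      fun j => Complex.exp (twistWeight K g j) := by
  refine isGeomDiag_expDiag ?_
  have h1 : ∀ j, anPH (flipBD K) j * crPH (flipBD K) j = 1 + crPH (flipBD K) j * anPH (flipBD K) j :=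
    fun j => anPH_mul_crPH _ j
  have h2 : ∀ i, cartanBD K t i = cartanDiff (crPH (flipBD K)) (anPH (flipBD K)) t (π (idx i)) := by
    intro i
    rw [cartanBD, laxBD, laxBD, hB, conjLax_permMat, conjLax_permMat]
    exact laxDiff_coeff h1 t (π (idx i))
  rw [Finset.sum_congr rfl fun i _ => congrArg (h i • ·) (h2 i), sum_cartanDiff _ _ t hπ hg,
    twistVacuum, sub_eq_add_neg, add_smul, add_assoc, ← Finset.sum_neg_distrib,
    Finset.sum_smul, ← Finset.sum_add_distrib]
  congr 1
  refine Finset.sum_congr rfl fun j _ => ?_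
  rw [crPH_mul_anPH, twistWeight]
  split_ifs <;> module

end Transfer

end TypeBD

section TypeBD

variable {m : ℕ}

section Transfer

variable {K : Fin (m + 2)} {π : Equiv.Perm (Fin (m + 2))} {g h : Fin (rk m) → ℂ}

theorem norm_exp_lt_one {κ : Type} {w : κ → ℂ} (hw : ∀ j, (w j).re < 0) (j : κ) :
    ‖Complex.exp (w j)‖ < 1 := by
  rw [Complex.norm_exp, Real.exp_lt_one_iff]
  exact hw j

theorem exp_ne_one_of_re_neg {a : ℂ} (ha : a.re < 0) : Complex.exp a ≠ 1 := by
  intro h1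
  have h2 : ‖Complex.exp a‖ = 1 := by rw [h1, norm_one]
  rw [Complex.norm_exp, Real.exp_eq_one_iff] at h2
  exact ha.ne h2

theorem paramBD_eq (K : Fin (m + 2)) (g : Fin (rk m) → ℂ) :
    paramBD g = fun j => if flipBD K j then (Complex.exp (twistWeight K g j))⁻¹
      else Complex.exp (twistWeight K g j) := by
  ext j
  rw [paramBD, twistWeight]
  split_ifs
  · rw [Complex.exp_neg, inv_inv]
  · rfl

theorem mem_regQBD_of_twistWeight (hw : ∀ j, (twistWeight K g j).re < 0) : g ∈ regQBD m := by
  rw [mem_regQBD_iff, paramBD_eq K]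
  intro j
  have := exp_ne_one_of_re_neg (hw j)
  beta_reduce
  split_ifs
  · rwa [Ne, inv_eq_one]
  · exact this

theorem traceConverges_twistBD (hB : bhat K = permMat π) (hπ : ∀ l, π l.rev = (π l).rev)
    (hg : ∀ l, fullTwist g (π l) = fullTwist h l) (hw : ∀ j, (twistWeight K g j).re < 0)
    (t x : ℂ) (N : ℕ) : TraceConverges (twistBD K t h) (laxBD K t x) N := by
  rw [← map_laxDiff]
  exact (isGeomDiag_twistBD hB hπ hg t).traceConverges (norm_exp_lt_one hw) _ _

theorem chBD_eq (hB : bhat K = permMat π) (hπ : ∀ l, π l.rev = (π l).rev)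
    (hg : ∀ l, fullTwist g (π l) = fullTwist h l) (hw : ∀ j, (twistWeight K g j).re < 0) (t : ℂ) :
    chBD K t h =
      Complex.exp (twistVacuum K g t) / ∏ j, (1 - Complex.exp (twistWeight K g j)) := by
  rw [chBD, (isGeomDiag_twistBD hB hπ hg t).trace (norm_exp_lt_one hw), Finset.prod_inv_distrib,
    div_eq_mul_inv]

theorem TBD_eq (hB : bhat K = permMat π) (hπ : ∀ l, π l.rev = (π l).rev)
    (hg : ∀ l, fullTwist g (π l) = fullTwist h l) (hw : ∀ j, (twistWeight K g j).re < 0)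
    (t x : ℂ) (N : ℕ) :
    TBD K N t x h = chBD K t h •
      (conjQ (permMat π) N (QfirstBD m N (x - 1 + t / 2 + ((m : ℂ) + 2) / 4) g) *
        conjQ (permMat π) N (QlastBD m N (x - t / 2 - ((m : ℂ) + 2) / 4) g)) := by
  have hreg := mem_regQBD_of_twistWeight hw
  rw [TBD, ← map_laxDiff, (isGeomDiag_twistBD hB hπ hg t).twistedTrace (norm_exp_lt_one hw), chBD,
    wickMat_conjLax _ (hB ▸ isUnit_permMat π), hB, wickMat_flipGen _ (by norm_num)
      (fun _ => Complex.exp_ne_zero _) (fun j => exp_ne_one_of_re_neg (hw j)), ← paramBD_eq,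
    ← wickMat_laxFirst_mul_laxLast, conjQ_mul (isUnit_permMat π), (QfirstBD_spec _ N).2 g hreg,
    (QlastBD_spec _ N).2 g hreg]
  congr 6 <;> ring

theorem conjQ_revPerm_QfirstBD (hg : g ∈ regQBD m) (π : Equiv.Perm (Fin (m + 2))) (x : ℂ) (N : ℕ) :
    conjQ (permMat (Fin.revPerm * π)) N (QfirstBD m N x (-g)) =
      conjQ (permMat π) N (QlastBD m N x g) := by
  rw [(QfirstBD_spec x N).2 _ (neg_mem_regQBD hg), (QlastBD_spec x N).2 g hg, paramBD_neg,
    wickMat_laxLast_dual (z := paramBD g) (fun _ => Complex.exp_ne_zero _) hg]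

end Transfer

variable (k : Fin (rk m)) (h : Fin (rk m) → ℂ)

theorem flipBD_idx (j : Fin m) : flipBD (idx k) j ↔ mid j ≤ idx k := by
  rw [flipBD, if_pos (idx_lt_rev k k)]

theorem flipBD_idx_rev (j : Fin m) : flipBD (idx k).rev j ↔ ¬ mid j ≤ idx k := by
  rw [flipBD, Fin.rev_rev, if_neg (idx_lt_rev k k).not_gt, not_le]

/-- The weight of the oscillator with index `π_k⁻¹(l)` in the twists labelled by `k` and `k'`. -/
def indexWeight (l : Fin (m + 2)) : ℂ :=
  if l < idx k then h k - fullTwist h l else fullTwist h l - h k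

theorem weightBD_swapTwist (j : Fin m) :
    weightBD (swapTwist k h) j = fullTwist h (idxPerm k (mid j)) - h k := by
  rw [weightBD, fullTwist_idxPerm, swapTwist_zero]

theorem twistWeight_idx (j : Fin m) :
    twistWeight (idx k) (swapTwist k h) j = indexWeight k h (idxPerm k (mid j)) := by
  simp only [twistWeight, flipBD_idx, mid_le_iff, indexWeight, weightBD_swapTwist, neg_sub]

theorem twistWeight_idx_rev (j : Fin m) :
    twistWeight (idx k).rev (-swapTwist k h) j = indexWeight k h (idxPerm k (mid j)) := by
  simp only [twistWeight, flipBD_idx_rev, mid_le_iff, indexWeight, weightBD_neg,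
    weightBD_swapTwist, neg_sub, ite_not]

theorem not_lt_of_middle {l : Fin (m + 2)} (hl : rk m ≤ l.1 ∧ rk m ≤ l.rev.1) (k : Fin (rk m)) :
    ¬ l < idx k := fun h => by
  have h1 : l.1 < k.1 := h
  have h2 := k.2
  omega

variable {k h} in
theorem indexWeight_re_neg (hh : h ∈ domBD k) {l : Fin (m + 2)} (h1 : l ≠ idx k)
    (h2 : l ≠ (idx k).rev) : (indexWeight k h l).re < 0 := by
  obtain ⟨H1, H2, H3, H4⟩ := hh
  rw [indexWeight]
  rcases idx_cases l with ⟨i, rfl⟩ | ⟨i, rfl⟩ | hl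
  · have h3 : i ≠ k := fun h => h1 (by rw [h])
    rw [fullTwist_idx]
    split_ifs with h4
    · rw [Complex.sub_re, sub_neg]
      exact H1 i h4
    · rw [Complex.sub_re, sub_neg]
      exact H2 i (lt_of_le_of_ne (not_lt.1 h4) h3.symm)
  · have h3 : i ≠ k := fun h => h2 (by rw [h])
    have h4 := H3 i h3
    rw [if_neg (idx_lt_rev k i).not_gt, fullTwist_idx_rev, Complex.sub_re, Complex.neg_re]
    rw [Complex.add_re] at h4
    linarith
  · have h4 := H4 (odd_of_le hl)
    rw [if_neg (not_lt_of_middle hl k),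
      fullTwist_of_le h hl, zero_sub, Complex.neg_re]
    linarith

theorem middle_bounds (hm : Odd m) : rk m ≤ (⟨rk m, rk_lt⟩ : Fin (m + 2)).1 ∧
    rk m ≤ (⟨rk m, rk_lt⟩ : Fin (m + 2)).rev.1 := by
  have := rk_bounds (m := m)
  rw [Nat.odd_iff] at hm
  exact ⟨le_rfl, by change _ ≤ m + 2 - (rk m + 1); omega⟩

theorem prod_indexWeight :
    ∏ j, (1 - Complex.exp (indexWeight k h (idxPerm k (mid j)))) = denBD k h := by
  have h1 : ∀ j, 1 - Complex.exp (indexWeight k h (idxPerm k (mid j))) =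
      (fun l => if l = idx k ∨ l = (idx k).rev then 1 else 1 - Complex.exp (indexWeight k h l))
        (idxPerm k (mid j)) := fun j => by
    beta_reduce
    rw [if_neg (not_or.2 (idxPerm_mid_ne k j))]
  rw [Finset.prod_congr rfl fun j _ => h1 j, prod_idxPerm_mid k
    (f := fun l => if l = idx k ∨ l = (idx k).rev then 1 else 1 - Complex.exp (indexWeight k h l))
    (by simp) (by simp), denBD]
  have h2 : ∀ i, (if idx i = idx k ∨ idx i = (idx k).rev then 1 else
      1 - Complex.exp (indexWeight k h (idx i))) =
      (if i < k then 1 - Complex.exp (h k - h i) else 1) *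
        if k < i then 1 - Complex.exp (h i - h k) else 1 := by
    intro i
    rw [indexWeight, fullTwist_idx]
    rcases lt_trichotomy i k with hi | rfl | hi
    · rw [if_neg (not_or.2 ⟨idx_injective.ne hi.ne, idx_ne_rev i k⟩),
        if_pos (show idx i < idx k from hi), if_pos hi, if_neg hi.not_gt, mul_one]
    · simp
    · rw [if_neg (not_or.2 ⟨idx_injective.ne hi.ne', idx_ne_rev i k⟩),
        if_neg (show ¬ idx i < idx k from hi.not_gt), if_neg hi.not_gt, if_pos hi, one_mul]
  have h3 : ∀ i, (if (idx i).rev = idx k ∨ (idx i).rev = (idx k).rev then 1 else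
      1 - Complex.exp (indexWeight k h (idx i).rev)) =
      if i ≠ k then 1 - Complex.exp (-(h k + h i)) else 1 := by
    intro i
    rcases eq_or_ne i k with rfl | hi
    · simp
    · rw [if_neg (not_or.2 ⟨(idx_ne_rev k i).symm, Fin.rev_injective.ne (idx_injective.ne hi)⟩),
        if_pos hi, indexWeight, if_neg (idx_lt_rev k i).not_gt, fullTwist_idx_rev, add_comm, neg_add']
  have h4 : (if Odd m then if (⟨rk m, rk_lt⟩ : Fin (m + 2)) = idx k ∨
      (⟨rk m, rk_lt⟩ : Fin (m + 2)) = (idx k).rev then 1 else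
      1 - Complex.exp (indexWeight k h ⟨rk m, rk_lt⟩) else 1) =
      if Odd m then 1 - Complex.exp (-h k) else 1 := by
    refine if_ctx_congr Iff.rfl (fun hm => ?_) fun _ => rfl
    have hl := middle_bounds hm
    rw [if_neg (not_or.2 ⟨ne_idx_of_le hl k, ne_rev_of_le hl k⟩), indexWeight,
      if_neg (not_lt_of_middle hl k),
      fullTwist_of_le h hl, zero_sub]
  simp only [h2, h3, h4, Finset.prod_mul_distrib]
  ring

theorem sum_weightBD_flip :
    ∑ j, (if mid j ≤ idx k then weightBD (swapTwist k h) j else 0) =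
      ∑ l ∈ Finset.Iio k, h l - (k : ℕ) * h k := by
  simp only [mid_le_iff, weightBD_swapTwist]
  rw [sum_idxPerm_mid k (f := fun l => if l < idx k then fullTwist h l - h k else 0) (by simp)
    (by rw [if_neg (idx_lt_rev k k).not_gt])]
  have h1 : ∀ i, (if idx i < idx k then fullTwist h (idx i) - h k else 0) =
      if i < k then h i - h k else 0 := fun i => by
    rw [fullTwist_idx]
    rfl
  have h2 : ∀ i : Fin (rk m), (if (idx i).rev < idx k then fullTwist h (idx i).rev - h k else 0) = 0 :=
    fun i => if_neg (idx_lt_rev k i).not_gt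
  have h3 : ¬ (⟨rk m, rk_lt⟩ : Fin (m + 2)) < idx k := fun h => absurd (lt_trans h k.2) (lt_irrefl _)
  simp only [h1, h2, if_neg h3, Finset.sum_const_zero, ite_self, add_zero]
  rw [← Finset.sum_filter, Finset.filter_gt_eq_Iio, Finset.sum_sub_distrib, Finset.sum_const,
    Fin.card_Iio, nsmul_eq_mul]

theorem sum_weightBD_swapTwist : ∑ j, weightBD (swapTwist k h) j = -(m : ℂ) * h k := by
  have h1 : ∑ j : Fin m, fullTwist (swapTwist k h) (mid j) =
      -∑ j : Fin m, fullTwist (swapTwist k h) (mid j) := by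
    conv_lhs => rw [← Equiv.sum_comp Fin.revPerm]
    rw [← Finset.sum_neg_distrib]
    refine Finset.sum_congr rfl fun j _ => ?_
    rw [Fin.revPerm_apply, ← rev_mid, fullTwist_rev]
  simp only [weightBD, Finset.sum_sub_distrib, Finset.sum_const, Finset.card_univ,
    Fintype.card_fin, nsmul_eq_mul, swapTwist_zero]
  rw [self_eq_neg.1 h1]
  ring

theorem twistVacuum_idx (t : ℂ) : twistVacuum (idx k) (swapTwist k h) t =
    -(∑ l ∈ Finset.Iio k, h l) + (t + (k : ℕ)) * h k := by
  simp only [twistVacuum, flipBD_idx, sum_weightBD_flip, swapTwist_zero]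
  ring

theorem twistVacuum_idx_rev (t : ℂ) : twistVacuum (idx k).rev (-swapTwist k h) t =
    -(∑ l ∈ Finset.Iio k, h l) + ((k : ℕ) - (m : ℂ) - t) * h k := by
  have h1 : ∀ j, (if ¬ mid j ≤ idx k then -weightBD (swapTwist k h) j else 0) =
      (if mid j ≤ idx k then weightBD (swapTwist k h) j else 0) - weightBD (swapTwist k h) j := by
    intro j
    split_ifs <;> ring
  simp only [twistVacuum, flipBD_idx_rev, weightBD_neg, h1, Finset.sum_sub_distrib,
    sum_weightBD_flip, sum_weightBD_swapTwist, Pi.neg_apply, swapTwist_zero]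
  ring

theorem typeBD (m N : ℕ) :
      (∀ (x : ℂ),
        (∀ h ∈ domQBD m,
          NormTraceConverges (twistQBD h) (laxFirst cr an x : Matrix _ _ (FockOp (Fin m))) N ∧
          NormTraceConverges (twistQBD h) (laxLast cr an x : Matrix _ _ (FockOp (Fin m))) N) ∧
        IsRatCont (domQBD m) (regQBD m) (fun h => normTrace (twistQBD h) (laxFirst cr an x) N)
          (QfirstBD m N x) ∧
        IsRatCont (domQBD m) (regQBD m) (fun h => normTrace (twistQBD h) (laxLast cr an x) N)
          (QlastBD m N x)) ∧
      ∀ (k : Fin (rk m)) (t x : ℂ), ∀ h ∈ domBD k,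
        TraceConverges (twistBD (idx k) t h) (laxBD (idx k) t x) N ∧
        TraceConverges (twistBD (idx k).rev t h) (laxBD (idx k).rev t x) N ∧
        chBD (idx k) t h =
          Complex.exp (-(∑ l ∈ Finset.Iio k, h l) + (t + (k : ℕ)) * h k) / denBD k h ∧
        chBD (idx k).rev t h =
          Complex.exp (-(∑ l ∈ Finset.Iio k, h l) + ((k : ℕ) - (m : ℂ) - t) * h k) / denBD k h ∧
        QBD' k N x h = conjQ (bhat (idx k)) N (QlastBD m N x (swapTwist k h)) ∧
        QBD k N x h = conjQ (bhat (idx k).rev) N (QlastBD m N x (-swapTwist k h)) ∧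
        TBD (idx k) N t x h = chBD (idx k) t h •
          (QBD k N (x - 1 + t / 2 + ((m : ℂ) + 2) / 4) h *
            QBD' k N (x - t / 2 - ((m : ℂ) + 2) / 4) h) ∧
        TBD (idx k).rev N t x h = chBD (idx k).rev t h •
          (QBD' k N (x - 1 + t / 2 + ((m : ℂ) + 2) / 4) h *
            QBD k N (x - t / 2 - ((m : ℂ) + 2) / 4) h) := by
  refine ⟨fun x => ⟨fun h hh => normTraceConverges_twistQBD hh x N, (QfirstBD_spec x N).1,
    (QlastBD_spec x N).1⟩, fun k t x h hh => ?_⟩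
  have hB := bhat_idx k
  have hB' := bhat_idx_rev k
  have hπ := idxPerm_apply_rev k
  have hπ' : ∀ l, (Fin.revPerm * idxPerm k : Equiv.Perm (Fin (m + 2))) l.rev = ((Fin.revPerm * idxPerm k : Equiv.Perm (Fin (m + 2))) l).rev := fun l => by
    simp [hπ]
  have hg : ∀ l, fullTwist (swapTwist k h) (idxPerm k l) = fullTwist h l := fun l => by
    rw [fullTwist_idxPerm, swapTwist_swapTwist]
  have hg' : ∀ l, fullTwist (-swapTwist k h) ((Fin.revPerm * idxPerm k : Equiv.Perm (Fin (m + 2))) l) = fullTwist h l :=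
    fun l => by
      rw [Equiv.Perm.mul_apply, Fin.revPerm_apply, fullTwist_rev, fullTwist_neg, neg_neg, hg]
  have hw0 : ∀ j, (indexWeight k h (idxPerm k (mid j))).re < 0 := fun j =>
    indexWeight_re_neg hh (idxPerm_mid_ne k j).1 (idxPerm_mid_ne k j).2
  have hw : ∀ j, (twistWeight (idx k) (swapTwist k h) j).re < 0 := fun j => by
    rw [twistWeight_idx]
    exact hw0 j
  have hw' : ∀ j, (twistWeight (idx k).rev (-swapTwist k h) j).re < 0 := fun j => by
    rw [twistWeight_idx_rev]
    exact hw0 j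
  have hreg := mem_regQBD_of_twistWeight hw
  have hQ' : ∀ x, QBD' k N x h = conjQ (permMat (idxPerm k)) N (QlastBD m N x (swapTwist k h)) :=
    fun x => by rw [QBD', hB', conjQ_revPerm_QfirstBD hreg]
  have hQ : ∀ x, QBD k N x h =
      conjQ (permMat (Fin.revPerm * idxPerm k)) N (QlastBD m N x (-swapTwist k h)) := fun x => by
    have h1 : (Fin.revPerm : Equiv.Perm (Fin (m + 2))) * Fin.revPerm = 1 := by ext; simp
    rw [← conjQ_revPerm_QfirstBD (neg_mem_regQBD hreg), neg_neg, ← mul_assoc, h1, one_mul, QBD, hB]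
  refine ⟨traceConverges_twistBD hB hπ hg hw t x N, traceConverges_twistBD hB' hπ' hg' hw' t x N,
    ?_, ?_, ?_, ?_, ?_, ?_⟩
  · rw [chBD_eq hB hπ hg hw, twistVacuum_idx]
    simp only [twistWeight_idx, prod_indexWeight]
  · rw [chBD_eq hB' hπ' hg' hw', twistVacuum_idx_rev]
    simp only [twistWeight_idx_rev, prod_indexWeight]
  · rw [hQ', hB]
  · rw [hQ, hB']
  · rw [TBD_eq hB hπ hg hw, hQ', QBD, hB]
  · rw [TBD_eq hB' hπ' hg' hw', hQ, QBD', hB']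

end TypeBD

end BaxterQ

end

theorem theorem3 :
    -- Type A
    (∀ (n N : ℕ) (I : Finset (Fin n)), 1 ≤ I.card → I.card < n →
      ∀ (t x : ℂ), ∀ h ∈ domA I,
        TraceConverges (twistA I t h) (laxA I t x) N ∧
        NormTraceConverges (twistQA I h) (laxQA I (x + t)) N ∧
        NormTraceConverges (twistQA Iᶜ h) (laxQA Iᶜ (x - (I.card : ℂ))) N ∧
        chA I t h = (∏ i ∈ I, Complex.exp (t * h i)) *
          ∏ i ∈ I, ∏ j ∈ Iᶜ, (if j < i then -1 else 1) * Complex.exp (h i) /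
            (Complex.exp (h i) - Complex.exp (h j)) ∧
        TA I N t x h = chA I t h • (QA I N (x + t) h * QA Iᶜ N (x - (I.card : ℂ)) h)) ∧
    -- Type C
    (∀ (r N : ℕ), 1 ≤ r →
      (∀ (x : ℂ),
        (∀ h ∈ domQC r, NormTraceConverges (twistQC h) (laxPlusC r x) N ∧
          NormTraceConverges (twistQC h) (laxMinusC r x) N) ∧
        IsRatCont (domQC r) (regQC r) (fun h => normTrace (twistQC h) (laxPlusC r x) N)
          (QplusC r N x) ∧
        IsRatCont (domQC r) (regQC r) (fun h => normTrace (twistQC h) (laxMinusC r x) N)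
          (QminusC r N x)) ∧
      ∀ (μ : Fin r → ℤˣ) (t x : ℂ), ∀ h ∈ domC μ,
        TraceConverges (twistC μ t h) (laxC μ t x) N ∧
        chC μ t h =
          Complex.exp (∑ i : Fin r, sgn μ i * (t + ((r : ℂ) - (i : ℕ)) * neg μ i
            + ∑ k ∈ Finset.Iic i, neg μ k) * h i) /
          ∏ p : OscC r, (1 - Complex.exp (-(h p.1.1 + sgn μ p.1.1 * sgn μ p.1.2 * h p.1.2))) ∧
        QC (-μ) N x h = conjQ (weylMat (-1) μ) N (QminusC r N x (flipTwist μ h)) ∧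
        TC μ N t x h = chC μ t h • (QC μ N (x + t) h * QC (-μ) N (x - t - r - 1) h)) ∧
    -- Type D, spinorial nodes
    (∀ (r N : ℕ), 2 ≤ r →
      (∀ (x : ℂ),
        (∀ h ∈ domQD r, NormTraceConverges (twistQD h) (laxPlusD r x) N ∧
          NormTraceConverges (twistQD h) (laxMinusD r x) N) ∧
        IsRatCont (domQD r) (regQD r) (fun h => normTrace (twistQD h) (laxPlusD r x) N)
          (QplusD r N x) ∧
        IsRatCont (domQD r) (regQD r) (fun h => normTrace (twistQD h) (laxMinusD r x) N)
          (QminusD r N x)) ∧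
      ∀ (μ : Fin r → ℤˣ) (t x : ℂ), ∀ h ∈ domD μ,
        TraceConverges (twistD μ t h) (laxD μ t x) N ∧
        chD μ t h =
          Complex.exp (∑ i : Fin r, sgn μ i * (t + ((r : ℂ) - (i : ℕ) - 2) * neg μ i
            + ∑ k ∈ Finset.Iic i, neg μ k) * h i) /
          ∏ p : OscD r, (1 - Complex.exp (-(h p.1.1 + sgn μ p.1.1 * sgn μ p.1.2 * h p.1.2))) ∧
        QD (-μ) N x h = conjQ (weylMat 1 μ) N (QminusD r N x (flipTwist μ h)) ∧
        TD μ N t x h = chD μ t h • (QD μ N (x + t) h * QD (-μ) N (x - t - r + 1) h)) ∧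
    -- Types B and D, first node, K = m + 2
    (∀ (m N : ℕ), 3 ≤ m →
      (∀ (x : ℂ),
        (∀ h ∈ domQBD m,
          NormTraceConverges (twistQBD h) (laxFirst cr an x : Matrix _ _ (FockOp (Fin m))) N ∧
          NormTraceConverges (twistQBD h) (laxLast cr an x : Matrix _ _ (FockOp (Fin m))) N) ∧
        IsRatCont (domQBD m) (regQBD m) (fun h => normTrace (twistQBD h) (laxFirst cr an x) N)
          (QfirstBD m N x) ∧
        IsRatCont (domQBD m) (regQBD m) (fun h => normTrace (twistQBD h) (laxLast cr an x) N)
          (QlastBD m N x)) ∧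
      ∀ (k : Fin (rk m)) (t x : ℂ), ∀ h ∈ domBD k,
        TraceConverges (twistBD (idx k) t h) (laxBD (idx k) t x) N ∧
        TraceConverges (twistBD (idx k).rev t h) (laxBD (idx k).rev t x) N ∧
        chBD (idx k) t h =
          Complex.exp (-(∑ l ∈ Finset.Iio k, h l) + (t + (k : ℕ)) * h k) / denBD k h ∧
        chBD (idx k).rev t h =
          Complex.exp (-(∑ l ∈ Finset.Iio k, h l) + ((k : ℕ) - (m : ℂ) - t) * h k) / denBD k h ∧
        QBD' k N x h = conjQ (bhat (idx k)) N (QlastBD m N x (swapTwist k h)) ∧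
        QBD k N x h = conjQ (bhat (idx k).rev) N (QlastBD m N x (-swapTwist k h)) ∧
        TBD (idx k) N t x h = chBD (idx k) t h •
          (QBD k N (x - 1 + t / 2 + ((m : ℂ) + 2) / 4) h *
            QBD' k N (x - t / 2 - ((m : ℂ) + 2) / 4) h) ∧
        TBD (idx k).rev N t x h = chBD (idx k).rev t h •
          (QBD' k N (x - 1 + t / 2 + ((m : ℂ) + 2) / 4) h *
            QBD k N (x - t / 2 - ((m : ℂ) + 2) / 4) h)) := by
  refine ⟨fun n N I _ _ t x h hh => typeA I N t x hh, fun r N _ => typeC r N, fun r N _ => typeD r N,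
    fun m N _ => typeBD m N⟩
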